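/- **Definitions.** All Hopf algebras are over $\mathbb{C}$. A basis $B$ of a finite-dimensional Hopf algebra $H$ is *positive* if all structure constants of $H$ relative to $B$ (multiplication, unit, comultiplication, counit, antipode) are non-negative real numbers. A *quasi-triangular structure* on $H$ is an invertible $R\in H\otimes H$ with $\tau\Delta(g)=R\,\Delta(g)R^{-1}$ for all $g\in H$, $(\Delta\otimes\mathrm{id})R=R_{13}R_{23}$, $(\mathrm{id}\otimes\Delta)R=R_{13}R_{12}$ and $(\varepsilon\otimes\mathrm{id})R=(\mathrm{id}\otimes\varepsilon)R=1$, where $\tau(a\otimes b)=b\otimes a$. It is *triangular* if moreover $(\tau R)R=1\otimes 1$, and *positive* if its coefficients in the basis $B\otimes B$ are non-negative real numbers. A *unique factorization* $G=G_+G_-$ of a group consists of two subgroups such that every $g\in G$ is $g=g_+g_-$ for unique $g_\pm\in G_\pm$. For $u\in G_+$, $x\in G_-$ define ${}^xu,\,u^x\in G_+$ and $x^u,\,{}^ux\in G_-$ by $xu=({}^xu)(x^u)$ and $ux=({}^ux)(u^x)$. If $G$ is finite, $H(G;G_+,G_-)$ is the Hopf algebra with basis $\{g\}$, $g\in G$,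 and $$\{g\}\{h\}=\delta_{g_+^{g_-},\,h_+}\{gh_-\},\quad 1=\sum_{u\in G_+}\{u\},\quad \Delta\{g\}=\sum_{h\in G_+}\{g_+h^{-1}({}^{h}g_-)\}\otimes\{hg_-\},\quad \varepsilon\{g\}=\delta_{g_+,e},\quad S\{g\}=\{g^{-1}\}.$$ For homomorphisms $\xi,\eta:G_+\to G_-$ put $$R_{\xi,\eta}=\sum_{u,v\in G_+}\{u(\eta(v)^u)^{-1}\}\otimes\{v\xi(u)\},\qquad R_\xi=R_{\xi,\xi}.$$ If a group $G_-$ acts on a group $A$ by automorphisms, a *1-cycle* is a map $\zeta:A\to G_-$ with $\zeta(a)\zeta(b)=\zeta(a(\zeta(a)\cdot b))$ for all $a,b\in A$. **Theorem 4.** The following data are in one-to-one correspondence, up to isomorphism: 1. a finite-dimensional Hopf algebra $H$ with a positive basis $B$ and a positive triangular structure $R$; 2. a unique factorization $G=G_+G_-$ of a finite group and a homomorphism $\xi:G_+\to G_-$ such that $A=\{u\xi(u^{-1}):u\in G_+\}$ is an abelian normal subgroup of $G$; 3. a unique factorization $G=G_+G_-$ of a finite group and a homomorphism $\xi:G_+\to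 G_-$ satisfying $uv=({}^{\xi(u)}v)(u^{\xi(v)})$ and $\xi({}^xu)\,x^u=x\,\xi(u)$ for all $u,v\in G_+$, $x\in G_-$; 4. a finite group $G_-$, a finite abelian group $A$ on which $G_-$ acts by automorphisms, and a 1-cycle $\zeta:A\to G_-$. Here an isomorphism in (1) is an isomorphism of Hopf algebras carrying $R$ to $R'$ and $B$ to $B'$ up to multiplying the basis elements by positive real numbers; in (2) and (3) it is a group isomorphism compatible with $G_+$, $G_-$ and $\xi$; in (4) it is a pair of group isomorphisms compatible with the actions and with $\zeta$. The correspondence is as follows. To $(G=G_+G_-,\xi)$ as in (2) corresponds $(H(G;G_+,G_-),\,G,\,R_\xi)$ in (1); the same pair $(G=G_+G_-,\xi)$ in (3); and, in (4), $A=\{u\xi(u^{-1})\}$ with $G_-$ acting by conjugation and $\zeta(u\xi(u^{-1}))=\xi(u)$. Inversely, to $(G_-,A,\zeta)$ corresponds $G=A\rtimes G_-$ with $G_+=\{a\zeta(a):a\in A\}$ and $\xi$ the restriction to $G_+$ of the projection $ax\mapsto x$. Moreover, for a fixed unique factorization $G=G_+G_-$ of a finite group: (i) $\xi\mapsto R_\xi$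 is a bijection from the homomorphisms as in (2) onto the positive triangular structures on $H(G;G_+,G_-)$ with basis $G$; (ii) a homomorphism $\xi$ satisfies the condition in (2) if and only if it satisfies the conditions in (3); (iii) if $\xi,\eta:G_+\to G_-$ are homomorphisms such that $G_+'=\{u\xi(u^{-1}):u\in G_+\}$ and $G_+''=\{\eta(u^{-1})u:u\in G_+\}$ are normal subgroups of $G$ and $u\xi(u^{-1})\mapsto\eta(u)u^{-1}$ is a group isomorphism $G_+'\to G_+''$, then $R_{\xi,\eta}$ is triangular if and only if $\xi=\eta$. -/

import Mathlib

open scoped TensorProduct ComplexOrder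

universe u v

noncomputable section

/-! ### Unique factorizations of groups and the induced actions -/

/-- A unique factorization `G = G₊ G₋`: every `g` is `u * x` for unique `u ∈ pos`, `x ∈ neg`. -/
structure UniqueFactorization (G : Type u) [Group G] where
  pos : Subgroup G
  neg : Subgroup G
  isComplement : pos.IsComplement' neg

namespace UniqueFactorization

variable {G : Type u} [Group G] (F : UniqueFactorization G)

/-- `g₊`, where `g = g₊ g₋`. -/
def posPart (g : G) : F.pos := (Subgroup.IsComplement.equiv F.isComplement g).1

/-- `g₋`, where `g = g₊ g₋`. -/
def negPart (g : G) : F.neg := (Subgroup.IsComplement.equiv F.isComplement g).2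

/-- `ḡ₊`, where `g = ḡ₋ ḡ₊`; see `negBar_mul_posBar`. -/
def posBar (g : G) : F.pos := (F.posPart g⁻¹)⁻¹

/-- `ḡ₋`, where `g = ḡ₋ ḡ₊`; see `negBar_mul_posBar`. -/
def negBar (g : G) : F.neg := (F.negPart g⁻¹)⁻¹

/-- `ˣu`: the `G₊`-part of `x u = (ˣu)(xᵘ)`. -/
def negOnPos (x : F.neg) (u : F.pos) : F.pos := F.posPart (x * u : G)

/-- `xᵘ`: the `G₋`-part of `x u = (ˣu)(xᵘ)`. -/
def negPow (x : F.neg) (u : F.pos) : F.neg := F.negPart (x * u : G)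

/-- `uˣ`: the `G₊`-part of `u x = (ᵘx)(uˣ)`. -/
def posPow (u : F.pos) (x : F.neg) : F.pos := F.posBar (u * x : G)

/-- `ᵘx`: the `G₋`-part of `u x = (ᵘx)(uˣ)`. -/
def posOnNeg (u : F.pos) (x : F.neg) : F.neg := F.negBar (u * x : G)

theorem posPart_mul_negPart (g : G) : (F.posPart g * F.negPart g : G) = g :=
  Subgroup.IsComplement.equiv_fst_mul_equiv_snd F.isComplement g

theorem equiv_mul (u : F.pos) (x : F.neg) :
    Subgroup.IsComplement.equiv F.isComplement (u * x : G) = (u, x) :=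
  (Subgroup.IsComplement.equiv F.isComplement).apply_symm_apply (u, x)

theorem posPart_mul (u : F.pos) (x : F.neg) : F.posPart (u * x : G) = u := by
  rw [posPart, equiv_mul]

theorem negPart_mul (u : F.pos) (x : F.neg) : F.negPart (u * x : G) = x := by
  rw [negPart, equiv_mul]

theorem posPart_eq {g : G} (u : F.pos) (x : F.neg) (h : g = u * x) : F.posPart g = u := by
  rw [h, posPart_mul]

theorem negPart_eq {g : G} (u : F.pos) (x : F.neg) (h : g = u * x) : F.negPart g = x := by
  rw [h, negPart_mul]

theorem negBar_mul_posBar (g : G) : (F.negBar g * F.posBar g : G) = g := by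
  have h := F.posPart_mul_negPart g⁻¹
  rw [negBar, posBar, Subgroup.coe_inv, Subgroup.coe_inv, ← mul_inv_rev, h, inv_inv]

theorem posBar_eq {g : G} (x : F.neg) (u : F.pos) (h : g = x * u) : F.posBar g = u := by
  rw [posBar, F.posPart_eq u⁻¹ x⁻¹ (by simp [h]), inv_inv]

theorem negBar_eq {g : G} (x : F.neg) (u : F.pos) (h : g = x * u) : F.negBar g = x := by
  rw [negBar, F.negPart_eq u⁻¹ x⁻¹ (by simp [h]), inv_inv]

/-- `u x = (ᵘx)(uˣ)`. -/
theorem posOnNeg_mul_posPow (u : F.pos) (x : F.neg) :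
    (F.posOnNeg u x * F.posPow u x : G) = u * x :=
  F.negBar_mul_posBar _

theorem posPow_one (u : F.pos) : F.posPow u 1 = u :=
  F.posBar_eq 1 u (by simp)

theorem one_posPow (x : F.neg) : F.posPow 1 x = 1 := F.posBar_eq x 1 (by simp)

theorem one_posOnNeg (x : F.neg) : F.posOnNeg 1 x = x := F.negBar_eq x 1 (by simp)

theorem posOnNeg_one (u : F.pos) : F.posOnNeg u 1 = 1 := F.negBar_eq 1 u (by simp)

theorem posPow_mul (u : F.pos) (x y : F.neg) :
    F.posPow u (x * y) = F.posPow (F.posPow u x) y := by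
  refine F.posBar_eq (F.posOnNeg u x * F.posOnNeg (F.posPow u x) y) _ ?_
  rw [Subgroup.coe_mul, Subgroup.coe_mul, mul_assoc, posOnNeg_mul_posPow, ← mul_assoc, ← mul_assoc,
    posOnNeg_mul_posPow]

theorem posOnNeg_mul (u : F.pos) (x y : F.neg) :
    F.posOnNeg u (x * y) = F.posOnNeg u x * F.posOnNeg (F.posPow u x) y := by
  refine F.negBar_eq _ (F.posPow (F.posPow u x) y) ?_
  rw [Subgroup.coe_mul, Subgroup.coe_mul, mul_assoc, posOnNeg_mul_posPow, ← mul_assoc, ← mul_assoc,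
    posOnNeg_mul_posPow]

theorem mul_posOnNeg (u v : F.pos) (x : F.neg) :
    F.posOnNeg (u * v) x = F.posOnNeg u (F.posOnNeg v x) := by
  refine F.negBar_eq _ (F.posPow u (F.posOnNeg v x) * F.posPow v x) ?_
  rw [Subgroup.coe_mul, Subgroup.coe_mul, ← mul_assoc, posOnNeg_mul_posPow, mul_assoc, mul_assoc,
    posOnNeg_mul_posPow]

theorem mul_posPow (u v : F.pos) (x : F.neg) :
    F.posPow (u * v) x = F.posPow u (F.posOnNeg v x) * F.posPow v x := by
  refine F.posBar_eq (F.posOnNeg u (F.posOnNeg v x)) _ ?_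
  rw [Subgroup.coe_mul, Subgroup.coe_mul, ← mul_assoc, posOnNeg_mul_posPow, mul_assoc, mul_assoc,
    posOnNeg_mul_posPow]

/-- The right action of `x` on `G₊` as a permutation. -/
def posPowEquiv (x : F.neg) : F.pos ≃ F.pos where
  toFun u := F.posPow u x
  invFun u := F.posPow u x⁻¹
  left_inv u := by simp only [← posPow_mul, mul_inv_cancel, posPow_one]
  right_inv u := by simp only [← posPow_mul, inv_mul_cancel, posPow_one]

theorem posPow_eq_one_iff (u : F.pos) (x : F.neg) : F.posPow u x = 1 ↔ u = 1 := by
  have h := (F.posPowEquiv x).injective.eq_iff (a := u) (b := 1)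
  simpa only [posPowEquiv, Equiv.coe_fn_mk, one_posPow] using h

theorem posPow_inv (p : F.pos) (x : F.neg) :
    F.posPow (F.posPow p x)⁻¹ (F.posOnNeg p x)⁻¹ = p⁻¹ := by
  refine F.posBar_eq x⁻¹ _ ?_
  simp only [Subgroup.coe_inv]
  rw [← mul_inv_rev, ← mul_inv_rev, posOnNeg_mul_posPow]

theorem inv_posPow (p : F.pos) (x : F.neg) :
    F.posPow p⁻¹ (F.posOnNeg p x) = (F.posPow p x)⁻¹ := by
  have h := F.mul_posPow p⁻¹ p x
  rw [inv_mul_cancel, one_posPow] at h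
  exact eq_inv_of_mul_eq_one_left h.symm

theorem posOnNeg_cancel (p q : F.pos) (x : F.neg) :
    F.posOnNeg (p * q⁻¹) (F.posOnNeg q x) = F.posOnNeg p x := by
  rw [← mul_posOnNeg, inv_mul_cancel_right]

instance fintypePos [Finite G] : Fintype F.pos := Fintype.ofFinite _

instance decidableEqPos : DecidableEq F.pos := Classical.decEq _

end UniqueFactorization

/-! ### The bicrossproduct Hopf algebra `H(G; G₊, G₋)` -/

/-- The underlying vector space of `H(G; G₊, G₋)`, spanned by the set `G`. -/
def Bicross {G : Type u} [Group G] (_F : UniqueFactorization G) : Type u := G →₀ ℂ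

namespace Bicross

variable {G : Type u} [Group G] (F : UniqueFactorization G)

instance : AddCommGroup (Bicross F) := inferInstanceAs (AddCommGroup (G →₀ ℂ))
instance : Module ℂ (Bicross F) := inferInstanceAs (Module ℂ (G →₀ ℂ))

/-- The basis `G` of `H(G; G₊, G₋)`; `basis F g` is the element written `{g}`. -/
def basis : Module.Basis G ℂ (Bicross F) := ⟨LinearEquiv.refl ℂ (G →₀ ℂ)⟩

/-- Multiplication: `{g}{h} = {g h₋}` if `g₊ ^ g₋ = h₊`, and `0` otherwise. -/
def mulMap : Bicross F →ₗ[ℂ] Bicross F →ₗ[ℂ] Bicross F :=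
  (basis F).constr ℂ fun g => (basis F).constr ℂ fun h =>
    if F.posPow (F.posPart g) (F.negPart g) = F.posPart h then basis F (g * F.negPart h) else 0

/-- Counit: `ε{g} = 1` if `g₊ = e`, and `0` otherwise. -/
def counitMap : Bicross F →ₗ[ℂ] ℂ :=
  (basis F).constr ℂ fun g => if F.posPart g = 1 then 1 else 0

/-- Antipode: `S{g} = {g⁻¹}`. -/
def antipodeMap : Bicross F →ₗ[ℂ] Bicross F :=
  (basis F).constr ℂ fun g => basis F g⁻¹

/-- The basis element `{u x}`, for `u ∈ G₊` and `x ∈ G₋`. -/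
def el (p : F.pos) (x : F.neg) : Bicross F := basis F (p * x : G)

theorem basis_eq_el (g : G) : basis F g = el F (F.posPart g) (F.negPart g) := by
  rw [el, F.posPart_mul_negPart]

theorem ext_el {M : Type v} [AddCommMonoid M] [Module ℂ M] {f f' : Bicross F →ₗ[ℂ] M}
    (h : ∀ p x, f (el F p x) = f' (el F p x)) : f = f' :=
  (basis F).ext fun g => by rw [basis_eq_el]; exact h _ _

theorem mulMap_el (p q : F.pos) (x y : F.neg) :
    mulMap F (el F p x) (el F q y) = if F.posPow p x = q then el F p (x * y) else 0 := by
  simp only [mulMap, el, Module.Basis.constr_basis, F.posPart_mul, F.negPart_mul,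
    Subgroup.coe_mul, mul_assoc]

theorem counitMap_el (p : F.pos) (x : F.neg) :
    counitMap F (el F p x) = if p = 1 then 1 else 0 := by
  simp only [counitMap, el, Module.Basis.constr_basis, F.posPart_mul]

theorem antipodeMap_el (p : F.pos) (x : F.neg) :
    antipodeMap F (el F p x) = el F (F.posPow p x)⁻¹ (F.posOnNeg p x)⁻¹ := by
  simp only [antipodeMap, el, Module.Basis.constr_basis, Subgroup.coe_inv]
  rw [← F.posOnNeg_mul_posPow, mul_inv_rev]

theorem mulMap_assoc (a b c : Bicross F) :
    mulMap F (mulMap F a b) c = mulMap F a (mulMap F b c) := by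
  have key : (mulMap F).compr₂ (mulMap F) =
      (LinearMap.lcomp ℂ _ (mulMap F)).comp ((LinearMap.llcomp ℂ _ _ _).comp (mulMap F)) := by
    refine ext_el F fun p x => ext_el F fun q y => ext_el F fun r z => ?_
    simp only [LinearMap.compr₂_apply, LinearMap.comp_apply, LinearMap.lcomp_apply,
      LinearMap.llcomp_apply, mulMap_el]
    by_cases h₁ : F.posPow p x = q
    · by_cases h₂ : F.posPow q y = r
      · simp [h₁, h₂, mulMap_el, F.posPow_mul, mul_assoc]
      · simp [h₁, h₂, mulMap_el, F.posPow_mul]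
    · by_cases h₂ : F.posPow q y = r
      · simp [h₁, h₂, mulMap_el]
      · simp [h₁, h₂]
  exact LinearMap.congr_fun (LinearMap.congr_fun (LinearMap.congr_fun key a) b) c

variable [Finite G]

/-- Unit: `1 = ∑_{u ∈ G₊} {u}`. -/
def unit : Bicross F := ∑ w : F.pos, basis F (w : G)

/-- Comultiplication: `Δ{g} = ∑_{h ∈ G₊} {g₊ h⁻¹ (ʰg₋)} ⊗ {h g₋}`. -/
def comulMap : Bicross F →ₗ[ℂ] Bicross F ⊗[ℂ] Bicross F :=
  (basis F).constr ℂ fun g => ∑ h : F.pos,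
    basis F (F.posPart g * (h : G)⁻¹ * F.posOnNeg h (F.negPart g)) ⊗ₜ[ℂ]
      basis F (h * F.negPart g : G)

theorem unit_eq : unit F = ∑ w : F.pos, el F w 1 := by simp [unit, el]

theorem comulMap_el (p : F.pos) (x : F.neg) :
    comulMap F (el F p x) =
      ∑ h : F.pos, el F (p * h⁻¹) (F.posOnNeg h x) ⊗ₜ[ℂ] el F h x := by
  simp only [comulMap, el, Module.Basis.constr_basis, F.posPart_mul, F.negPart_mul,
    Subgroup.coe_mul, Subgroup.coe_inv]

theorem unit_mulMap (a : Bicross F) : mulMap F (unit F) a = a := by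
  have key : mulMap F (unit F) = LinearMap.id := by
    refine ext_el F fun p x => ?_
    simp [unit_eq, mulMap_el, F.posPow_one]
  exact LinearMap.congr_fun key a

theorem mulMap_unit (a : Bicross F) : mulMap F a (unit F) = a := by
  have key : (mulMap F).flip (unit F) = LinearMap.id := by
    refine ext_el F fun p x => ?_
    simp [unit_eq, mulMap_el]
  exact LinearMap.congr_fun key a

instance : Ring (Bicross F) where
  __ := (inferInstance : AddCommGroup (Bicross F))
  mul a b := mulMap F a b
  one := unit F
  left_distrib a b c := map_add (mulMap F a) b c
  right_distrib a b c := LinearMap.map_add₂ (mulMap F) a b c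
  zero_mul a := LinearMap.map_zero₂ (mulMap F) a
  mul_zero a := map_zero (mulMap F a)
  mul_assoc := mulMap_assoc F
  one_mul := unit_mulMap F
  mul_one := mulMap_unit F

instance : Algebra ℂ (Bicross F) :=
  Algebra.ofModule (fun r a b => LinearMap.map_smul₂ (mulMap F) r a b)
    (fun r a b => map_smul (mulMap F a) r b)

theorem el_mul_el (p q : F.pos) (x y : F.neg) :
    el F p x * el F q y = if F.posPow p x = q then el F p (x * y) else 0 :=
  mulMap_el F p q x y

theorem one_eq : (1 : Bicross F) = ∑ w : F.pos, el F w 1 := unit_eq F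

instance : Coalgebra ℂ (Bicross F) where
  comul := comulMap F
  counit := counitMap F
  coassoc := by
    refine ext_el F fun p x => ?_
    simp only [LinearMap.comp_apply, comulMap_el, map_sum, LinearMap.rTensor_tmul,
      LinearMap.lTensor_tmul, TensorProduct.sum_tmul, TensorProduct.tmul_sum,
      LinearEquiv.coe_coe, TensorProduct.assoc_tmul]
    rw [Finset.sum_comm (s := Finset.univ) (t := Finset.univ)
      (f := fun h k => el F (p * h⁻¹) (F.posOnNeg h x) ⊗ₜ[ℂ]
        (el F (h * k⁻¹) (F.posOnNeg k x) ⊗ₜ[ℂ] el F k x))]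
    refine Finset.sum_congr rfl fun k _ => ?_
    refine Fintype.sum_equiv (Equiv.mulRight k) _ _ fun h => ?_
    simp [mul_assoc, F.mul_posOnNeg]
  rTensor_counit_comp_comul := by
    refine ext_el F fun p x => ?_
    simp [comulMap_el, counitMap_el, mul_inv_eq_one, TensorProduct.ite_tmul]
  lTensor_counit_comp_comul := by
    refine ext_el F fun p x => ?_
    simp [comulMap_el, counitMap_el, F.one_posOnNeg, TensorProduct.tmul_ite]

theorem comul_el (p : F.pos) (x : F.neg) :
    Coalgebra.comul (R := ℂ) (el F p x) =
      ∑ h : F.pos, el F (p * h⁻¹) (F.posOnNeg h x) ⊗ₜ[ℂ] el F h x :=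
  comulMap_el F p x

theorem counit_el (p : F.pos) (x : F.neg) :
    Coalgebra.counit (R := ℂ) (el F p x) = if p = 1 then 1 else 0 :=
  counitMap_el F p x

instance : Bialgebra ℂ (Bicross F) where
  counit_one := by
    simp [one_eq, counit_el]
  mul_compr₂_counit := by
    refine ext_el F fun p x => ext_el F fun q y => ?_
    simp only [LinearMap.compr₂_apply, LinearMap.compl₁₂_apply, LinearMap.mul_apply', el_mul_el,
      counit_el]
    by_cases hp : p = 1
    · subst hp
      by_cases hq : q = 1
      · simp [hq, F.one_posPow, counit_el]
      · simp [hq, Ne.symm hq, F.one_posPow]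
    · split_ifs <;> simp_all [counit_el]
  comul_one := by
    simp only [one_eq, map_sum, comul_el, Algebra.TensorProduct.one_def, TensorProduct.sum_tmul,
      TensorProduct.tmul_sum, F.posOnNeg_one]
    rw [Finset.sum_comm]
    refine Finset.sum_congr rfl fun k _ => ?_
    exact Fintype.sum_equiv (Equiv.mulRight k⁻¹) _ _ fun h => by simp
  mul_compr₂_comul := by
    refine ext_el F fun p x => ext_el F fun q y => ?_
    simp only [LinearMap.compr₂_apply, LinearMap.compl₁₂_apply, LinearMap.mul_apply', el_mul_el,
      comul_el, Finset.sum_mul_sum, Algebra.TensorProduct.tmul_mul_tmul]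
    have h₁ : ∀ k l : F.pos,
        (if F.posPow (p * k⁻¹) (F.posOnNeg k x) = q * l⁻¹ then
          el F (p * k⁻¹) (F.posOnNeg k x * F.posOnNeg l y) else 0) ⊗ₜ[ℂ]
        (if F.posPow k x = l then el F k (x * y) else 0) =
        if F.posPow k x = l then
          (if F.posPow p x = q then
            el F (p * k⁻¹) (F.posOnNeg k (x * y)) ⊗ₜ[ℂ] el F k (x * y) else 0) else 0 := by
      intro k l
      by_cases hl : F.posPow k x = l
      · subst hl
        have h₂ := F.mul_posPow (p * k⁻¹) k x
        rw [inv_mul_cancel_right] at h₂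
        have h₃ : F.posPow (p * k⁻¹) (F.posOnNeg k x) = q * (F.posPow k x)⁻¹ ↔
            F.posPow p x = q := by
          rw [eq_mul_inv_iff_mul_eq, ← h₂]
        by_cases hq : F.posPow p x = q
        · rw [if_pos (h₃.2 hq)]
          simp [hq, F.posOnNeg_mul]
        · rw [if_neg (mt h₃.1 hq)]
          simp [hq]
      · simp [hl]
    simp only [h₁, Finset.sum_ite_eq, Finset.mem_univ, if_true]
    by_cases hq : F.posPow p x = q
    · simp [hq, comul_el]
    · simp [hq]

instance : HopfAlgebra ℂ (Bicross F) where
  antipode := antipodeMap F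
  mul_antipode_rTensor_comul := by
    refine ext_el F fun p x => ?_
    simp only [LinearMap.comp_apply, comul_el, counit_el, map_sum, LinearMap.rTensor_tmul,
      LinearMap.mul'_apply, antipodeMap_el, Algebra.linearMap_apply, el_mul_el, F.posPow_inv]
    by_cases hp : p = 1
    · subst hp
      simp only [one_mul, inv_inv, if_true, F.inv_posPow, map_one, one_eq]
      refine Fintype.sum_equiv (F.posPowEquiv x) _ _ fun h => ?_
      have h₁ : F.posOnNeg h⁻¹ (F.posOnNeg h x) = x := by
        rw [← F.mul_posOnNeg, inv_mul_cancel, F.one_posOnNeg]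
      simp [h₁, UniqueFactorization.posPowEquiv]
    · simp [hp]
  mul_antipode_lTensor_comul := by
    refine ext_el F fun p x => ?_
    simp only [LinearMap.comp_apply, comul_el, counit_el, map_sum, LinearMap.lTensor_tmul,
      LinearMap.mul'_apply, antipodeMap_el, Algebra.linearMap_apply, el_mul_el]
    have h₁ : ∀ h : F.pos,
        F.posPow (p * h⁻¹) (F.posOnNeg h x) = (F.posPow h x)⁻¹ ↔ p = 1 := fun h => by
      have h₂ := F.mul_posPow (p * h⁻¹) h x
      rw [inv_mul_cancel_right] at h₂
      rw [eq_inv_iff_mul_eq_one, ← h₂, F.posPow_eq_one_iff]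
    simp only [h₁, mul_inv_cancel]
    by_cases hp : p = 1
    · subst hp
      simp only [one_mul, if_true, map_one, one_eq]
      exact Fintype.sum_equiv (Equiv.inv _) _ _ fun h => by simp
    · simp [hp]

end Bicross

/-! ### Positive bases and (quasi-)triangular structures -/

section Triangular

variable {H : Type u} [Ring H] [HopfAlgebra ℂ H]

/-- All structure constants of `H` (multiplication, unit, comultiplication, counit, antipode)
relative to `b` are non-negative real numbers (the order on `ℂ` is the one with
`0 ≤ z ↔ 0 ≤ z.re ∧ z.im = 0`). -/
structure IsPositiveBasis {ι : Type v} (b : Module.Basis ι ℂ H) : Prop where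
  mul_nonneg : ∀ i j k, 0 ≤ b.repr (b i * b j) k
  one_nonneg : ∀ i, 0 ≤ b.repr 1 i
  comul_nonneg : ∀ i j k, 0 ≤ (b.tensorProduct b).repr (Coalgebra.comul (R := ℂ) (b i)) (j, k)
  counit_nonneg : ∀ i, 0 ≤ Coalgebra.counit (R := ℂ) (b i)
  antipode_nonneg : ∀ i j, 0 ≤ b.repr (HopfAlgebra.antipode ℂ (b i)) j

/-- `R ∈ H ⊗ H` has non-negative real coefficients in the basis `b ⊗ b`. -/
def IsPositiveTensor {ι : Type v} (b : Module.Basis ι ℂ H) (R : H ⊗[ℂ] H) : Prop :=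
  ∀ i j, 0 ≤ (b.tensorProduct b).repr R (i, j)

/-- `R₁₂ = R ⊗ 1`. -/
def leg₁₂ (R : H ⊗[ℂ] H) : H ⊗[ℂ] (H ⊗[ℂ] H) := TensorProduct.assoc ℂ H H H (R ⊗ₜ[ℂ] 1)

/-- `R₁₃`: the image of `R` under `a ⊗ b ↦ a ⊗ 1 ⊗ b`. -/
def leg₁₃ (R : H ⊗[ℂ] H) : H ⊗[ℂ] (H ⊗[ℂ] H) :=
  LinearMap.lTensor H (TensorProduct.mk ℂ H H 1) R

/-- `R₂₃ = 1 ⊗ R`. -/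
def leg₂₃ (R : H ⊗[ℂ] H) : H ⊗[ℂ] (H ⊗[ℂ] H) := 1 ⊗ₜ[ℂ] R

structure IsQuasiTriangular (R : H ⊗[ℂ] H) : Prop where
  /-- `R` is invertible, and `τ Δ(g) = R Δ(g) R⁻¹`. -/
  exists_inv : ∃ S : H ⊗[ℂ] H, R * S = 1 ∧ S * R = 1 ∧ ∀ g : H,
    TensorProduct.comm ℂ H H (Coalgebra.comul (R := ℂ) g) = R * Coalgebra.comul (R := ℂ) g * S
  /-- `(Δ ⊗ id) R = R₁₃ R₂₃`. -/
  comul_left : TensorProduct.assoc ℂ H H H (LinearMap.rTensor H (Coalgebra.comul (R := ℂ)) R) =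
    leg₁₃ R * leg₂₃ R
  /-- `(id ⊗ Δ) R = R₁₃ R₁₂`. -/
  comul_right : LinearMap.lTensor H (Coalgebra.comul (R := ℂ)) R = leg₁₃ R * leg₁₂ R
  /-- `(ε ⊗ id) R = 1`. -/
  counit_left : TensorProduct.lid ℂ H (LinearMap.rTensor H (Coalgebra.counit (R := ℂ)) R) = 1
  /-- `(id ⊗ ε) R = 1`. -/
  counit_right : TensorProduct.rid ℂ H (LinearMap.lTensor H (Coalgebra.counit (R := ℂ)) R) = 1

/-- A quasi-triangular structure with `(τ R) R = 1 ⊗ 1`. -/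
structure IsTriangular (R : H ⊗[ℂ] H) : Prop extends IsQuasiTriangular R where
  comm_mul_self : TensorProduct.comm ℂ H H R * R = 1

end Triangular

/-! ### First kind of data: Hopf algebras with positive basis and positive triangular structure -/

/-- A finite-dimensional complex Hopf algebra with a positive basis and a positive triangular
structure. -/
structure PosTriHopf where
  H : Type u
  [ring : Ring H]
  [hopf : HopfAlgebra ℂ H]
  ι : Type u
  [finite : Finite ι]
  b : Module.Basis ι ℂ H
  R : H ⊗[ℂ] H
  isPositiveBasis : IsPositiveBasis b
  isTriangular : IsTriangular R
  isPositiveTensor : IsPositiveTensor b R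

attribute [instance] PosTriHopf.ring PosTriHopf.hopf PosTriHopf.finite

/-- Isomorphism: an isomorphism of bialgebras (hence of Hopf algebras) that carries one basis to
the other up to multiplying the basis elements by positive real numbers, and carries one
triangular structure to the other. -/
def PosTriHopf.Iso (X Y : PosTriHopf.{u}) : Prop :=
  ∃ e : X.H ≃ₐc[ℂ] Y.H,
    (∃ (σ : X.ι ≃ Y.ι) (c : X.ι → ℝ), ∀ i, 0 < c i ∧ e (X.b i) = (c i : ℂ) • Y.b (σ i)) ∧
    TensorProduct.congr e.toCoalgEquiv.toLinearEquiv e.toCoalgEquiv.toLinearEquiv X.R = Y.R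

instance PosTriHopf.setoid : Setoid PosTriHopf.{u} where
  r := PosTriHopf.Iso
  iseqv :=
    { refl := fun X => ⟨BialgEquiv.refl ℂ X.H, ⟨Equiv.refl _, fun _ => 1, fun i => by simp⟩, by
        change TensorProduct.congr (LinearEquiv.refl ℂ X.H) (LinearEquiv.refl ℂ X.H) X.R = X.R
        simp⟩
      symm := by
        rintro X Y ⟨e, ⟨σ, c, h⟩, hR⟩
        refine ⟨e.symm, ⟨σ.symm, fun i => (c (σ.symm i))⁻¹, fun i => ⟨inv_pos.2 (h _).1, ?_⟩⟩, ?_⟩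
        · have h₁ := (h (σ.symm i)).2
          have h₂ : (c (σ.symm i) : ℂ) ≠ 0 := by exact_mod_cast (h (σ.symm i)).1.ne'
          rw [Equiv.apply_symm_apply] at h₁
          have h₃ : Y.b i = e ((c (σ.symm i) : ℂ)⁻¹ • X.b (σ.symm i)) := by
            rw [map_smul, h₁, smul_smul, inv_mul_cancel₀ h₂, one_smul]
          rw [h₃]
          simp
        · rw [← hR]
          exact (TensorProduct.congr e.toCoalgEquiv.toLinearEquiv
            e.toCoalgEquiv.toLinearEquiv).symm_apply_apply X.R
      trans := by
        rintro X Y Z ⟨e, ⟨σ, c, h⟩, hR⟩ ⟨e', ⟨σ', c', h'⟩, hR'⟩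
        refine ⟨e.trans e', ⟨σ.trans σ', fun i => c i * c' (σ i),
          fun i => ⟨mul_pos (h i).1 (h' _).1, ?_⟩⟩, ?_⟩
        · change e' (e (X.b i)) = _
          rw [(h i).2, map_smul, (h' _).2, smul_smul]
          simp
        · rw [← hR', ← hR]
          change TensorProduct.congr
            (e.toCoalgEquiv.toLinearEquiv.trans e'.toCoalgEquiv.toLinearEquiv)
            (e.toCoalgEquiv.toLinearEquiv.trans e'.toCoalgEquiv.toLinearEquiv) X.R = _
          rw [TensorProduct.congr_trans]
          rfl }

/-! ### Second and third kind of data: unique factorizations with a homomorphism -/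

namespace UniqueFactorization

variable {G : Type u} [Group G] (F : UniqueFactorization G)

/-- The set `{u ξ(u⁻¹) : u ∈ G₊}`. -/
def leftSet (ξ : F.pos →* F.neg) : Set G := Set.range fun p : F.pos => (p * ξ p⁻¹ : G)

/-- The set `{η(u⁻¹) u : u ∈ G₊}`. -/
def rightSet (η : F.pos →* F.neg) : Set G := Set.range fun p : F.pos => (η p⁻¹ * p : G)

/-- `{u ξ(u⁻¹) : u ∈ G₊}` is an abelian normal subgroup of `G`. -/
def IsAbelianNormal (ξ : F.pos →* F.neg) : Prop :=
  ∃ A : Subgroup G, (A : Set G) = F.leftSet ξ ∧ A.Normal ∧ ∀ a ∈ A, ∀ b ∈ A, a * b = b * a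

/-- `u v = (^{ξ(u)} v)(u ^ {ξ(v)})` and `ξ(ˣu) xᵘ = x ξ(u)` for `u, v ∈ G₊`, `x ∈ G₋`. -/
def IsBraided (ξ : F.pos →* F.neg) : Prop :=
  (∀ p q : F.pos, p * q = F.negOnPos (ξ p) q * F.posPow p (ξ q)) ∧
  ∀ (p : F.pos) (x : F.neg), ξ (F.negOnPos x p) * F.negPow x p = x * ξ p

/-- `G₊' = {u ξ(u⁻¹)}` and `G₊'' = {η(u⁻¹) u}` are normal subgroups of `G`, and
`u ξ(u⁻¹) ↦ η(u) u⁻¹` is an isomorphism of groups `G₊' → G₊''`. -/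
def IsQuasiTriangularPair (ξ η : F.pos →* F.neg) : Prop :=
  ∃ A B : Subgroup G, (A : Set G) = F.leftSet ξ ∧ (B : Set G) = F.rightSet η ∧
    A.Normal ∧ B.Normal ∧
    ∃ f : A ≃* B, ∀ (p : F.pos) (a : A), (a : G) = p * ξ p⁻¹ → (f a : G) = η p * (p : G)⁻¹

/-- `R = ∑_{u, v ∈ G₊} {u (η(v)ᵘ)⁻¹} ⊗ {v ξ(u)}`. -/
def rMatrix [Finite G] (ξ η : F.pos →* F.neg) : Bicross F ⊗[ℂ] Bicross F :=
  ∑ p : F.pos, ∑ q : F.pos,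
    Bicross.basis F (p * (F.negPow (η q) p : G)⁻¹) ⊗ₜ[ℂ] Bicross.basis F (q * ξ p : G)

end UniqueFactorization

/-- A unique factorization `G = G₊ G₋` of a finite group with a homomorphism `ξ : G₊ → G₋`. -/
structure FactHom where
  G : Type u
  [group : Group G]
  [finite : Finite G]
  F : UniqueFactorization G
  ξ : F.pos →* F.neg

attribute [instance] FactHom.group FactHom.finite

/-- Isomorphism: a group isomorphism carrying `G₊`, `G₋`, `ξ` to `G₊`, `G₋`, `ξ`. -/
def FactHom.Iso (X Y : FactHom.{u}) : Prop :=
  ∃ f : X.G ≃* Y.G, (∀ g, f g ∈ Y.F.pos ↔ g ∈ X.F.pos) ∧ (∀ g, f g ∈ Y.F.neg ↔ g ∈ X.F.neg) ∧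
    ∀ (p : X.F.pos) (q : Y.F.pos), f p = q → f (X.ξ p) = Y.ξ q

instance FactHom.setoid : Setoid FactHom.{u} where
  r := FactHom.Iso
  iseqv :=
    { refl := fun X => ⟨MulEquiv.refl _, fun _ => Iff.rfl, fun _ => Iff.rfl, fun p q h => by
        obtain rfl : p = q := Subtype.ext h
        rfl⟩
      symm := by
        rintro X Y ⟨f, h₁, h₂, h₃⟩
        refine ⟨f.symm, fun g => ?_, fun g => ?_, fun p q h => ?_⟩
        · rw [← h₁, f.apply_symm_apply]
        · rw [← h₂, f.apply_symm_apply]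
        · rw [MulEquiv.symm_apply_eq] at h ⊢
          exact (h₃ q p h.symm).symm
      trans := by
        rintro X Y Z ⟨f, h₁, h₂, h₃⟩ ⟨f', h₁', h₂', h₃'⟩
        refine ⟨f.trans f', fun g => (h₁' _).trans (h₁ _), fun g => (h₂' _).trans (h₂ _),
          fun p q h => ?_⟩
        exact (congrArg f' (h₃ p ⟨f p, (h₁ _).2 p.2⟩ rfl)).trans (h₃' _ q h) }

/-- Second kind of data: `{u ξ(u⁻¹) : u ∈ G₊}` is an abelian normal subgroup. -/
abbrev AbelianFact := {X : FactHom.{u} // X.F.IsAbelianNormal X.ξ}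

/-- Third kind of data: `u v = (^{ξ(u)} v)(u ^ {ξ(v)})` and `ξ(ˣu) xᵘ = x ξ(u)`. -/
abbrev BraidedFact := {X : FactHom.{u} // X.F.IsBraided X.ξ}

instance AbelianFact.setoid : Setoid AbelianFact.{u} := FactHom.setoid.comap Subtype.val

instance BraidedFact.setoid : Setoid BraidedFact.{u} := FactHom.setoid.comap Subtype.val

/-! ### Fourth kind of data: actions on abelian groups with a 1-cycle -/

/-- A finite group `N` (in the role of `G₋`) acting on a finite abelian group `A` by
automorphisms, and a 1-cycle `ζ : A → N`. -/
structure CycleData where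
  N : Type u
  A : Type u
  [groupN : Group N]
  [finiteN : Finite N]
  [groupA : CommGroup A]
  [finiteA : Finite A]
  [action : MulDistribMulAction N A]
  ζ : A → N
  cycle : ∀ a b, ζ a * ζ b = ζ (a * ζ a • b)

attribute [instance] CycleData.groupN CycleData.finiteN CycleData.groupA CycleData.finiteA
  CycleData.action

/-- Isomorphism: compatible isomorphisms of both groups. -/
def CycleData.Iso (X Y : CycleData.{u}) : Prop :=
  ∃ (φ : X.N ≃* Y.N) (ψ : X.A ≃* Y.A),
    (∀ x a, ψ (x • a) = φ x • ψ a) ∧ ∀ a, φ (X.ζ a) = Y.ζ (ψ a)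

instance CycleData.setoid : Setoid CycleData.{u} where
  r := CycleData.Iso
  iseqv :=
    { refl := fun X => ⟨MulEquiv.refl _, MulEquiv.refl _, fun _ _ => rfl, fun _ => rfl⟩
      symm := by
        rintro X Y ⟨φ, ψ, h₁, h₂⟩
        refine ⟨φ.symm, ψ.symm, fun x a => ?_, fun a => ?_⟩
        · rw [MulEquiv.symm_apply_eq, h₁]
          simp
        · rw [MulEquiv.symm_apply_eq, h₂]
          simp
      trans := by
        rintro X Y Z ⟨φ, ψ, h₁, h₂⟩ ⟨φ', ψ', h₁', h₂'⟩
        refine ⟨φ.trans φ', ψ.trans ψ', fun x a => ?_, fun a => ?_⟩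
        · simp [h₁, h₁']
        · simp [h₂, h₂'] }

theorem CycleData.ζ_one (Y : CycleData.{u}) : Y.ζ 1 = 1 := by
  have h := Y.cycle 1 1
  rwa [smul_one, mul_one, mul_eq_left] at h

/-- The semi-direct product `A ⋊ N`, with `(a x)(b y) = a (x • b) x y`. -/
abbrev CycleData.Semidirect (Y : CycleData.{u}) : Type u :=
  Y.A ⋊[MulDistribMulAction.toMulAut Y.N Y.A] Y.N

instance (Y : CycleData.{u}) : Finite Y.Semidirect :=
  Finite.of_equiv _ SemidirectProduct.equivProd.symm

/-- The subgroup `{a ζ(a) : a ∈ A}` of `A ⋊ N`. -/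
def CycleData.graph (Y : CycleData.{u}) : Subgroup Y.Semidirect where
  carrier := Set.range fun a : Y.A => ⟨a, Y.ζ a⟩
  one_mem' := ⟨1, SemidirectProduct.ext rfl Y.ζ_one⟩
  mul_mem' := by
    rintro _ _ ⟨a, rfl⟩ ⟨b, rfl⟩
    exact ⟨a * Y.ζ a • b, SemidirectProduct.ext rfl (Y.cycle a b).symm⟩
  inv_mem' := by
    rintro _ ⟨a, rfl⟩
    refine ⟨(Y.ζ a)⁻¹ • a⁻¹, SemidirectProduct.ext rfl ?_⟩
    have h := Y.cycle a ((Y.ζ a)⁻¹ • a⁻¹)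
    rw [smul_inv_smul, mul_inv_cancel, Y.ζ_one] at h
    exact eq_inv_of_mul_eq_one_right h

/-- The unique factorization of `G = A ⋊ N` with `G₊ = {a ζ(a)}` and `G₋ = N`. -/
def CycleData.factorization (Y : CycleData.{u}) : UniqueFactorization Y.Semidirect where
  pos := Y.graph
  neg := (SemidirectProduct.inr : Y.N →* Y.Semidirect).range
  isComplement := by
    constructor
    · rintro ⟨⟨_, a, rfl⟩, ⟨_, x, rfl⟩⟩ ⟨⟨_, b, rfl⟩, ⟨_, y, rfl⟩⟩ h
      obtain rfl : a = b := by simpa using congrArg SemidirectProduct.left h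
      obtain rfl : x = y := by simpa using congrArg SemidirectProduct.right h
      rfl
    · rintro ⟨a, x⟩
      refine ⟨⟨⟨_, a, rfl⟩, ⟨_, (Y.ζ a)⁻¹ * x, rfl⟩⟩, ?_⟩
      ext <;> simp

/-- From the fourth kind of data: `G = A ⋊ N`, `G₊ = {a ζ(a)}`, `G₋ = N`, and `ξ : G₊ → G₋` the
restriction of the projection `a x ↦ x`. -/
def CycleData.toFactHom (Y : CycleData.{u}) : FactHom.{u} where
  G := Y.Semidirect
  F := Y.factorization
  ξ := (SemidirectProduct.inr : Y.N →* Y.Semidirect).rangeRestrict.comp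
    (SemidirectProduct.rightHom.comp Y.graph.subtype)

namespace AbelianFact

variable (X : AbelianFact.{u})

/-- The subgroup `A = {u ξ(u⁻¹) : u ∈ G₊}` of `G`. -/
def subgroup : Subgroup X.1.G :=
  X.2.choose.copy (X.1.F.leftSet X.1.ξ) X.2.choose_spec.1.symm

theorem subgroup_eq : X.subgroup = X.2.choose := Subgroup.copy_eq _ _ _

instance subgroup_normal : X.subgroup.Normal := X.subgroup_eq ▸ X.2.choose_spec.2.1

instance : CommGroup X.subgroup where
  __ := (inferInstance : Group X.subgroup)
  mul_comm a b := Subtype.ext <| X.2.choose_spec.2.2 a (X.subgroup_eq ▸ a.2) b (X.subgroup_eq ▸ b.2)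

/-- `G₋` acts on `A` by conjugation: `x • a = x a x⁻¹`. -/
instance : MulDistribMulAction X.1.F.neg X.subgroup :=
  MulDistribMulAction.compHom X.subgroup
    ((MulAut.conjNormal : X.1.G →* MulAut X.subgroup).comp X.1.F.neg.subtype)

theorem coe_smul (x : X.1.F.neg) (a : X.subgroup) :
    ((x • a : X.subgroup) : X.1.G) = x * a * (x : X.1.G)⁻¹ :=
  MulAut.conjNormal_apply (x : X.1.G) a

/-- From the second kind of data: `G₋` acts on `A = {u ξ(u⁻¹)}` by conjugation, and
`ζ(u ξ(u⁻¹)) = ξ(u)`. Note that `u` is the `G₊`-part of `u ξ(u⁻¹)`. -/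
def toCycleData : CycleData.{u} where
  N := X.1.F.neg
  A := X.subgroup
  ζ a := X.1.ξ (X.1.F.posPart a)
  cycle := by
    rintro ⟨_, p, rfl⟩ ⟨_, q, rfl⟩
    rw [← map_mul]
    congr 1
    have h : ∀ r : X.1.F.pos, X.1.F.posPart (r * X.1.ξ r⁻¹ : X.1.G) = r :=
      fun r => X.1.F.posPart_mul _ _
    refine (X.1.F.posPart_eq _ (X.1.ξ (p * q)⁻¹) ?_).symm
    rw [Subgroup.coe_mul, coe_smul]
    simp only [h]
    simp [mul_assoc]

end AbelianFact

end

noncomputable section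

/-! ### Abelian normal complements and the braided identities -/

namespace UniqueFactorization

variable {G : Type u} [Group G] (F : UniqueFactorization G)

/-! The equivalence of 2, 3 and 4 is group theory. If `A = {u ξ(u)⁻¹}` is a normal subgroup, then it
is a complement of `G₋`, and `ξ` is the restriction to `G₊` of the projection `A ⋊ G₋ → G₋`. The
second braided identity says exactly that `u x ↦ ξ(u) x` is a homomorphism; its kernel is `A`.
Granted this, the first identity says that `u` and `ξ(u)` conjugate `A` in the same way, that is,
that `A` is abelian. Inside `A ⋊ G₋` the factor `G₊` is the graph of `ζ`, and the cycle law is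
closure of this graph under products.

The link with Hopf algebras rests on one fact, `exists_perm_of_nonneg_inverse`: a non-negative
matrix with a non-negative inverse is monomial, because non-negative terms with sum zero all vanish.
It is used twice.

Applied to the canonical maps `a ⊗ b ↦ a₁ ⊗ a₂ b` and `a ⊗ b ↦ a b₁ ⊗ b₂`, whose inverses involve
the antipode, it shows that a product of two basis elements is zero or a positive multiple of a
third. The basis becomes a groupoid over the basis elements occurring in `1`, and dually a groupoid
over those with non-zero counit. A basis element is determined by its left unit and its right
counit; units and counits form groups, and the right unit and the left counit are the two actions of
a matched pair, which gives `G = G₊ G₋` (`HopfSupport.exists_isBicross`). The logarithms of the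
remaining positive factors are compatible real cocycles. Averaging over the finite groups makes them
coboundaries (`UniqueFactorization.exists_coboundary`), so rescaling the basis identifies `H` with
`H(G; G₊, G₋)`.

Applied to multiplication by `R`, with inverse given by `τR`, it leaves one term `r(u, v) {u a(u,
v)} ⊗ {v b(u, v)}` for each pair `(u, v)`. The two coproduct axioms force `b(u, v) = ξ(u)` and `a(u,
v) = (η(v)ᵘ)⁻¹` for homomorphisms `ξ`, `η`, and make `r` multiplicative in a twisted sense, whence
`r = 1` because the positive reals have no torsion. Then `(τR)R = 1` gives `ξ = η`, and `τΔ = RΔR⁻¹`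
gives the braided identities (`Bicross.exists_isBraided_of_isTriangular`). Finally, an isomorphism
of Hopf algebras that matches the bases up to positive factors respects all supports, so the
bijection of indices is a group isomorphism (`Bicross.index_mul`). -/

theorem factor_inj {p q : F.pos} {x y : F.neg} (h : (p * x : G) = q * y) : p = q ∧ x = y := by
  have h₁ := F.posPart_mul p x
  have h₂ := F.negPart_mul p x
  rw [h, posPart_mul] at h₁
  rw [h, negPart_mul] at h₂
  exact ⟨h₁.symm, h₂.symm⟩

/-- `x u = (ˣu)(xᵘ)`. -/
theorem negOnPos_mul_negPow (x : F.neg) (p : F.pos) :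
    (F.negOnPos x p * F.negPow x p : G) = x * p :=
  F.posPart_mul_negPart _

theorem negOnPos_posPow (p : F.pos) (x : F.neg) :
    F.negOnPos (F.posOnNeg p x) (F.posPow p x) = p :=
  F.posPart_eq p x (F.posOnNeg_mul_posPow p x)

theorem negPow_posPow (p : F.pos) (x : F.neg) :
    F.negPow (F.posOnNeg p x) (F.posPow p x) = x :=
  F.negPart_eq p x (F.posOnNeg_mul_posPow p x)

theorem posPow_negOnPos (x : F.neg) (p : F.pos) :
    F.posPow (F.negOnPos x p) (F.negPow x p) = p :=
  F.posBar_eq x p (F.negOnPos_mul_negPow x p)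

theorem posOnNeg_negOnPos (x : F.neg) (p : F.pos) :
    F.posOnNeg (F.negOnPos x p) (F.negPow x p) = x :=
  F.negBar_eq x p (F.negOnPos_mul_negPow x p)

theorem negPow_inv (x : F.neg) (p : F.pos) :
    (F.negPow x p)⁻¹ = F.posOnNeg p⁻¹ x⁻¹ := by
  refine (F.negBar_eq _ (F.negOnPos x p)⁻¹ ?_).symm
  have h := congrArg (·⁻¹) (F.negOnPos_mul_negPow x p)
  simpa using h.symm

theorem posPow_negPow_inv (x : F.neg) (p : F.pos) :
    F.posPow p (F.negPow x p)⁻¹ = F.negOnPos x p := by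
  have h := F.posPow_mul (F.negOnPos x p) (F.negPow x p) (F.negPow x p)⁻¹
  rw [mul_inv_cancel, posPow_one, posPow_negOnPos] at h
  exact h.symm

theorem mul_negOnPos (x y : F.neg) (p : F.pos) :
    F.negOnPos (x * y) p = F.negOnPos x (F.negOnPos y p) := by
  refine F.posPart_eq _ (F.negPow x (F.negOnPos y p) * F.negPow y p) ?_
  rw [Subgroup.coe_mul, Subgroup.coe_mul, ← mul_assoc, negOnPos_mul_negPow, mul_assoc, mul_assoc,
    negOnPos_mul_negPow]

theorem mul_negPow (x y : F.neg) (p : F.pos) :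
    F.negPow (x * y) p = F.negPow x (F.negOnPos y p) * F.negPow y p := by
  refine F.negPart_eq (F.negOnPos x (F.negOnPos y p)) _ ?_
  rw [Subgroup.coe_mul, Subgroup.coe_mul, ← mul_assoc, negOnPos_mul_negPow, mul_assoc, mul_assoc,
    negOnPos_mul_negPow]

theorem one_negOnPos (p : F.pos) : F.negOnPos 1 p = p := F.posPart_eq p 1 (by simp)

theorem negPow_one (x : F.neg) : F.negPow x 1 = x := F.negPart_eq 1 x (by simp)

theorem one_negPow (p : F.pos) : F.negPow 1 p = 1 := F.negPart_eq p 1 (by simp)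

variable {F} {ξ : F.pos →* F.neg}

/-- The `G₊`-part of `p ξ(p)⁻¹ x` is `p`, so it recovers the element of `leftSet`. This provides the
uniqueness half of `G = A G₋`. -/
theorem leftSet_mul_inj {a b : G} (ha : a ∈ F.leftSet ξ) (hb : b ∈ F.leftSet ξ) {x y : F.neg}
    (h : a * x = b * y) : a = b ∧ x = y := by
  obtain ⟨p, rfl⟩ := ha
  obtain ⟨q, rfl⟩ := hb
  have h₁ : (p * ((ξ p⁻¹ * x : F.neg) : G) : G) = q * ((ξ q⁻¹ * y : F.neg) : G) := by
    simpa [mul_assoc] using h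
  obtain ⟨rfl, h₂⟩ := F.factor_inj h₁
  exact ⟨rfl, by simpa using h₂⟩

theorem IsAbelianNormal.isBraided (h : F.IsAbelianNormal ξ) : F.IsBraided ξ := by
  obtain ⟨A, hA, hn, hc⟩ := h
  have mem : ∀ p : F.pos, (p * (ξ p : G)⁻¹ : G) ∈ A := fun p => by
    rw [← SetLike.mem_coe, hA]
    exact ⟨p, by simp⟩
  have inj : ∀ {a b : G}, a ∈ A → b ∈ A → ∀ {x y : F.neg}, a * x = b * y → a = b ∧ x = y := by
    intro a b ha hb x y
    rw [← SetLike.mem_coe, hA] at ha hb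
    exact leftSet_mul_inj ha hb
  have key : ∀ (p : F.pos) (x : F.neg),
      (x * (p * (ξ p : G)⁻¹) * (x : G)⁻¹ : G) =
        F.negOnPos x p * (ξ (F.negOnPos x p) : G)⁻¹ ∧
      x * ξ p = ξ (F.negOnPos x p) * F.negPow x p := by
    intro p x
    -- Both decompositions along `A G₋` multiply to `x p`; uniqueness yields the conjugate of `p
    -- ξ(p)⁻¹` and the second identity at once.
    refine inj (hn.conj_mem _ (mem p) _) (mem _) ?_
    have h := F.negOnPos_mul_negPow x p
    simp only [Subgroup.coe_mul]
    calc _ = (x * p : G) := by group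
      _ = _ := by rw [← h]; group
  refine ⟨fun p q => ?_, fun p x => (key p x).2.symm⟩
  have h₁ := (key q (ξ p)).1
  set w := F.negOnPos (ξ p) q with hw
  -- As `A` is abelian, `p = (p ξ(p)⁻¹) ξ(p)` conjugates `A` in the same way as `ξ(p)`.
  have h₂ : (p * (q * (ξ q : G)⁻¹) * (p : G)⁻¹ : G) = w * (ξ w : G)⁻¹ := by
    have h₃ := hc _ (mem p) _ (mem w)
    rw [← h₁] at h₃ ⊢
    have h₄ : (p : G) = (p * (ξ p : G)⁻¹) * ξ p := by group
    calc _ = ((p * (ξ p : G)⁻¹) * (ξ p * (q * (ξ q : G)⁻¹) * (ξ p : G)⁻¹)) *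
        (p * (ξ p : G)⁻¹)⁻¹ := by group
      _ = _ := by rw [h₃]; group
  have h₅ : F.posPow p (ξ q) = w⁻¹ * (p * q) := by
    refine F.posBar_eq (ξ w) _ ?_
    have h₆ : (p * ξ q : G) = (w * (ξ w : G)⁻¹)⁻¹ * (p * q) := by rw [← h₂]; group
    rw [h₆]
    simp only [Subgroup.coe_mul, Subgroup.coe_inv]
    group
  rw [h₅, mul_inv_cancel_left]

/-- The projection `u x ↦ ξ(u) x` of `G` onto `G₋`. -/
def IsBraided.proj (h : F.IsBraided ξ) : G →* F.neg :=
  MonoidHom.mk' (fun g => ξ (F.posPart g) * F.negPart g) fun g k => by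
    set p := F.posPart g
    set x := F.negPart g
    set q := F.posPart k
    set y := F.negPart k
    have h₁ : g * k = ((p * F.negOnPos x q : F.pos) : G) * ((F.negPow x q * y : F.neg) : G) := by
      rw [← F.posPart_mul_negPart g, ← F.posPart_mul_negPart k]
      have h₂ := F.negOnPos_mul_negPow x q
      simp only [Subgroup.coe_mul]
      calc _ = (p * (x * q) * y : G) := by simp only [mul_assoc, p, x, q, y]
        _ = _ := by rw [← h₂]; group
    rw [F.posPart_eq _ _ h₁, F.negPart_eq _ _ h₁, map_mul]
    -- Moving `x` past `q` is the only obstruction to multiplicativity, and the second identity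
    -- removes it.
    have h₂ := h.2 q x
    calc _ = ξ p * (ξ (F.negOnPos x q) * F.negPow x q) * y := by group
      _ = _ := by rw [h₂]; group

theorem IsBraided.proj_mul (h : F.IsBraided ξ) (p : F.pos) (x : F.neg) :
    h.proj (p * x : G) = ξ p * x := by
  change ξ (F.posPart _) * F.negPart _ = _
  rw [F.posPart_mul, F.negPart_mul]

theorem IsBraided.proj_pos (h : F.IsBraided ξ) (p : F.pos) : h.proj p = ξ p := by
  simpa using h.proj_mul p 1

theorem IsBraided.proj_neg (h : F.IsBraided ξ) (x : F.neg) : h.proj x = x := by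
  simpa using h.proj_mul 1 x

/-- `A` is the kernel of `proj`, hence normal. The first identity shows that `ξ(p)⁻¹ p` centralizes
this kernel, and a conjugation by `ξ(p)` turns this into commutativity. -/
theorem IsBraided.isAbelianNormal (h : F.IsBraided ξ) : F.IsAbelianNormal ξ := by
  have mem : ∀ p : F.pos, h.proj (p * (ξ p : G)⁻¹) = 1 := fun p => by
    rw [← Subgroup.coe_inv, h.proj_mul, mul_inv_cancel]
  have hs : (h.proj.ker : Set G) = F.leftSet ξ := by
    ext g
    constructor
    · intro hg
      have h₁ : ξ (F.posPart g) * F.negPart g = 1 := hg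
      refine ⟨F.posPart g, ?_⟩
      conv_rhs => rw [← F.posPart_mul_negPart g, eq_inv_of_mul_eq_one_right h₁]
      simp
    · rintro ⟨p, rfl⟩
      simpa using mem p
  refine ⟨h.proj.ker, hs, inferInstance, ?_⟩
  have key : ∀ p q : F.pos, (p * (q * (ξ q : G)⁻¹) * (p : G)⁻¹ : G) =
      ξ p * (q * (ξ q : G)⁻¹) * (ξ p : G)⁻¹ := by
    intro p q
    set w := F.negOnPos (ξ p) q with hw
    have h₁ := h.1 p q
    have h₂ := F.posOnNeg_mul_posPow p (ξ q)
    -- Projecting `h₄` to `G₋` kills the factor from the kernel and leaves `ξ(p) ξ(p)⁻¹ ξ(w)`.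
    have h₃ : F.posOnNeg p (ξ q) = ξ w := by
      have h₄ : (F.posOnNeg p (ξ q) : G) = p * (q * (ξ q : G)⁻¹)⁻¹ * (p : G)⁻¹ * w := by
        have h₅ : (F.posPow p (ξ q) : G) = (w : G)⁻¹ * (p * q) := by
          rw [← Subgroup.coe_mul, h₁, Subgroup.coe_mul, inv_mul_cancel_left]
        rw [h₅] at h₂
        rw [eq_mul_inv_of_mul_eq h₂]
        group
      have h₅ := congrArg h.proj h₄
      rw [h.proj_neg, map_mul, map_mul, map_mul, map_inv, map_inv, mem, h.proj_pos,
        h.proj_pos] at h₅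
      simpa using h₅
    rw [h₃] at h₂
    have h₄ : (p * (q * (ξ q : G)⁻¹) * (p : G)⁻¹ : G) = w * (ξ w : G)⁻¹ := by
      have h₅ : (p * q : G) = w * F.posPow p (ξ q) := by
        rw [← Subgroup.coe_mul, h₁, Subgroup.coe_mul]
      calc _ = (p * q : G) * (p * ξ q : G)⁻¹ := by group
        _ = _ := by rw [← h₂, h₅]; group
    rw [h₄]
    have h₆ := F.negOnPos_mul_negPow (ξ p) q
    have h₇ := congrArg (Subtype.val) (h.2 q (ξ p))
    simp only [Subgroup.coe_mul] at h₇
    rw [← hw] at h₆ h₇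
    calc (w * (ξ w : G)⁻¹ : G) = w * F.negPow (ξ p) q * (ξ w * F.negPow (ξ p) q : G)⁻¹ := by group
      _ = _ := by rw [h₆, h₇]; group
  have comm : ∀ p : F.pos, ∀ b ∈ h.proj.ker,
      ((ξ p : G)⁻¹ * p) * b = b * ((ξ p : G)⁻¹ * p) := by
    intro p b hb
    rw [← SetLike.mem_coe, hs] at hb
    obtain ⟨q, rfl⟩ := hb
    have h₁ := key p q
    simp only [map_inv, Subgroup.coe_inv]
    calc _ = (ξ p : G)⁻¹ * (p * (q * (ξ q : G)⁻¹) * (p : G)⁻¹) * p := by group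
      _ = _ := by rw [h₁]; group
  intro a ha b hb
  rw [← SetLike.mem_coe, hs] at ha
  obtain ⟨p, rfl⟩ := ha
  -- `p ξ(p)⁻¹` is the conjugate of `ξ(p)⁻¹ p` by `ξ(p)`; normality of the kernel carries the
  -- centralizing property along.
  have h₁ := comm p ((ξ p : G)⁻¹ * b * ((ξ p : G)⁻¹)⁻¹)
    ((inferInstance : h.proj.ker.Normal).conj_mem b hb _)
  simp only [map_inv, Subgroup.coe_inv]
  calc _ = ξ p * (((ξ p : G)⁻¹ * p) * ((ξ p : G)⁻¹ * b * ((ξ p : G)⁻¹)⁻¹)) * (ξ p : G)⁻¹ := by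
        group
    _ = _ := by rw [h₁]; group

theorem isAbelianNormal_iff_isBraided : F.IsAbelianNormal ξ ↔ F.IsBraided ξ :=
  ⟨IsAbelianNormal.isBraided, IsBraided.isAbelianNormal⟩

end UniqueFactorization

/-! ### The second, third and fourth kind of data -/

/-- The restriction of an isomorphism of groups to subgroups that correspond to each other. -/
def MulEquiv.restrictSubgroups {G G' : Type*} [Group G] [Group G'] (f : G ≃* G') {K : Subgroup G}
    {K' : Subgroup G'} (h : ∀ g, f g ∈ K' ↔ g ∈ K) : K ≃* K' where
  toFun g := ⟨f g, (h g).2 g.2⟩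
  invFun g := ⟨f.symm g, by rw [← h, f.apply_symm_apply]; exact g.2⟩
  left_inv g := Subtype.ext (f.symm_apply_apply _)
  right_inv g := Subtype.ext (f.apply_symm_apply _)
  map_mul' a b := Subtype.ext (map_mul f _ _)

namespace CycleData

variable (Y : CycleData.{u})

theorem mem_graph_iff (g : Y.Semidirect) : g ∈ Y.graph ↔ g.right = Y.ζ g.left := by
  constructor
  · rintro ⟨a, rfl⟩
    rfl
  · intro h
    exact ⟨g.left, SemidirectProduct.ext rfl h.symm⟩

theorem mem_range_inr_iff (g : Y.Semidirect) :
    g ∈ (SemidirectProduct.inr : Y.N →* Y.Semidirect).range ↔ g.left = 1 := by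
  constructor
  · rintro ⟨x, rfl⟩
    simp
  · intro h
    exact ⟨g.right, SemidirectProduct.ext h.symm rfl⟩

theorem mem_leftSet_iff (g : Y.Semidirect) :
    g ∈ Y.factorization.leftSet Y.toFactHom.ξ ↔ g.right = 1 := by
  constructor
  · rintro ⟨⟨p, hp⟩, rfl⟩
    exact mul_inv_cancel (SemidirectProduct.right p)
  · intro h
    refine ⟨⟨(⟨g.left, Y.ζ g.left⟩ : Y.Semidirect), g.left, rfl⟩, ?_⟩
    refine SemidirectProduct.ext ?_ ?_
    · change g.left * Y.ζ g.left • (1 : Y.A) = g.left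
      rw [smul_one, mul_one]
    · exact (mul_inv_cancel (Y.ζ g.left)).trans h.symm

theorem toFactHom_isAbelianNormal : Y.toFactHom.F.IsAbelianNormal Y.toFactHom.ξ := by
  refine ⟨(SemidirectProduct.rightHom : Y.Semidirect →* Y.N).ker, ?_, MonoidHom.normal_ker _, ?_⟩
  · ext g
    exact (Y.mem_leftSet_iff g).symm
  · intro a ha b hb
    have ha' : SemidirectProduct.right a = 1 := ha
    have hb' : SemidirectProduct.right b = 1 := hb
    refine SemidirectProduct.ext ?_ ?_
    · change a.left * a.right • b.left = b.left * b.right • a.left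
      rw [ha', hb', one_smul, one_smul, mul_comm]
    · change a.right * b.right = b.right * a.right
      rw [ha', hb']

/-- The second kind of data obtained from the fourth. -/
def toAbelianFact : AbelianFact.{u} := ⟨Y.toFactHom, Y.toFactHom_isAbelianNormal⟩

variable {Y} in
theorem Iso.toFactHom {Z : CycleData.{u}} (h : Y.Iso Z) : Y.toFactHom.Iso Z.toFactHom := by
  obtain ⟨φ, ψ, h₁, h₂⟩ := h
  refine ⟨SemidirectProduct.congr ψ φ (fun x => MulEquiv.ext (h₁ x)), fun g => ?_, fun g => ?_,
    ?_⟩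
  · refine (Z.mem_graph_iff _).trans (Iff.trans ?_ (Y.mem_graph_iff g).symm)
    change φ g.right = Z.ζ (ψ g.left) ↔ _
    rw [← h₂, φ.injective.eq_iff]
  · refine (Z.mem_range_inr_iff _).trans (Iff.trans ?_ (Y.mem_range_inr_iff g).symm)
    exact map_eq_one_iff ψ ψ.injective
  · rintro p q h
    refine SemidirectProduct.ext (map_one ψ) ?_
    have h₃ := congrArg SemidirectProduct.right h
    exact h₃

end CycleData

namespace AbelianFact

theorem mem_subgroup (X : AbelianFact.{u}) (p : X.1.F.pos) :
    (p * (X.1.ξ p : X.1.G)⁻¹ : X.1.G) ∈ X.subgroup := ⟨p, by simp⟩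

theorem coe_eq (X : AbelianFact.{u}) (a : X.subgroup) :
    (a : X.1.G) = X.1.F.posPart a * (X.1.ξ (X.1.F.posPart a) : X.1.G)⁻¹ := by
  obtain ⟨_, p, rfl⟩ := a
  simp only [X.1.F.posPart_mul]
  simp

theorem iso_toCycleData {X Y : AbelianFact.{u}} (h : X.1.Iso Y.1) :
    X.toCycleData.Iso Y.toCycleData := by
  obtain ⟨f, h₁, h₂, h₃⟩ := h
  have hA : ∀ g, f g ∈ Y.subgroup ↔ g ∈ X.subgroup := by
    intro g
    constructor
    · intro hg
      have h₄ := Y.coe_eq ⟨_, hg⟩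
      set q := Y.1.F.posPart (f g)
      obtain ⟨p, hp⟩ : ∃ p : X.1.F.pos, f p = q :=
        ⟨⟨f.symm q, by rw [← h₁, f.apply_symm_apply]; exact q.2⟩, f.apply_symm_apply _⟩
      have h₅ : g = p * (X.1.ξ p : X.1.G)⁻¹ := by
        apply f.injective
        rw [map_mul, map_inv, h₃ p q hp, hp]
        exact h₄
      rw [h₅]
      exact X.mem_subgroup p
    · intro hg
      have h₄ := X.coe_eq ⟨_, hg⟩
      set p := X.1.F.posPart g
      have h₅ : f g = f p * (f (X.1.ξ p))⁻¹ := by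
        rw [← map_inv, ← map_mul]
        exact congrArg f h₄
      rw [h₅, h₃ p ⟨f p, (h₁ _).2 p.2⟩ rfl]
      exact Y.mem_subgroup ⟨f p, (h₁ _).2 p.2⟩
  refine ⟨f.restrictSubgroups h₂, f.restrictSubgroups hA, fun x a => ?_, fun a => ?_⟩
  · refine Subtype.ext ?_
    refine (congrArg f (X.coe_smul x a)).trans (Eq.trans ?_ (Y.coe_smul _ _).symm)
    rw [map_mul, map_mul, map_inv]
    rfl
  · have h₄ : Y.1.F.posPart (f a.1) =
        ⟨f (X.1.F.posPart a.1), (h₁ _).2 (X.1.F.posPart a.1).2⟩ := by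
      refine Y.1.F.posPart_eq _ ⟨f (X.1.F.negPart a.1), (h₂ _).2 (X.1.F.negPart a.1).2⟩ ?_
      change f a.1 = f _ * f _
      rw [← map_mul, X.1.F.posPart_mul_negPart]
    exact Subtype.ext (h₃ _ _ (congrArg Subtype.val h₄).symm)

theorem coe_mul_smul (X : AbelianFact.{u}) (a b : X.subgroup) (x y : X.1.F.neg) :
    ((a * x • b : X.subgroup) : X.1.G) * ((x * y : X.1.F.neg) : X.1.G) =
      (a * x) * (b * y) := by
  rw [Subgroup.coe_mul, coe_smul, Subgroup.coe_mul]
  group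

/-- The group `G` as the semidirect product of `A = {u ξ(u⁻¹)}` and `G₋`. -/
def semidirectEquiv (X : AbelianFact.{u}) : X.toCycleData.Semidirect ≃* X.1.G :=
  MulEquiv.ofBijective
    (MonoidHom.mk' (fun g => Subtype.val (p := (· ∈ X.subgroup)) g.left *
      Subtype.val (p := (· ∈ X.1.F.neg)) g.right)
      (fun ⟨a, x⟩ ⟨b, y⟩ => X.coe_mul_smul a b x y)) (by
    constructor
    · rintro ⟨a, x⟩ ⟨b, y⟩ h
      obtain ⟨h₁, h₂⟩ := UniqueFactorization.leftSet_mul_inj (ξ := X.1.ξ) a.2 b.2 h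
      exact SemidirectProduct.ext (Subtype.ext h₁) h₂
    · intro g
      refine ⟨⟨⟨_, X.mem_subgroup (X.1.F.posPart g)⟩,
        X.1.ξ (X.1.F.posPart g) * X.1.F.negPart g⟩, ?_⟩
      conv_rhs => rw [← X.1.F.posPart_mul_negPart g]
      change _ * _ * (_ * _ : X.1.G) = _
      group)

theorem coe_mul_ξ (X : AbelianFact.{u}) (a : X.subgroup) :
    (a * X.1.ξ (X.1.F.posPart a) : X.1.G) = X.1.F.posPart a := by
  conv_lhs => enter [1]; rw [X.coe_eq a]
  group

/-- In the coordinates of `semidirectEquiv` this is the graph condition of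
`CycleData.mem_graph_iff`: writing `a = p ξ(p)⁻¹`, the `G₋`-part of `a x` is `ξ(p)⁻¹ x`. -/
theorem mul_mem_pos_iff (X : AbelianFact.{u}) (a : X.subgroup) (x : X.1.F.neg) :
    (a * x : X.1.G) ∈ X.1.F.pos ↔ x = X.1.ξ (X.1.F.posPart a) := by
  constructor
  · intro h
    have h₁ := X.coe_eq a
    set p := X.1.F.posPart (a : X.1.G)
    have h₂ : (p * (((X.1.ξ p)⁻¹ * x : X.1.F.neg) : X.1.G) : X.1.G) =
        (⟨_, h⟩ : X.1.F.pos) * ((1 : X.1.F.neg) : X.1.G) := by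
      rw [Subgroup.coe_one, mul_one, Subgroup.coe_mul, ← mul_assoc, Subgroup.coe_inv]
      exact congrArg (· * _) h₁.symm
    exact (inv_mul_eq_one.1 (X.1.F.factor_inj h₂).2).symm
  · rintro rfl
    rw [X.coe_mul_ξ]
    exact Subtype.prop _

theorem mul_mem_neg_iff (X : AbelianFact.{u}) (a : X.subgroup) (x : X.1.F.neg) :
    (a * x : X.1.G) ∈ X.1.F.neg ↔ a = 1 := by
  constructor
  · intro h
    have h₁ : (a * x : X.1.G) = 1 * (⟨_, h⟩ : X.1.F.neg) := (one_mul _).symm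
    exact Subtype.ext
      (UniqueFactorization.leftSet_mul_inj (ξ := X.1.ξ) a.2 X.subgroup.one_mem h₁).1
  · rintro rfl
    simp

theorem toCycleData_toFactHom_iso (X : AbelianFact.{u}) : X.toCycleData.toFactHom.Iso X.1 := by
  refine ⟨X.semidirectEquiv, ?_, ?_, ?_⟩
  · rintro ⟨a, x⟩
    exact (X.mul_mem_pos_iff a x).trans (X.toCycleData.mem_graph_iff ⟨a, x⟩).symm
  · rintro ⟨a, x⟩
    exact (X.mul_mem_neg_iff a x).trans (X.toCycleData.mem_range_inr_iff ⟨a, x⟩).symm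
  · rintro ⟨_, a, rfl⟩ q h
    have h₁ : (X.1.F.posPart (Subtype.val (p := (· ∈ X.subgroup)) a)) = q :=
      Subtype.ext ((X.coe_mul_ξ a).symm.trans h)
    rw [← h₁]
    exact one_mul _

end AbelianFact

theorem CycleData.toAbelianFact_toCycleData_iso (Y : CycleData.{u}) :
    Y.toAbelianFact.toCycleData.Iso Y := by
  have hA : ∀ g : Y.Semidirect, g ∈ Y.toAbelianFact.subgroup ↔ g.right = 1 := Y.mem_leftSet_iff
  let φ : Y.N ≃* (SemidirectProduct.inr : Y.N →* Y.Semidirect).range :=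
    MonoidHom.ofInjective SemidirectProduct.inr_injective
  let ψ : Y.A ≃* Y.toAbelianFact.subgroup := MulEquiv.ofBijective
    (MonoidHom.codRestrict (SemidirectProduct.inl : Y.A →* Y.Semidirect) Y.toAbelianFact.subgroup
      fun a => (hA _).2 rfl) (by
    constructor
    · intro a b h
      exact SemidirectProduct.inl_injective (congrArg Subtype.val h)
    · rintro ⟨g, hg⟩
      exact ⟨SemidirectProduct.left g,
        Subtype.ext (SemidirectProduct.ext rfl ((hA g).1 hg).symm)⟩)
  refine CycleData.setoid.iseqv.symm ⟨φ, ψ, fun x a => ?_, fun a => ?_⟩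
  · refine Subtype.ext (Eq.trans ?_ (Y.toAbelianFact.coe_smul (φ x) (ψ a)).symm)
    exact (SemidirectProduct.inl_aut (φ := MulDistribMulAction.toMulAut Y.N Y.A) x a).trans
      (by rw [map_inv]; rfl)
  · have h : Y.factorization.posPart (SemidirectProduct.inl a : Y.Semidirect) =
        ⟨⟨a, Y.ζ a⟩, a, rfl⟩ := by
      refine Y.factorization.posPart_eq _ ⟨SemidirectProduct.inr (Y.ζ a)⁻¹, _, rfl⟩ ?_
      refine SemidirectProduct.ext ?_ ?_
      · change a = a * Y.ζ a • (1 : Y.A)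
        rw [smul_one, mul_one]
      · exact (mul_inv_cancel (Y.ζ a)).symm
    refine Subtype.ext (Eq.trans ?_ (congrArg (fun p => (Y.toFactHom.ξ p).1) h.symm))
    rfl

/-- The correspondence between the second and the third kind of data. -/
def abelianBraidedEquiv : Quotient AbelianFact.setoid.{u} ≃ Quotient BraidedFact.setoid.{u} :=
  Quotient.congr
    (Equiv.subtypeEquivRight fun _ => UniqueFactorization.isAbelianNormal_iff_isBraided)
    fun _ _ => Iff.rfl

/-- The correspondence between the second and the fourth kind of data. -/
def abelianCycleEquiv : Quotient AbelianFact.setoid.{u} ≃ Quotient CycleData.setoid.{u} where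
  toFun := Quotient.map AbelianFact.toCycleData fun _ _ h => AbelianFact.iso_toCycleData h
  invFun := Quotient.map CycleData.toAbelianFact fun _ _ h => h.toFactHom
  left_inv := by
    rintro ⟨X⟩
    exact Quotient.sound X.toCycleData_toFactHom_iso
  right_inv := by
    rintro ⟨Y⟩
    exact Quotient.sound Y.toAbelianFact_toCycleData_iso

/-! ### Non-negative matrices with non-negative inverse -/

section Monomial

/-- A vanishing off-diagonal entry of `AB` or `BA` is a sum of non-negative terms, so every term
vanishes. If `A k j ≠ 0`, then column `k` of `B` is supported at `j`; as columns of `B` are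
non-zero, two non-zero entries of `A` in one column or in one row are impossible. -/
theorem exists_perm_of_nonneg_inverse {ι : Type*} [Fintype ι] [DecidableEq ι] (A B : ι → ι → ℂ)
    (hA : ∀ i j, 0 ≤ A i j) (hB : ∀ i j, 0 ≤ B i j)
    (hAB : ∀ i j, ∑ k, A i k * B k j = if i = j then 1 else 0)
    (hBA : ∀ i j, ∑ k, B i k * A k j = if i = j then 1 else 0) :
    ∃ σ : Equiv.Perm ι, ∀ i j, A i j ≠ 0 ↔ i = σ j := by
  have hsupp : ∀ {k j i}, A k j ≠ 0 → i ≠ j → B i k = 0 := by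
    intro k j i hk hij
    have h := hBA i j
    rw [if_neg hij, Finset.sum_eq_zero_iff_of_nonneg
      (fun k _ => mul_nonneg (hB i k) (hA k j))] at h
    exact (mul_eq_zero.1 (h k (Finset.mem_univ k))).resolve_right hk
  have hcol : ∀ k, ∃ i, B i k ≠ 0 := by
    intro k
    by_contra! h
    have h₁ := hAB k k
    simp [h] at h₁
  have hex : ∀ j, ∃ k, A k j ≠ 0 := by
    intro j
    by_contra! h
    have h₁ := hBA j j
    simp [h] at h₁
  have huniq : ∀ {k k' j}, A k j ≠ 0 → A k' j ≠ 0 → k = k' := by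
    intro k k' j hk hk'
    by_contra hne
    have h := hAB k k'
    rw [if_neg hne, Finset.sum_eq_zero_iff_of_nonneg
      (fun i _ => mul_nonneg (hA k i) (hB i k'))] at h
    have h₁ := (mul_eq_zero.1 (h j (Finset.mem_univ j))).resolve_left hk
    obtain ⟨i, hi⟩ := hcol k'
    by_cases hij : i = j
    · exact hi (hij ▸ h₁)
    · exact hi (hsupp hk' hij)
  choose σ hσ using hex
  have hinj : Function.Injective σ := by
    intro j j' h
    by_contra hne
    obtain ⟨i, hi⟩ := hcol (σ j)
    by_cases hij : i = j
    · subst hij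
      exact hi (hsupp (h ▸ hσ j' : A (σ i) j' ≠ 0) hne)
    · exact hi (hsupp (hσ j) hij)
  refine ⟨Equiv.ofBijective σ (Finite.injective_iff_bijective.1 hinj), fun i j => ⟨fun h => ?_, ?_⟩⟩
  · exact huniq h (hσ j)
  · rintro rfl
    exact hσ j

/-- An endomorphism that is non-negative in a basis and has a non-negative inverse permutes the
basis up to positive factors. -/
theorem exists_perm_of_nonneg_linearMap {ι V : Type*} [Finite ι] [AddCommGroup V] [Module ℂ V]
    (b : Module.Basis ι ℂ V) (f g : V →ₗ[ℂ] V) (hf : ∀ i j, 0 ≤ b.repr (f (b i)) j)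
    (hg : ∀ i j, 0 ≤ b.repr (g (b i)) j) (hfg : f ∘ₗ g = LinearMap.id) :
    ∃ σ : Equiv.Perm ι, ∀ i j, b.repr (f (b i)) j ≠ 0 ↔ j = σ i := by
  classical
  have := Fintype.ofFinite ι
  have : Module.Finite ℂ V := Module.Finite.of_basis b
  have hgf : g ∘ₗ f = LinearMap.id := (LinearMap.comp_eq_id_comm ℂ V).1 hfg
  have key : ∀ f g : V →ₗ[ℂ] V, f ∘ₗ g = LinearMap.id → ∀ i j,
      ∑ k, b.repr (f (b k)) i * b.repr (g (b j)) k = if i = j then 1 else 0 := by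
    intro f g h i j
    have h₁ := LinearMap.congr_fun h (b j)
    rw [LinearMap.comp_apply, ← b.sum_repr (g (b j)), map_sum] at h₁
    have h₂ := congrArg (fun v => b.repr v i) h₁
    simp only [map_smul, map_sum, Finsupp.coe_finsetSum, Finset.sum_apply, Finsupp.smul_apply,
      smul_eq_mul, LinearMap.id_apply, Module.Basis.repr_self, Finsupp.single_apply] at h₂
    simp only [mul_comm (b.repr (f _) i), h₂, eq_comm]
  obtain ⟨σ, hσ⟩ := exists_perm_of_nonneg_inverse (fun i j => b.repr (f (b j)) i)
    (fun i j => b.repr (g (b j)) i) (fun i j => hf j i) (fun i j => hg j i) (key f g hfg)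
    (key g f hgf)
  exact ⟨σ, fun i j => hσ j i⟩

/-- Linear combinations of basis vectors with prescribed first index are determined by
their terms. -/
theorem Module.Basis.sum_smul_eq {ι κ V : Type*} [Fintype ι] [AddCommGroup V] [Module ℂ V]
    (b : Module.Basis (ι × κ) ℂ V) {c c' : ι → ℂ} {f f' : ι → κ}
    (h : ∑ i, c i • b (i, f i) = ∑ i, c' i • b (i, f' i)) (i : ι) (hi : c i ≠ 0) :
    c i = c' i ∧ f i = f' i := by
  classical
  have h₁ := congrArg (fun v => b.repr v (i, f i)) h
  simp only [map_sum, map_smul, Module.Basis.repr_self, Finsupp.coe_finsetSum, Finset.sum_apply,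
    Finsupp.smul_apply, Finsupp.single_apply, smul_eq_mul, Prod.mk.injEq, mul_ite, mul_one,
    mul_zero, ite_and] at h₁
  rw [Finset.sum_ite_eq' Finset.univ i, Finset.sum_ite_eq' Finset.univ i] at h₁
  simp only [Finset.mem_univ, if_true] at h₁
  by_cases h₂ : f' i = f i
  · rw [if_pos h₂] at h₁
    exact ⟨h₁, h₂.symm⟩
  · rw [if_neg h₂] at h₁
    exact absurd h₁ hi

end Monomial

/-! ### Comparing terms in tensor powers of `H(G; G₊, G₋)` -/

namespace Bicross

variable {G : Type u} [Group G] (F : UniqueFactorization G)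

/-- The basis `{u x}` of `H(G; G₊, G₋)`, indexed by `u ∈ G₊` and `x ∈ G₋`. -/
def elBasis : Module.Basis (F.pos × F.neg) ℂ (Bicross F) :=
  (basis F).reindex (Subgroup.IsComplement.equiv F.isComplement)

theorem elBasis_apply (p : F.pos) (x : F.neg) : elBasis F (p, x) = el F p x := by
  rw [elBasis, Module.Basis.reindex_apply]
  rfl

variable [Finite G]

/-- Each side has a single term for each pair of left units `(p, q)`, so equality can be read off
term by term. Together with the threefold version, this turns identities of tensors into identities
in `G`. -/
theorem sum_smul_el_tmul_el_eq {c c' : F.pos → F.pos → ℂ} {f g f' g' : F.pos → F.pos → F.neg}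
    (h : ∑ p, ∑ q, c p q • (el F p (f p q) ⊗ₜ[ℂ] el F q (g p q)) =
      ∑ p, ∑ q, c' p q • (el F p (f' p q) ⊗ₜ[ℂ] el F q (g' p q)))
    (p q : F.pos) (hp : c p q ≠ 0) : c p q = c' p q ∧ f p q = f' p q ∧ g p q = g' p q := by
  let b := ((elBasis F).tensorProduct (elBasis F)).reindex (Equiv.prodProdProdComm _ _ _ _)
  have hb : ∀ p q x y, b ((p, q), (x, y)) = el F p x ⊗ₜ[ℂ] el F q y := by
    intro p q x y
    simp [b, elBasis_apply]
  simp only [← hb] at h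
  have h₁ := b.sum_smul_eq (c := fun i => c i.1 i.2) (c' := fun i => c' i.1 i.2)
    (f := fun i => (f i.1 i.2, g i.1 i.2)) (f' := fun i => (f' i.1 i.2, g' i.1 i.2))
    (by simpa only [Fintype.sum_prod_type] using h) (p, q) hp
  exact ⟨h₁.1, Prod.mk.inj h₁.2⟩

theorem sum_smul_el_tmul_el_tmul_el_eq {c c' : F.pos → F.pos → F.pos → ℂ}
    {f g k f' g' k' : F.pos → F.pos → F.pos → F.neg}
    (h : ∑ p, ∑ q, ∑ r, c p q r •
        (el F p (f p q r) ⊗ₜ[ℂ] (el F q (g p q r) ⊗ₜ[ℂ] el F r (k p q r))) =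
      ∑ p, ∑ q, ∑ r, c' p q r •
        (el F p (f' p q r) ⊗ₜ[ℂ] (el F q (g' p q r) ⊗ₜ[ℂ] el F r (k' p q r))))
    (p q r : F.pos) (hp : c p q r ≠ 0) :
    c p q r = c' p q r ∧ f p q r = f' p q r ∧ g p q r = g' p q r ∧ k p q r = k' p q r := by
  let e : (F.pos × F.neg) × (F.pos × F.neg) × (F.pos × F.neg) ≃
      (F.pos × F.pos × F.pos) × (F.neg × F.neg × F.neg) :=
    ((Equiv.refl _).prodCongr (Equiv.prodProdProdComm _ _ _ _)).trans
      (Equiv.prodProdProdComm _ _ _ _)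
  let b := ((elBasis F).tensorProduct ((elBasis F).tensorProduct (elBasis F))).reindex e
  have hb : ∀ p q r x y z, b ((p, q, r), (x, y, z)) =
      el F p x ⊗ₜ[ℂ] (el F q y ⊗ₜ[ℂ] el F r z) := by
    intro p q r x y z
    simp [b, e, elBasis_apply]
  simp only [← hb] at h
  have h₁ := b.sum_smul_eq (c := fun i => c i.1 i.2.1 i.2.2) (c' := fun i => c' i.1 i.2.1 i.2.2)
    (f := fun i => (f i.1 i.2.1 i.2.2, g i.1 i.2.1 i.2.2, k i.1 i.2.1 i.2.2))
    (f' := fun i => (f' i.1 i.2.1 i.2.2, g' i.1 i.2.1 i.2.2, k' i.1 i.2.1 i.2.2))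
    (by simpa only [Fintype.sum_prod_type] using h) (p, q, r) hp
  obtain ⟨h₂, h₃⟩ := h₁
  obtain ⟨h₄, h₅⟩ := Prod.mk.inj h₃
  exact ⟨h₂, h₄, Prod.mk.inj h₅⟩

end Bicross

/-! ### Quasi-triangular structures on `H(G; G₊, G₋)` -/

namespace Bicross

variable {G : Type u} [Group G] [Finite G] (F : UniqueFactorization G)

/-- The tensor `∑_{u, v ∈ G₊} r(u, v) {u a(u, v)} ⊗ {v b(u, v)}`. -/
def tens (r : F.pos → F.pos → ℂ) (a b : F.pos → F.pos → F.neg) : Bicross F ⊗[ℂ] Bicross F :=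
  ∑ p, ∑ q, r p q • (el F p (a p q) ⊗ₜ[ℂ] el F q (b p q))

variable (r : F.pos → F.pos → ℂ) (a b : F.pos → F.pos → F.neg)

theorem one_tmul_one_eq : (1 : Bicross F ⊗[ℂ] Bicross F) = tens F (fun _ _ => 1) 1 1 := by
  simp only [tens, Algebra.TensorProduct.one_def, one_eq, TensorProduct.sum_tmul,
    TensorProduct.tmul_sum, one_smul, Pi.one_apply]
  exact Finset.sum_comm

theorem counit_left_tens :
    TensorProduct.lid ℂ _ (LinearMap.rTensor (Bicross F) (Coalgebra.counit (R := ℂ))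
      (tens F r a b)) = ∑ q, r 1 q • el F q (b 1 q) := by
  simp only [tens, map_sum, map_smul, LinearMap.rTensor_tmul, TensorProduct.lid_tmul, counit_el]
  simp

theorem counit_right_tens :
    TensorProduct.rid ℂ _ (LinearMap.lTensor (Bicross F) (Coalgebra.counit (R := ℂ))
      (tens F r a b)) = ∑ p, r p 1 • el F p (a p 1) := by
  simp only [tens, map_sum, map_smul, LinearMap.lTensor_tmul, TensorProduct.rid_tmul, counit_el]
  simp

theorem comul_left_tens :
    TensorProduct.assoc ℂ _ _ _ (LinearMap.rTensor (Bicross F) (Coalgebra.comul (R := ℂ))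
      (tens F r a b)) = ∑ p, ∑ p', ∑ q, r (p * p') q •
        (el F p (F.posOnNeg p' (a (p * p') q)) ⊗ₜ[ℂ]
          (el F p' (a (p * p') q) ⊗ₜ[ℂ] el F q (b (p * p') q))) := by
  simp only [tens, map_sum, map_smul, LinearMap.rTensor_tmul, comul_el, TensorProduct.sum_tmul,
    TensorProduct.assoc_tmul, Finset.smul_sum]
  rw [Finset.sum_congr rfl fun p _ => Finset.sum_comm, Finset.sum_comm]
  conv_rhs => rw [Finset.sum_comm]
  refine Finset.sum_congr rfl fun h _ => ?_
  exact Fintype.sum_equiv (Equiv.mulRight h⁻¹) _ _ fun p => by simp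

theorem comul_right_tens :
    LinearMap.lTensor (Bicross F) (Coalgebra.comul (R := ℂ)) (tens F r a b) =
      ∑ p, ∑ q, ∑ q', r p (q * q') •
        (el F p (a p (q * q')) ⊗ₜ[ℂ]
          (el F q (F.posOnNeg q' (b p (q * q'))) ⊗ₜ[ℂ] el F q' (b p (q * q')))) := by
  simp only [tens, map_sum, map_smul, LinearMap.lTensor_tmul, comul_el, TensorProduct.tmul_sum,
    Finset.smul_sum]
  refine Finset.sum_congr rfl fun p _ => ?_
  rw [Finset.sum_comm]
  conv_rhs => rw [Finset.sum_comm]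
  refine Finset.sum_congr rfl fun q' _ => ?_
  exact Fintype.sum_equiv (Equiv.mulRight q'⁻¹) _ _ fun q => by simp

/-- Only the third legs meet. Their product vanishes unless the left unit coming from the second
copy of `R` is `q^{b(p, q)}`, which removes one of the four sums. -/
theorem leg₁₃_mul_leg₂₃_tens :
    leg₁₃ (tens F r a b) * leg₂₃ (tens F r a b) =
      ∑ p, ∑ p', ∑ q, (r p q * r p' (F.posPow q (b p q))) •
        (el F p (a p q) ⊗ₜ[ℂ] (el F p' (a p' (F.posPow q (b p q))) ⊗ₜ[ℂ]
          el F q (b p q * b p' (F.posPow q (b p q))))) := by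
  simp only [leg₁₃, leg₂₃, tens, map_sum, map_smul, LinearMap.lTensor_tmul,
    TensorProduct.mk_apply, TensorProduct.tmul_sum, TensorProduct.tmul_smul]
  rw [Finset.sum_mul]
  refine Finset.sum_congr rfl fun p _ => ?_
  rw [Finset.sum_mul]
  conv_rhs => rw [Finset.sum_comm]
  refine Finset.sum_congr rfl fun q _ => ?_
  simp only [Finset.mul_sum, smul_mul_smul_comm, Algebra.TensorProduct.tmul_mul_tmul, one_mul,
    mul_one, el_mul_el, TensorProduct.tmul_ite, smul_ite, smul_zero, Finset.sum_ite_eq,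
    Finset.mem_univ, if_true]

theorem leg₁₃_mul_leg₁₂_tens :
    leg₁₃ (tens F r a b) * leg₁₂ (tens F r a b) =
      ∑ p, ∑ q, ∑ q', (r p q' * r (F.posPow p (a p q')) q) •
        (el F p (a p q' * a (F.posPow p (a p q')) q) ⊗ₜ[ℂ]
          (el F q (b (F.posPow p (a p q')) q) ⊗ₜ[ℂ] el F q' (b p q'))) := by
  simp only [leg₁₃, leg₁₂, tens, map_sum, map_smul, LinearMap.lTensor_tmul,
    TensorProduct.mk_apply, TensorProduct.sum_tmul, ← TensorProduct.smul_tmul',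
    TensorProduct.assoc_tmul]
  rw [Finset.sum_mul]
  refine Finset.sum_congr rfl fun p _ => ?_
  rw [Finset.sum_mul]
  conv_rhs => rw [Finset.sum_comm]
  refine Finset.sum_congr rfl fun q _ => ?_
  rw [Finset.sum_comm, Finset.mul_sum]
  refine Finset.sum_congr rfl fun q' _ => ?_
  simp only [Finset.mul_sum, smul_mul_smul_comm, Algebra.TensorProduct.tmul_mul_tmul, one_mul,
    mul_one, el_mul_el, TensorProduct.ite_tmul, smul_ite, smul_zero, Finset.sum_ite_eq,
    Finset.mem_univ, if_true]

/-- Both legs meet here, so both left units of the second factor are determined by the first. -/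
theorem comm_tens_mul_tens :
    TensorProduct.comm ℂ _ _ (tens F r a b) * tens F r a b =
      ∑ q, ∑ p, (r p q * r (F.posPow q (b p q)) (F.posPow p (a p q))) •
        (el F q (b p q * a (F.posPow q (b p q)) (F.posPow p (a p q))) ⊗ₜ[ℂ]
          el F p (a p q * b (F.posPow q (b p q)) (F.posPow p (a p q)))) := by
  simp only [tens, map_sum, map_smul, TensorProduct.comm_tmul]
  conv_rhs => rw [Finset.sum_comm]
  rw [Finset.sum_mul]
  refine Finset.sum_congr rfl fun p _ => ?_
  rw [Finset.sum_mul]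
  refine Finset.sum_congr rfl fun q _ => ?_
  simp only [Finset.mul_sum, smul_mul_smul_comm, Algebra.TensorProduct.tmul_mul_tmul,
    el_mul_el, TensorProduct.tmul_ite, TensorProduct.ite_tmul,
    smul_ite, smul_zero, Finset.sum_ite_eq, Finset.mem_univ, if_true]

/-- The second leg fixes the summation variable of the coproduct as `h = q^{b(p, q)}`; the first leg
then survives exactly when `p^{a(p, q)} h = w`. -/
theorem tens_mul_comul (w : F.pos) (x : F.neg) :
    tens F r a b * Coalgebra.comul (R := ℂ) (el F w x) =
      ∑ p, ∑ q, (if F.posPow p (a p q) * F.posPow q (b p q) = w then r p q else 0) •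
        (el F p (a p q * F.posOnNeg (F.posPow q (b p q)) x) ⊗ₜ[ℂ] el F q (b p q * x)) := by
  simp only [tens, comul_el]
  rw [Finset.sum_mul]
  refine Finset.sum_congr rfl fun p _ => ?_
  rw [Finset.sum_mul]
  refine Finset.sum_congr rfl fun q _ => ?_
  simp only [Finset.mul_sum, smul_mul_assoc, Algebra.TensorProduct.tmul_mul_tmul, el_mul_el,
    TensorProduct.tmul_ite, TensorProduct.ite_tmul,
    smul_ite, smul_zero, Finset.sum_ite_eq, Finset.mem_univ, if_true,
    ite_smul, zero_smul, eq_mul_inv_iff_mul_eq]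

theorem comm_comul_mul_tens (w : F.pos) (x : F.neg) :
    TensorProduct.comm ℂ _ _ (Coalgebra.comul (R := ℂ) (el F w x)) * tens F r a b =
      ∑ p, ∑ q, (if q * p = w then r (F.posPow p x) (F.posPow q (F.posOnNeg p x)) else 0) •
        (el F p (x * a (F.posPow p x) (F.posPow q (F.posOnNeg p x))) ⊗ₜ[ℂ]
          el F q (F.posOnNeg p x * b (F.posPow p x) (F.posPow q (F.posOnNeg p x)))) := by
  simp only [tens, comul_el, map_sum, TensorProduct.comm_tmul]
  rw [Finset.sum_mul]
  refine Finset.sum_congr rfl fun p _ => ?_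
  have h : ∀ q : F.pos, q * p = w ↔ q = w * p⁻¹ := fun q => by rw [eq_mul_inv_iff_mul_eq]
  simp only [h, ite_smul, zero_smul, Finset.sum_ite_eq', Finset.mem_univ, if_true]
  simp only [Finset.mul_sum, mul_smul_comm, Algebra.TensorProduct.tmul_mul_tmul, el_mul_el,
    TensorProduct.tmul_ite, TensorProduct.ite_tmul,
    smul_ite, smul_zero, Finset.sum_ite_eq, Finset.mem_univ, if_true]

end Bicross

/-! ### Vectors with non-negative coefficients -/

/-- All coefficients of `v` in the basis `b` are non-negative real numbers. -/
def IsNonneg {ι V : Type*} [AddCommGroup V] [Module ℂ V] (b : Module.Basis ι ℂ V) (v : V) : Prop :=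
  ∀ i, 0 ≤ b.repr v i

namespace IsNonneg

variable {ι κ V W : Type*} [AddCommGroup V] [Module ℂ V] [AddCommGroup W] [Module ℂ W]
  {b : Module.Basis ι ℂ V} {c : Module.Basis κ ℂ W}

theorem zero : IsNonneg b 0 := fun i => by simp

theorem smul {v : V} (hv : IsNonneg b v) {z : ℂ} (hz : 0 ≤ z) : IsNonneg b (z • v) := fun i => by
  simpa using mul_nonneg hz (hv i)

theorem sum {α : Type*} {s : Finset α} {f : α → V} (h : ∀ a ∈ s, IsNonneg b (f a)) :
    IsNonneg b (∑ a ∈ s, f a) := fun i => by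
  simpa using Finset.sum_nonneg fun a ha => h a ha i

theorem self (i : ι) : IsNonneg b (b i) := fun j => by
  classical
  rw [b.repr_self, Finsupp.single_apply]
  split_ifs <;> simp

theorem map [Finite ι] {f : V →ₗ[ℂ] W} (hf : ∀ i, IsNonneg c (f (b i))) {v : V}
    (hv : IsNonneg b v) : IsNonneg c (f v) := by
  have := Fintype.ofFinite ι
  rw [← b.sum_repr v, map_sum]
  refine sum fun i _ => ?_
  rw [map_smul]
  exact (hf i).smul (hv i)

theorem tmul {v : V} {w : W} (hv : IsNonneg b v) (hw : IsNonneg c w) :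
    IsNonneg (b.tensorProduct c) (v ⊗ₜ[ℂ] w) := by
  rintro ⟨i, j⟩
  rw [Module.Basis.tensorProduct_repr_tmul_apply, smul_eq_mul]
  exact mul_nonneg (hw j) (hv i)

theorem mul {A : Type*} [Ring A] [Algebra ℂ A] [Finite ι] {b : Module.Basis ι ℂ A}
    (hb : ∀ i j, IsNonneg b (b i * b j)) {v w : A} (hv : IsNonneg b v) (hw : IsNonneg b w) :
    IsNonneg b (v * w) :=
  map (f := LinearMap.mulRight ℂ w) (fun i => map (f := LinearMap.mulLeft ℂ (b i)) (hb i) hw) hv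

theorem basis_tmul_mul {A : Type*} [Ring A] [Algebra ℂ A] {b : Module.Basis ι ℂ A}
    (hb : ∀ i j, IsNonneg b (b i * b j)) (i j : ι × ι) :
    IsNonneg (b.tensorProduct b) (b.tensorProduct b i * b.tensorProduct b j) := by
  rw [Module.Basis.tensorProduct_apply', Module.Basis.tensorProduct_apply',
    Algebra.TensorProduct.tmul_mul_tmul]
  exact (hb _ _).tmul (hb _ _)

theorem comm {b : Module.Basis ι ℂ V} [Finite ι] {v : V ⊗[ℂ] V}
    (hv : IsNonneg (b.tensorProduct b) v) :
    IsNonneg (b.tensorProduct b) (TensorProduct.comm ℂ V V v) := by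
  refine map (f := (TensorProduct.comm ℂ V V).toLinearMap) (fun i => ?_) hv
  rw [Module.Basis.tensorProduct_apply']
  exact (self _).tmul (self _)

end IsNonneg

/-! ### Positivity in the basis `G` and the shape of positive invertible tensors -/

namespace Bicross

variable {G : Type u} [Group G] [Finite G] {F : UniqueFactorization G}

theorem isNonneg_mul (g h : G) : IsNonneg (basis F) (basis F g * basis F h) := by
  rw [basis_eq_el, basis_eq_el F h, el_mul_el]
  split_ifs
  · exact IsNonneg.self _
  · exact IsNonneg.zero

theorem isNonneg_one : IsNonneg (basis F) 1 := by
  rw [one_eq]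
  exact IsNonneg.sum fun _ _ => IsNonneg.self _

theorem isPositiveBasis : IsPositiveBasis (basis F) where
  mul_nonneg := isNonneg_mul
  one_nonneg := isNonneg_one
  comul_nonneg g j k := by
    rw [basis_eq_el, comul_el]
    exact IsNonneg.sum (b := (basis F).tensorProduct (basis F))
      (fun _ _ => (IsNonneg.self _).tmul (IsNonneg.self _)) (j, k)
  counit_nonneg g := by
    rw [basis_eq_el, counit_el]
    split_ifs <;> simp
  antipode_nonneg g := by
    have h : HopfAlgebra.antipode ℂ (basis F g) = basis F g⁻¹ := by
      change antipodeMap F (basis F g) = _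
      rw [antipodeMap, Module.Basis.constr_basis]
    rw [h]
    exact IsNonneg.self _

theorem rMatrix_eq_tens (ξ η : F.pos →* F.neg) :
    F.rMatrix ξ η = tens F (fun _ _ => 1) (fun p q => (F.negPow (η q) p)⁻¹) (fun p _ => ξ p) := by
  simp only [UniqueFactorization.rMatrix, tens, one_smul, el, Subgroup.coe_inv]

theorem isPositiveTensor_rMatrix (ξ η : F.pos →* F.neg) :
    IsPositiveTensor (basis F) (F.rMatrix ξ η) := fun i j =>
  IsNonneg.sum (b := (basis F).tensorProduct (basis F)) (fun _ _ => IsNonneg.sum fun _ _ =>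
    (IsNonneg.self _).tmul (IsNonneg.self _)) (i, j)

/-- A non-negative tensor with a non-negative left inverse has exactly one term for each pair of
left units. -/
theorem exists_eq_tens {R S : Bicross F ⊗[ℂ] Bicross F} (hR : IsPositiveTensor (basis F) R)
    (hS : IsPositiveTensor (basis F) S) (hSR : S * R = 1) :
    ∃ (r : F.pos → F.pos → ℝ) (a b : F.pos → F.pos → F.neg), (∀ p q, 0 < r p q) ∧
      R = tens F (fun p q => r p q) a b := by
  set B := (basis F).tensorProduct (basis F) with hB
  have hpos : ∀ {R}, IsPositiveTensor (basis F) R → ∀ i, IsNonneg B (B i * R) := by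
    intro R hR i
    have hR' : IsNonneg B R := fun ij => hR ij.1 ij.2
    exact IsNonneg.mul (IsNonneg.basis_tmul_mul isNonneg_mul) (IsNonneg.self i) hR'
  -- Right multiplications by `R` and by `S` are mutually inverse and non-negative, hence monomial.
  obtain ⟨σ, hσ⟩ := exists_perm_of_nonneg_linearMap B (LinearMap.mulRight ℂ R)
    (LinearMap.mulRight ℂ S) (fun i j => hpos hR i j) (fun i j => hpos hS i j)
    (by
      refine LinearMap.ext fun x => ?_
      simp only [LinearMap.comp_apply, LinearMap.mulRight_apply, mul_assoc, hSR, mul_one,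
        LinearMap.id_apply])
  have key : ∀ p q : F.pos, ∃ (r : ℝ) (a b : F.neg), 0 < r ∧
      (el F p 1 ⊗ₜ[ℂ] el F q 1) * R = (r : ℂ) • (el F p a ⊗ₜ[ℂ] el F q b) := by
    intro p q
    set i : G × G := ((p : G), (q : G)) with hi
    have hBi : B i = el F p 1 ⊗ₜ[ℂ] el F q 1 := by
      simp [hB, hi, el]
    set z := B.repr (B i * R) (σ i) with hz
    have hz₀ : z ≠ 0 := (hσ i (σ i)).2 rfl
    have hz₁ : 0 ≤ z := hpos hR i (σ i)
    have h₁ : B i * R = z • B (σ i) := by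
      refine B.ext_elem fun j => ?_
      rw [map_smul, B.repr_self, Finsupp.smul_apply]
      by_cases hj : j = σ i
      · rw [hj, Finsupp.single_eq_same, smul_eq_mul, mul_one]
      · rw [Finsupp.single_eq_of_ne hj, smul_zero]
        by_contra h
        exact hj ((hσ i j).1 h)
    have hBσ : B (σ i) = el F (F.posPart (σ i).1) (F.negPart (σ i).1) ⊗ₜ[ℂ]
        el F (F.posPart (σ i).2) (F.negPart (σ i).2) := by
      rw [← basis_eq_el, ← basis_eq_el, hB, Module.Basis.tensorProduct_apply']
    -- `{p} ⊗ {q}` is idempotent, so multiplying its image by it once more does not kill the image;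
    -- this forces the left units of the image to be `p` and `q`.
    have h₂ : B i * (B i * R) = B i * R := by
      rw [← mul_assoc, hBi, Algebra.TensorProduct.tmul_mul_tmul, el_mul_el, el_mul_el]
      simp [F.posPow_one]
    rw [h₁, mul_smul_comm] at h₂
    have h₃ : B i * B (σ i) ≠ 0 := by
      intro h
      rw [h, smul_zero] at h₂
      exact smul_ne_zero hz₀ (B.ne_zero _) h₂.symm
    rw [hBi, hBσ, Algebra.TensorProduct.tmul_mul_tmul, el_mul_el, el_mul_el, F.posPow_one,
      F.posPow_one] at h₃
    have h₄ : p = F.posPart (σ i).1 := by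
      by_contra h
      simp [h] at h₃
    have h₅ : q = F.posPart (σ i).2 := by
      by_contra h
      simp [h] at h₃
    rw [hBσ, ← h₄, ← h₅, hBi] at h₁
    obtain ⟨h₆, h₇⟩ := Complex.nonneg_iff.1 hz₁
    have h₈ : z = (z.re : ℂ) := Complex.ext rfl (by simp [← h₇])
    refine ⟨z.re, _, _, lt_of_le_of_ne h₆ fun h => hz₀ ?_, by rw [← h₈]; exact h₁⟩
    rw [h₈, ← h, Complex.ofReal_zero]
  choose r a b hr h using key
  refine ⟨r, a, b, hr, ?_⟩
  simp only [tens, ← h, ← Finset.sum_mul]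
  -- Since `1 ⊗ 1` is the sum of the idempotents `{p} ⊗ {q}`, the pieces add up to `R`.
  have h₁ := one_tmul_one_eq F
  simp only [tens, one_smul, Pi.one_apply] at h₁
  rw [← h₁, one_mul]

end Bicross

/-! ### Classification of the positive triangular structures on `H(G; G₊, G₋)` -/

namespace UniqueFactorization.IsBraided

variable {G : Type u} [Group G] {F : UniqueFactorization G} {ξ : F.pos →* F.neg}

/-- The second identity for the factorization `p x = (ᵖx)(pˣ)`, stated through the other pair of
actions. -/
theorem posOnNeg_mul_map (h : F.IsBraided ξ) (p : F.pos) (x : F.neg) :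
    F.posOnNeg p x * ξ (F.posPow p x) = ξ p * x := by
  have h₁ := h.2 (F.posPow p x) (F.posOnNeg p x)
  rw [F.negOnPos_posPow, F.negPow_posPow] at h₁
  exact h₁.symm

/-- Apply `ξ` to the first identity for `q p` and compare with the second for `x = ξ(q)`: both equal
`ξ(q) ξ(p)`, and the common left factor `ξ` of `^{ξ(q)}p` cancels. -/
theorem negPow_map (h : F.IsBraided ξ) (p q : F.pos) :
    F.negPow (ξ q) p = ξ (F.posPow q (ξ p)) := by
  have h₁ := h.2 p (ξ q)
  rw [← map_mul, h.1 q p, map_mul] at h₁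
  exact mul_left_cancel h₁

theorem posOnNeg_map (h : F.IsBraided ξ) (p q : F.pos) :
    F.posOnNeg q (ξ p) = ξ (F.negOnPos (ξ q) p) := by
  have h₁ := h.posOnNeg_mul_map q (ξ p)
  rw [← map_mul, h.1 q p, map_mul] at h₁
  exact mul_right_cancel h₁

end UniqueFactorization.IsBraided

namespace Bicross

variable {G : Type u} [Group G] [Finite G] {F : UniqueFactorization G}

/-- For braided `ξ` the inner element `ξ(v)ᵘ` becomes `ξ(v^{ξ(u)})`. Each axiom then holds term by
term, for terms with the same left units. -/
theorem isTriangular_rMatrix {ξ : F.pos →* F.neg} (h : F.IsBraided ξ) :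
    IsTriangular (F.rMatrix ξ ξ) := by
  have hinv : TensorProduct.comm ℂ _ _ (F.rMatrix ξ ξ) * F.rMatrix ξ ξ = 1 := by
    rw [rMatrix_eq_tens, comm_tens_mul_tens, one_tmul_one_eq, tens]
    refine Finset.sum_congr rfl fun q _ => Finset.sum_congr rfl fun p _ => ?_
    have h₁ : F.posPow (F.negOnPos (ξ q) p) (ξ (F.posPow q (ξ p))) = p := by
      rw [← h.negPow_map, F.posPow_negOnPos]
    simp only [F.posPow_negPow_inv]
    simp only [h.negPow_map, h₁, mul_one, mul_inv_cancel, inv_mul_cancel, Pi.one_apply]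
  -- The flip is an algebra automorphism of order two, so it turns the left inverse into a right
  -- inverse.
  have hinv' : F.rMatrix ξ ξ * TensorProduct.comm ℂ _ _ (F.rMatrix ξ ξ) = 1 := by
    have h₁ := congrArg (Algebra.TensorProduct.comm ℂ (Bicross F) (Bicross F)) hinv
    rw [map_mul, map_one] at h₁
    have h₂ : ∀ z : Bicross F ⊗[ℂ] Bicross F,
        Algebra.TensorProduct.comm ℂ (Bicross F) (Bicross F) (TensorProduct.comm ℂ _ _ z) = z :=
      fun z => (TensorProduct.comm ℂ (Bicross F) (Bicross F)).symm_apply_apply z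
    rw [h₂] at h₁
    exact h₁
  refine ⟨⟨⟨_, hinv', hinv, fun g => ?_⟩, ?_, ?_, ?_, ?_⟩, hinv⟩
  · have key : TensorProduct.comm ℂ _ _ (Coalgebra.comul (R := ℂ) g) * F.rMatrix ξ ξ =
        F.rMatrix ξ ξ * Coalgebra.comul (R := ℂ) g := by
      have h₁ : LinearMap.mulRight ℂ (F.rMatrix ξ ξ) ∘ₗ
          (TensorProduct.comm ℂ (Bicross F) (Bicross F)).toLinearMap ∘ₗ Coalgebra.comul (R := ℂ) =
          LinearMap.mulLeft ℂ (F.rMatrix ξ ξ) ∘ₗ Coalgebra.comul (R := ℂ) := by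
        refine ext_el F fun w x => ?_
        simp only [LinearMap.comp_apply, LinearMap.mulRight_apply, LinearMap.mulLeft_apply,
          LinearEquiv.coe_coe]
        rw [rMatrix_eq_tens, tens_mul_comul, comm_comul_mul_tens]
        refine Finset.sum_congr rfl fun p _ => Finset.sum_congr rfl fun q _ => ?_
        have h₂ : x * (ξ (F.posPow (F.posPow q (F.posOnNeg p x)) (ξ (F.posPow p x))))⁻¹ =
            (ξ (F.posPow q (ξ p)))⁻¹ * F.posOnNeg (F.posPow q (ξ p)) x := by
          rw [← F.posPow_mul, h.posOnNeg_mul_map, F.posPow_mul, mul_inv_eq_iff_eq_mul, mul_assoc,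
            h.posOnNeg_mul_map, inv_mul_cancel_left]
        rw [F.posPow_negPow_inv, ← h.1 q p, h.posOnNeg_mul_map, h.negPow_map, h.negPow_map, h₂]
      exact LinearMap.congr_fun h₁ g
    rw [← key, mul_assoc, hinv', mul_one]
  · rw [rMatrix_eq_tens, comul_left_tens, leg₁₃_mul_leg₂₃_tens]
    refine Finset.sum_congr rfl fun p _ => Finset.sum_congr rfl fun p' _ =>
      Finset.sum_congr rfl fun q _ => ?_
    have h₁ : F.posOnNeg p' (F.negPow (ξ q) (p * p'))⁻¹ = (F.negPow (ξ q) p)⁻¹ := by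
      rw [F.negPow_inv, F.negPow_inv, ← F.mul_posOnNeg]
      simp
    rw [h₁, h.negPow_map (p * p') q, h.negPow_map p', map_mul ξ p p', F.posPow_mul, one_mul]
  · rw [rMatrix_eq_tens, comul_right_tens, leg₁₃_mul_leg₁₂_tens]
    refine Finset.sum_congr rfl fun p _ => Finset.sum_congr rfl fun q _ =>
      Finset.sum_congr rfl fun q' _ => ?_
    rw [F.posPow_negPow_inv, h.posOnNeg_map, map_mul, F.mul_negPow, mul_inv_rev, one_mul]
  · rw [rMatrix_eq_tens, counit_left_tens, one_eq]
    simp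
  · rw [rMatrix_eq_tens, counit_right_tens, one_eq]
    simp [F.one_negPow]

/-- In `(τR)R`, the term with left units `(q, 1)` has second leg `{η(q)⁻¹ ξ(q)}`, while in `1 ⊗ 1`
it has `{1}`. -/
theorem eq_of_comm_mul_self {ξ η : F.pos →* F.neg}
    (h : TensorProduct.comm ℂ _ _ (F.rMatrix ξ η) * F.rMatrix ξ η = 1) : ξ = η := by
  rw [rMatrix_eq_tens, comm_tens_mul_tens, one_tmul_one_eq, tens] at h
  ext q : 1
  have h₁ := (sum_smul_el_tmul_el_eq F h q 1 (by simp)).2.2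
  simp only [map_one, F.posPow_one, F.negPow_one, Pi.one_apply, inv_mul_eq_one] at h₁
  exact h₁.symm

theorem rMatrix_injective {ξ η : F.pos →* F.neg} (h : F.rMatrix ξ ξ = F.rMatrix η η) : ξ = η := by
  rw [rMatrix_eq_tens, rMatrix_eq_tens, tens, tens] at h
  ext p : 1
  exact (sum_smul_el_tmul_el_eq F h p 1 one_ne_zero).2.2

/-- Positive factors `r(u, v)` that are multiplicative in the twisted sense that is forced by the
quasi-triangular axioms are trivial. -/
theorem eq_one_of_twisted_mul {r : F.pos → F.pos → ℝ} (hr : ∀ p q, 0 < r p q)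
    (ξ η : F.pos →* F.neg) (h₁ : ∀ p p' q, r (p * p') q = r p q * r p' (F.posPow q (ξ p)))
    (h₂ : ∀ p q q', r p (q * q') = r p q' * r (F.negOnPos (η q') p) q) (p q : F.pos) :
    r p q = 1 := by
  set f : F.pos → ℝ := fun q => ∏ p, r p q with hf
  have hf₀ : ∀ q, 0 < f q := fun q => Finset.prod_pos fun p _ => hr p q
  -- Taking the product over all `p` removes the twist in `h₂`, because `η(q')` permutes `G₊`.
  have h₃ : ∀ q q', f (q * q') = f q * f q' := by
    intro q q'
    simp only [hf, h₂, Finset.prod_mul_distrib]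
    rw [mul_comm]
    congr 1
    have hbij : Function.Injective (F.negOnPos (η q')) := by
      intro s t hst
      have := congrArg (F.negOnPos (η q')⁻¹) hst
      simpa only [← F.mul_negOnPos, inv_mul_cancel, F.one_negOnPos] using this
    exact Fintype.prod_bijective _ (Finite.injective_iff_bijective.1 hbij) _ _ fun _ => rfl
  have h₄ : ∀ q, f q = 1 := by
    intro q
    have h₁ : f 1 = 1 := by
      have h := h₃ 1 1
      rw [mul_one] at h
      exact (mul_eq_left₀ (hf₀ 1).ne').1 h.symm
    let φ : F.pos →* ℝ := { toFun := f, map_one' := h₁, map_mul' := h₃ }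
    -- A homomorphism from a finite group to the positive reals is trivial.
    have h₅ : f q ^ Fintype.card F.pos = 1 := by
      change φ q ^ _ = 1
      rw [← map_pow, pow_card_eq_one, map_one]
    exact (pow_eq_one_iff_of_nonneg (hf₀ q).le Fintype.card_ne_zero).1 h₅
  have h₅ : r p q ^ Fintype.card F.pos = 1 := by
    -- The product of `h₁` over `p'`, with `p p'` again running through `G₊`.
    have h₆ : f q = r p q ^ Fintype.card F.pos * f (F.posPow q (ξ p)) := by
      rw [← Finset.card_univ, ← Finset.prod_const, hf, ← Finset.prod_mul_distrib]
      simp only [← h₁]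
      exact (Fintype.prod_equiv (Equiv.mulLeft p) _ _ fun _ => rfl).symm
    rw [h₄, h₄, mul_one] at h₆
    exact h₆.symm
  exact (pow_eq_one_iff_of_nonneg (hr p q).le Fintype.card_ne_zero).1 h₅

/-- Triangularity makes `τR` a non-negative inverse, so `exists_eq_tens` gives one term for each
pair. The axioms, compared term by term, then determine all the data. -/
theorem exists_isBraided_of_isTriangular {R : Bicross F ⊗[ℂ] Bicross F} (h : IsTriangular R)
    (hR : IsPositiveTensor (basis F) R) :
    ∃ ξ : F.pos →* F.neg, F.IsBraided ξ ∧ F.rMatrix ξ ξ = R := by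
  have hS : IsPositiveTensor (basis F) (TensorProduct.comm ℂ _ _ R) := fun i j =>
    IsNonneg.comm (fun ij => hR ij.1 ij.2) (i, j)
  obtain ⟨r, a, b, hr, rfl⟩ := exists_eq_tens hR hS h.comm_mul_self
  have hr₀ : ∀ p q, (r p q : ℂ) ≠ 0 := fun p q => by exact_mod_cast (hr p q).ne'
  have hl : ∀ p p' q, r (p * p') q = r p q * r p' (F.posPow q (b p q)) ∧
      F.posOnNeg p' (a (p * p') q) = a p q ∧ a (p * p') q = a p' (F.posPow q (b p q)) ∧
      b (p * p') q = b p q * b p' (F.posPow q (b p q)) := by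
    intro p p' q
    have h₁ := h.comul_left
    rw [comul_left_tens, leg₁₃_mul_leg₂₃_tens] at h₁
    have h₂ := sum_smul_el_tmul_el_tmul_el_eq F h₁ p p' q (hr₀ _ _)
    exact ⟨by exact_mod_cast h₂.1, h₂.2⟩
  have hrt : ∀ p q q', r p (q * q') = r p q' * r (F.posPow p (a p q')) q ∧
      a p (q * q') = a p q' * a (F.posPow p (a p q')) q ∧
      F.posOnNeg q' (b p (q * q')) = b (F.posPow p (a p q')) q ∧ b p (q * q') = b p q' := by
    intro p q q'
    have h₁ := h.comul_right
    rw [comul_right_tens, leg₁₃_mul_leg₁₂_tens] at h₁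
    have h₂ := sum_smul_el_tmul_el_tmul_el_eq F h₁ p q q' (hr₀ _ _)
    exact ⟨by exact_mod_cast h₂.1, h₂.2⟩
  -- The last leg of the second coproduct axiom at `q' = 1` shows that `b` depends on `p` only.
  have hbξ : ∀ p q, b p q = b p 1 := fun p q => by simpa using (hrt p q 1).2.2.2
  let ξ : F.pos →* F.neg := MonoidHom.mk' (fun p => b p 1) fun p p' => by
    rw [(hl p p' 1).2.2.2, hbξ p']
  have hξ : ∀ p q, b p q = ξ p := hbξ
  have haα : ∀ p q, a p q = F.posOnNeg p⁻¹ (a 1 q) := fun p q => by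
    have h₁ := (hl 1 p q).2.1
    rw [one_mul] at h₁
    rw [← h₁, ← F.mul_posOnNeg, inv_mul_cancel, F.one_posOnNeg]
  -- The inverse is needed because the second coproduct axiom makes `q ↦ a 1 q` reverse products.
  let η : F.pos →* F.neg := MonoidHom.mk' (fun q => (a 1 q)⁻¹) fun q q' => by
    rw [(hrt 1 q q').2.1, F.one_posPow, mul_inv_rev]
  have hη : ∀ p q, a p q = (F.negPow (η q) p)⁻¹ := fun p q => by
    rw [F.negPow_inv, haα]
    change _ = F.posOnNeg p⁻¹ (a 1 q)⁻¹⁻¹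
    rw [inv_inv]
  have hr₁ : ∀ p q, r p q = 1 := by
    refine eq_one_of_twisted_mul hr ξ η (fun p p' q => ?_) fun p q q' => ?_
    · rw [(hl p p' q).1, hξ]
    · rw [(hrt p q q').1, hη, F.posPow_negPow_inv]
  have hR' : tens F (fun p q => (r p q : ℂ)) a b = F.rMatrix ξ η := by
    rw [rMatrix_eq_tens]
    simp only [hr₁, Complex.ofReal_one, ← hη, ← hξ _ 1, hbξ, tens]
  rw [hR'] at h ⊢
  have hξη : ξ = η := eq_of_comm_mul_self h.comm_mul_self
  rw [← hξη] at h ⊢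
  refine ⟨ξ, ?_, rfl⟩
  obtain ⟨S, hRS, hSR, hg⟩ := h.exists_inv
  have key : ∀ (p q : F.pos) (x : F.neg), q * p = F.negOnPos (ξ q) p * F.posPow q (ξ p) ∧
      F.posOnNeg p x * ξ (F.posPow p x) = ξ p * x := by
    intro p q x
    -- Choosing `w = q p` makes the coefficient of the term `(p, q)` on the side of `τΔ` equal to
    -- `1`. The condition on the other side must therefore hold, which is the first identity; the
    -- second legs give the second identity.
    have h₁ := congrArg (· * F.rMatrix ξ ξ) (hg (el F (q * p) x))
    simp only [mul_assoc, hSR, mul_one] at h₁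
    rw [rMatrix_eq_tens, tens_mul_comul, comm_comul_mul_tens] at h₁
    obtain ⟨h₂, -, h₃⟩ := sum_smul_el_tmul_el_eq F h₁ p q (by simp)
    refine ⟨?_, h₃⟩
    rw [if_pos rfl, F.posPow_negPow_inv] at h₂
    by_contra h₄
    rw [if_neg (Ne.symm h₄)] at h₂
    exact one_ne_zero h₂
  refine ⟨fun p q => (key q p 1).1, fun p x => ?_⟩
  have h₁ := (key (F.negOnPos x p) 1 (F.negPow x p)).2
  rw [F.posOnNeg_negOnPos, F.posPow_negOnPos] at h₁
  exact h₁.symm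

theorem bijOn_rMatrix (F : UniqueFactorization G) :
    Set.BijOn (fun ξ => F.rMatrix ξ ξ) {ξ | F.IsAbelianNormal ξ}
      {R | IsTriangular R ∧ IsPositiveTensor (basis F) R} := by
  refine ⟨fun ξ h => ⟨isTriangular_rMatrix h.isBraided, isPositiveTensor_rMatrix ξ ξ⟩,
    fun ξ _ η _ h => rMatrix_injective h, ?_⟩
  rintro R ⟨h, hR⟩
  obtain ⟨ξ, hξ, rfl⟩ := exists_isBraided_of_isTriangular h hR
  exact ⟨ξ, hξ.isAbelianNormal, rfl⟩

/-- For `ξ = η` the given isomorphism is inversion, since `ξ(u) u⁻¹ = (u ξ(u)⁻¹)⁻¹`. A group on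
which inversion is a homomorphism is abelian, so the condition of abelian normality holds. -/
theorem isTriangular_rMatrix_iff {ξ η : F.pos →* F.neg} (h : F.IsQuasiTriangularPair ξ η) :
    IsTriangular (F.rMatrix ξ η) ↔ ξ = η := by
  refine ⟨fun h' => eq_of_comm_mul_self h'.comm_mul_self, ?_⟩
  rintro rfl
  obtain ⟨A, B, hA, -, hn, -, f, hf⟩ := h
  refine isTriangular_rMatrix (UniqueFactorization.IsAbelianNormal.isBraided ⟨A, hA, hn, ?_⟩)
  have hinv : ∀ a : A, (f a : G) = (a : G)⁻¹ := by
    intro a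
    obtain ⟨p, hp⟩ : (a : G) ∈ F.leftSet ξ := hA ▸ a.2
    rw [hf p a hp.symm, ← hp]
    simp
  intro a ha b hb
  have h₁ := congrArg Subtype.val (map_mul f ⟨a, ha⟩ ⟨b, hb⟩)
  rw [Subgroup.coe_mul, hinv, hinv, hinv] at h₁
  simpa using congrArg (·⁻¹) h₁

end Bicross

/-! ### The combinatorics of the supports of the structure constants -/

/-- The relations satisfied by the supports of the structure constants of a Hopf algebra with a
positive basis: `mul i j k` says that `k` occurs in the product of `i` and `j`, and `comul i j k`
that `i ⊗ j` occurs in the coproduct of `k`. The last two fields say that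
`a ⊗ b ↦ a₁ ⊗ a₂ b` and `a ⊗ b ↦ a b₁ ⊗ b₂` permute the basis `i ⊗ j` up to positive factors. -/
structure HopfSupport (ι : Type u) where
  mul : ι → ι → ι → Prop
  comul : ι → ι → ι → Prop
  unit : ι → Prop
  counit : ι → Prop
  assoc : ∀ i j k l, (∃ m, mul i j m ∧ mul m k l) ↔ ∃ m, mul j k m ∧ mul i m l
  coassoc : ∀ i j k l, (∃ m, comul i j m ∧ comul m k l) ↔ ∃ m, comul j k m ∧ comul i m l
  unit_mul : ∀ j k, (∃ i, unit i ∧ mul i j k) ↔ j = k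
  mul_unit : ∀ j k, (∃ i, unit i ∧ mul j i k) ↔ j = k
  counit_comul : ∀ j k, (∃ i, counit i ∧ comul i j k) ↔ j = k
  comul_counit : ∀ j k, (∃ i, counit i ∧ comul j i k) ↔ j = k
  mul_comul : ∀ i j k l, (∃ m, mul i j m ∧ comul k l m) ↔
    ∃ a b c d, comul a b i ∧ comul c d j ∧ mul a c k ∧ mul b d l
  counit_mul : ∀ i j, (∃ m, mul i j m ∧ counit m) ↔ counit i ∧ counit j
  unit_comul : ∀ i j, (∃ m, comul i j m ∧ unit m) ↔ unit i ∧ unit j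
  counit_unit : ∃ i, unit i ∧ counit i
  left_perm : ∃ σ : Equiv.Perm (ι × ι), ∀ i j k l,
    (∃ m, comul k m i ∧ mul m j l) ↔ (k, l) = σ (i, j)
  right_perm : ∃ σ : Equiv.Perm (ι × ι), ∀ i j k l,
    (∃ m, comul m l j ∧ mul i m k) ↔ (k, l) = σ (i, j)

namespace HopfSupport

variable {ι : Type u} (P : HopfSupport ι)

/-- The supports for the dual Hopf algebra. -/
def dual : HopfSupport ι where
  mul := P.comul
  comul := P.mul
  unit := P.counit
  counit := P.unit
  assoc := P.coassoc
  coassoc := P.assoc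
  unit_mul := P.counit_comul
  mul_unit := P.comul_counit
  counit_comul := P.unit_mul
  comul_counit := P.mul_unit
  mul_comul i j k l := by
    refine Iff.trans ?_ ((P.mul_comul k l i j).trans ?_)
    · exact exists_congr fun _ => and_comm
    · constructor
      · rintro ⟨a, b, c, d, h₁, h₂, h₃, h₄⟩
        exact ⟨a, c, b, d, h₃, h₄, h₁, h₂⟩
      · rintro ⟨a, b, c, d, h₁, h₂, h₃, h₄⟩
        exact ⟨a, c, b, d, h₃, h₄, h₁, h₂⟩
  counit_mul := P.unit_comul
  unit_comul := P.counit_mul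
  counit_unit := P.counit_unit.imp fun _ => And.symm
  left_perm := by
    obtain ⟨σ, h⟩ := P.right_perm
    -- Exchanging product and coproduct transposes the relation of the other canonical map, so its
    -- permutation is inverted.
    refine ⟨σ.symm, fun i j k l => ?_⟩
    rw [Equiv.eq_symm_apply, eq_comm, ← h]
    exact exists_congr fun _ => and_comm
  right_perm := by
    obtain ⟨σ, h⟩ := P.left_perm
    refine ⟨σ.symm, fun i j k l => ?_⟩
    rw [Equiv.eq_symm_apply, eq_comm, ← h]
    exact exists_congr fun _ => and_comm

/-- The supports for the Hopf algebra with opposite product and opposite coproduct. -/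
def op : HopfSupport ι where
  mul i j := P.mul j i
  comul i j := P.comul j i
  unit := P.unit
  counit := P.counit
  assoc i j k l := (P.assoc k j i l).symm
  coassoc i j k l := (P.coassoc k j i l).symm
  unit_mul := P.mul_unit
  mul_unit := P.unit_mul
  counit_comul := P.comul_counit
  comul_counit := P.counit_comul
  mul_comul i j k l := by
    refine (P.mul_comul j i l k).trans ?_
    constructor
    · rintro ⟨a, b, c, d, h₁, h₂, h₃, h₄⟩
      exact ⟨d, c, b, a, h₂, h₁, h₄, h₃⟩
    · rintro ⟨a, b, c, d, h₁, h₂, h₃, h₄⟩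
      exact ⟨d, c, b, a, h₂, h₁, h₄, h₃⟩
  counit_mul i j := (P.counit_mul j i).trans and_comm
  unit_comul i j := (P.unit_comul j i).trans and_comm
  counit_unit := P.counit_unit
  left_perm := by
    obtain ⟨σ, h⟩ := P.right_perm
    refine ⟨(Equiv.prodComm _ _).trans (σ.trans (Equiv.prodComm _ _)), fun i j k l => ?_⟩
    rw [h j i l k]
    exact (Equiv.prodComm ι ι).injective.eq_iff.symm
  right_perm := by
    obtain ⟨σ, h⟩ := P.left_perm
    refine ⟨(Equiv.prodComm _ _).trans (σ.trans (Equiv.prodComm _ _)), fun i j k l => ?_⟩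
    rw [h j i l k]
    exact (Equiv.prodComm ι ι).injective.eq_iff.symm

/-! ### The groupoid of basis elements: units, counits, cancellation and inverses -/

variable {P}

theorem eq_of_unit_mul {u j k : ι} (hu : P.unit u) (h : P.mul u j k) : j = k :=
  (P.unit_mul j k).1 ⟨u, hu, h⟩

theorem eq_of_mul_unit {u j k : ι} (hu : P.unit u) (h : P.mul j u k) : j = k :=
  (P.mul_unit j k).1 ⟨u, hu, h⟩

variable (P)

/-- The left unit of a basis element. -/
def src (j : ι) : ι := ((P.unit_mul j j).2 rfl).choose

/-- The right unit of a basis element. -/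
def tgt (j : ι) : ι := P.op.src j

/-- The left counit of a basis element. -/
def cosrc (j : ι) : ι := P.dual.src j

/-- The right counit of a basis element. -/
def cotgt (j : ι) : ι := P.dual.op.src j

theorem unit_src (j : ι) : P.unit (P.src j) := ((P.unit_mul j j).2 rfl).choose_spec.1

theorem src_mul_self (j : ι) : P.mul (P.src j) j j := ((P.unit_mul j j).2 rfl).choose_spec.2

theorem unit_tgt (j : ι) : P.unit (P.tgt j) := P.op.unit_src j

theorem mul_tgt_self (j : ι) : P.mul j (P.tgt j) j := P.op.src_mul_self j

theorem counit_cosrc (j : ι) : P.counit (P.cosrc j) := P.dual.unit_src j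

theorem cosrc_comul_self (j : ι) : P.comul (P.cosrc j) j j := P.dual.src_mul_self j

theorem counit_cotgt (j : ι) : P.counit (P.cotgt j) := P.dual.op.unit_src j

theorem comul_cotgt_self (j : ι) : P.comul j (P.cotgt j) j := P.dual.op.src_mul_self j

variable {P}

theorem eq_of_unit_mul_unit {u v k : ι} (hu : P.unit u) (hv : P.unit v) (h : P.mul u v k) :
    u = v :=
  (eq_of_mul_unit hv h).trans (eq_of_unit_mul hu h).symm

/-- Associativity shows that the product of `u` and `P.src j` is non-empty, and two units with
non-empty product coincide. -/
theorem src_eq {u j k : ι} (hu : P.unit u) (h : P.mul u j k) : P.src j = u := by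
  obtain rfl := eq_of_unit_mul hu h
  obtain ⟨m, hm, -⟩ := (P.assoc u (P.src j) j j).2 ⟨j, P.src_mul_self j, h⟩
  exact (eq_of_unit_mul_unit hu (P.unit_src j) hm).symm

theorem cosrc_eq {x j k : ι} (hx : P.counit x) (h : P.comul x j k) : P.cosrc j = x :=
  src_eq (P := P.dual) hx h

theorem cotgt_eq {x j k : ι} (hx : P.counit x) (h : P.comul j x k) : P.cotgt j = x :=
  src_eq (P := P.dual.op) hx h

theorem src_unit {u : ι} (hu : P.unit u) : P.src u = u :=
  eq_of_unit_mul_unit (P.unit_src u) hu (P.src_mul_self u)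

theorem tgt_unit {u : ι} (hu : P.unit u) : P.tgt u = u := src_unit (P := P.op) hu

theorem cosrc_counit {x : ι} (hx : P.counit x) : P.cosrc x = x := src_unit (P := P.dual) hx

theorem cotgt_counit {x : ι} (hx : P.counit x) : P.cotgt x = x := src_unit (P := P.dual.op) hx

/-- Since `cosrc i ⊗ i` occurs in the coproduct of `i`, the permutation of `left_perm` sends `(i,
j)` to `(cosrc i, k)`. Injectivity gives cancellation here; single-valuedness gives `mul_unique`. -/
theorem eq_of_mul {i i' j j' k k' : ι} (h : P.mul i j k) (h' : P.mul i' j' k')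
    (hv : P.cosrc i = P.cosrc i') (hk : k = k') : i = i' ∧ j = j' := by
  obtain ⟨σ, hσ⟩ := P.left_perm
  have h₁ := (hσ i j (P.cosrc i) k).1 ⟨i, P.cosrc_comul_self i, h⟩
  have h₂ := (hσ i' j' (P.cosrc i') k').1 ⟨i', P.cosrc_comul_self i', h'⟩
  rw [hv, hk, h₂] at h₁
  exact Prod.mk.inj (σ.injective h₁.symm)

theorem mul_unique {i j k k' : ι} (h : P.mul i j k) (h' : P.mul i j k') : k = k' := by
  obtain ⟨σ, hσ⟩ := P.left_perm
  have h₁ := (hσ i j (P.cosrc i) k).1 ⟨i, P.cosrc_comul_self i, h⟩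
  have h₂ := (hσ i j (P.cosrc i) k').1 ⟨i, P.cosrc_comul_self i, h'⟩
  exact (Prod.mk.inj (h₁.trans h₂.symm)).2

theorem mul_left_cancel {i j j' k : ι} (h : P.mul i j k) (h' : P.mul i j' k) : j = j' :=
  (eq_of_mul h h' rfl rfl).2

theorem mul_right_cancel {i i' j k : ι} (h : P.mul i j k) (h' : P.mul i' j k) : i = i' :=
  mul_left_cancel (P := P.op) h h'

theorem tgt_eq_src {i j k : ι} (h : P.mul i j k) : P.tgt i = P.src j := by
  obtain ⟨q, hq, -⟩ := (P.assoc i (P.tgt i) j k).1 ⟨i, P.mul_tgt_self i, h⟩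
  exact (src_eq (P.unit_tgt i) hq).symm

/-- Let `σ (i, j) = (x, l)`, realized by `m` with `x ⊗ m` in the coproduct of `i` and `l` in `m j`.
Inserting the common unit between `m` and `j` produces `q` in `m (tgt i)`. But `σ (i, tgt i) =
(cosrc i, i)`, so `q = i` and `l` occurs in `i j`. -/
theorem exists_mul {i j : ι} (h : P.tgt i = P.src j) : ∃ k, P.mul i j k := by
  obtain ⟨σ, hσ⟩ := P.left_perm
  have h₁ := (hσ i (P.tgt i) (P.cosrc i) i).1 ⟨i, P.cosrc_comul_self i, P.mul_tgt_self i⟩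
  obtain ⟨m, hm, hm'⟩ := (hσ i j (σ (i, j)).1 (σ (i, j)).2).2 rfl
  obtain ⟨q, hq, hq'⟩ := (P.assoc m (P.tgt i) j (σ (i, j)).2).2
    ⟨j, h ▸ P.src_mul_self j, hm'⟩
  have h₂ := (hσ i (P.tgt i) _ q).1 ⟨m, hm, hq⟩
  obtain rfl := (Prod.mk.inj (h₁.trans h₂.symm)).2
  exact ⟨_, hq'⟩

theorem src_mul {i j k : ι} (h : P.mul i j k) : P.src k = P.src i := by
  obtain ⟨q, hq, hq'⟩ := (P.assoc (P.src i) i j k).1 ⟨i, P.src_mul_self i, h⟩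
  obtain rfl := mul_unique h hq
  exact src_eq (P.unit_src i) hq'

theorem tgt_mul {i j k : ι} (h : P.mul i j k) : P.tgt k = P.tgt j := src_mul (P := P.op) h

theorem cosrc_comul {i j k : ι} (h : P.comul i j k) : P.cosrc k = P.cosrc i :=
  src_mul (P := P.dual) h

theorem cotgt_comul {i j k : ι} (h : P.comul i j k) : P.cotgt k = P.cotgt j :=
  tgt_mul (P := P.dual) h

/-- Surjectivity of the permutation at `(x, d)`: a counit `x` as left leg of a coproduct leaves the
other leg equal to the element itself. -/
theorem exists_mul_of_counit {x : ι} (hx : P.counit x) (d : ι) :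
    ∃ i j, P.cosrc i = x ∧ P.mul i j d := by
  obtain ⟨σ, hσ⟩ := P.left_perm
  set ij := σ.symm (x, d) with hij
  obtain ⟨m, hm, hm'⟩ := (hσ ij.1 ij.2 x d).2 (by rw [hij]; simp)
  obtain rfl := eq_of_unit_mul (P := P.dual) hx hm
  exact ⟨_, _, cosrc_eq hx hm, hm'⟩

/-- Every basis element is invertible in the groupoid of basis elements; moreover it is determined
by its left unit and its left counit. -/
theorem mul_src_of_cosrc {i j d : ι} (h : P.mul i j (P.src d)) (hi : P.cosrc i = P.cosrc d) :
    i = d := by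
  have hd := P.src_mul_self d
  -- Multiplying by `d` writes `d` as `i q`, to be compared with `d = d (tgt d)`: both left factors
  -- have the same left counit.
  obtain ⟨q, -, hq⟩ := (P.assoc i j d d).1 ⟨_, h, hd⟩
  exact (eq_of_mul hq (P.mul_tgt_self d) hi rfl).1

variable (P) in
-- Factor the left unit of `d` with a first factor of the same left counit as `d`; this factor has
-- to be `d`, so the other one is its inverse.
theorem exists_mul_src (d : ι) : ∃ c, P.mul d c (P.src d) := by
  obtain ⟨i, j, hi, h⟩ := exists_mul_of_counit (P.counit_cosrc d) (P.src d)
  obtain rfl := mul_src_of_cosrc h hi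
  exact ⟨j, h⟩

variable (P) in
theorem exists_mul_tgt (d : ι) : ∃ c, P.mul c d (P.tgt d) := P.op.exists_mul_src d

theorem ext_src_cosrc {d d' : ι} (h : P.src d = P.src d') (h' : P.cosrc d = P.cosrc d') :
    d = d' := by
  obtain ⟨c, hc⟩ := P.exists_mul_src d
  rw [h] at hc
  exact mul_src_of_cosrc hc h'

theorem exists_src_cosrc {u x : ι} (hu : P.unit u) (hx : P.counit x) :
    ∃ d, P.src d = u ∧ P.cosrc d = x := by
  obtain ⟨i, j, hi, h⟩ := exists_mul_of_counit hx u
  exact ⟨i, by rw [← src_mul h, src_unit hu], hi⟩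

theorem ext_tgt_cotgt {d d' : ι} (h : P.tgt d = P.tgt d') (h' : P.cotgt d = P.cotgt d') :
    d = d' :=
  ext_src_cosrc (P := P.op) h h'

theorem exists_tgt_cotgt {u x : ι} (hu : P.unit u) (hx : P.counit x) :
    ∃ d, P.tgt d = u ∧ P.cotgt d = x :=
  exists_src_cosrc (P := P.op) hu hx

variable (P) in
/-- The basis element that is both a unit and a counit. -/
def e : ι := P.counit_unit.choose

variable (P) in
theorem unit_e : P.unit P.e := P.counit_unit.choose_spec.1

variable (P) in
theorem counit_e : P.counit P.e := P.counit_unit.choose_spec.2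

theorem eq_e {i : ι} (h : P.unit i) (h' : P.counit i) : i = P.e := by
  obtain ⟨m, hm, -⟩ := (P.counit_mul i P.e).2 ⟨h', P.counit_e⟩
  exact eq_of_unit_mul_unit h P.unit_e hm

variable (P) in
theorem dual_e : P.dual.e = P.e := eq_e P.dual.counit_e P.dual.unit_e

/-- Multiplicativity of the counit passes counits from products to factors. It applies to `x = (src
x) x`, and conversely to `x x⁻¹ = src x = e`. -/
theorem counit_iff_src {x : ι} : P.counit x ↔ P.src x = P.e := by
  constructor
  · intro hx
    refine eq_e (P.unit_src x) ?_
    exact ((P.counit_mul (P.src x) x).1 ⟨x, P.src_mul_self x, hx⟩).1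
  · intro h
    obtain ⟨c, hc⟩ := P.exists_mul_src x
    exact ((P.counit_mul x c).1 ⟨_, hc, h ▸ P.counit_e⟩).1

theorem counit_iff_tgt {x : ι} : P.counit x ↔ P.tgt x = P.e := counit_iff_src (P := P.op)

theorem unit_iff_cosrc {x : ι} : P.unit x ↔ P.cosrc x = P.e := by
  rw [← P.dual_e]
  exact counit_iff_src (P := P.dual)

theorem unit_iff_cotgt {x : ι} : P.unit x ↔ P.cotgt x = P.e := by
  rw [← P.dual_e]
  exact counit_iff_tgt (P := P.dual)

theorem counit_of_mul {x y k : ι} (hx : P.counit x) (h : P.mul x y k) : P.counit k := by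
  rw [counit_iff_src] at hx ⊢
  rw [src_mul h, hx]

theorem exists_mul_of_counit_counit {x y : ι} (hx : P.counit x) (hy : P.counit y) :
    ∃ k, P.mul x y k :=
  exists_mul ((counit_iff_tgt.1 hx).trans (counit_iff_src.1 hy).symm)

/-- Multiply the terms `i ⊗ cotgt i` and `j ⊗ cotgt j` of the two coproducts: the second leg of the
result is a counit, hence the right counit of the product `k`. This is what makes the counits act
compatibly with products. -/
theorem mul_cotgt {i j k : ι} (h : P.mul i j k) : P.mul (P.cotgt i) (P.cotgt j) (P.cotgt k) := by
  obtain ⟨l, hl⟩ := exists_mul_of_counit_counit (P.counit_cotgt i) (P.counit_cotgt j)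
  obtain ⟨m, hm, hm'⟩ := (P.mul_comul i j k l).2
    ⟨_, _, _, _, P.comul_cotgt_self i, P.comul_cotgt_self j, h, hl⟩
  rwa [cotgt_eq (counit_of_mul (P.counit_cotgt i) hl) hm']

theorem mul_cosrc {i j k : ι} (h : P.mul i j k) : P.mul (P.cosrc i) (P.cosrc j) (P.cosrc k) :=
  mul_cotgt (P := P.op) h

theorem comul_src {i j k : ι} (h : P.comul i j k) : P.comul (P.src i) (P.src j) (P.src k) :=
  mul_cosrc (P := P.dual) h

theorem comul_tgt {i j k : ι} (h : P.comul i j k) : P.comul (P.tgt i) (P.tgt j) (P.tgt k) :=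
  mul_cotgt (P := P.dual) h

/-- The permutations control the pairs `(src, cosrc)` and `(tgt, cotgt)` directly. The mixed pair is
reached through inverses: inverting exchanges `src` with `tgt`, and by `mul_cotgt` the right counit
of the inverse is determined. -/
theorem ext_src_cotgt {d d' : ι} (h : P.src d = P.src d') (h' : P.cotgt d = P.cotgt d') :
    d = d' := by
  obtain ⟨c, hc⟩ := P.exists_mul_src d
  obtain ⟨c', hc'⟩ := P.exists_mul_src d'
  have h₁ := mul_cotgt hc
  have h₂ := mul_cotgt hc'
  rw [← h, ← h'] at h₂
  obtain rfl : c = c' := by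
    refine ext_tgt_cotgt ?_ (mul_left_cancel h₁ h₂)
    rw [← tgt_mul hc, ← tgt_mul hc', h]
  rw [← h] at hc'
  exact mul_right_cancel hc hc'

theorem exists_src_cotgt {u x : ι} (hu : P.unit u) (hx : P.counit x) :
    ∃ d, P.src d = u ∧ P.cotgt d = x := by
  -- The element sought is the inverse of the one with right unit `u` and right counit `x⁻¹`.
  obtain ⟨y, hy⟩ := P.exists_mul_src x
  rw [counit_iff_src.1 hx] at hy
  have hy' : P.counit y := ((P.counit_mul x y).1 ⟨_, hy, P.counit_e⟩).2
  obtain ⟨c, hc, hc'⟩ := exists_tgt_cotgt hu hy'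
  obtain ⟨d, hd⟩ := P.exists_mul_tgt c
  rw [hc] at hd
  refine ⟨d, by rw [← src_mul hd, src_unit hu], ?_⟩
  have h₁ := mul_cotgt hd
  rw [hc', unit_iff_cotgt.1 hu] at h₁
  exact mul_right_cancel h₁ hy

end HopfSupport

/-! ### Matched pairs of groups -/

/-- A matched pair of groups: a right action `uˣ` of `V` on the set `U` and a left action `ᵘx` of
`U` on the set `V`, compatible with the products. -/
structure MatchedPair (U V : Type u) [Group U] [Group V] where
  pow : U → V → U
  act : U → V → V
  pow_one : ∀ u, pow u 1 = u
  one_pow : ∀ x, pow 1 x = 1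
  act_one : ∀ u, act u 1 = 1
  one_act : ∀ x, act 1 x = x
  pow_mul : ∀ u x y, pow u (x * y) = pow (pow u x) y
  act_mul : ∀ u x y, act u (x * y) = act u x * act (pow u x) y
  mul_act : ∀ u v x, act (u * v) x = act u (act v x)
  mul_pow : ∀ u v x, pow (u * v) x = pow u (act v x) * pow v x

namespace MatchedPair

variable {U V : Type u} [Group U] [Group V] (m : MatchedPair U V)

/-- The group `V U` defined by a matched pair; `⟨x, u⟩` is the product `x u`. -/
@[ext]
structure Carrier (_m : MatchedPair U V) : Type u where
  neg : V
  pos : U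

instance : Mul m.Carrier := ⟨fun g h => ⟨g.neg * m.act g.pos h.neg, m.pow g.pos h.neg * h.pos⟩⟩
instance : One m.Carrier := ⟨⟨1, 1⟩⟩
instance : Inv m.Carrier := ⟨fun g => ⟨m.act g.pos⁻¹ g.neg⁻¹, m.pow g.pos⁻¹ g.neg⁻¹⟩⟩

theorem mul_def (g h : m.Carrier) :
    g * h = ⟨g.neg * m.act g.pos h.neg, m.pow g.pos h.neg * h.pos⟩ := rfl
theorem one_def : (1 : m.Carrier) = ⟨1, 1⟩ := rfl
theorem inv_def (g : m.Carrier) : g⁻¹ = ⟨m.act g.pos⁻¹ g.neg⁻¹, m.pow g.pos⁻¹ g.neg⁻¹⟩ := rfl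

instance : Group m.Carrier :=
  Group.ofLeftAxioms
    (fun _ _ _ => by
      simp only [mul_def, m.pow_mul, m.act_mul, m.mul_act, m.mul_pow, mul_assoc])
    (fun _ => by simp only [mul_def, one_def, m.one_act, m.one_pow, one_mul])
    (fun _ => by
      simp only [mul_def, inv_def, one_def, ← m.act_mul, ← m.pow_mul, inv_mul_cancel, m.act_one,
        m.pow_one])

instance [Finite U] [Finite V] : Finite m.Carrier :=
  Finite.of_injective (fun g : m.Carrier => (g.neg, g.pos)) fun _ _ hgh =>
    Carrier.ext (Prod.mk.inj hgh).1 (Prod.mk.inj hgh).2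

/-- The inclusion of `U`. -/
def inPos : U →* m.Carrier :=
  MonoidHom.mk' (fun u => ⟨1, u⟩) fun u v => by simp [mul_def, m.act_one, m.pow_one]

/-- The inclusion of `V`. -/
def inNeg : V →* m.Carrier :=
  MonoidHom.mk' (fun x => ⟨x, 1⟩) fun x y => by simp [mul_def, m.one_act, m.one_pow]

theorem inPos_injective : Function.Injective m.inPos := fun _ _ h => congrArg Carrier.pos h

theorem inNeg_injective : Function.Injective m.inNeg := fun _ _ h => congrArg Carrier.neg h

theorem inNeg_mul_inPos (x : V) (u : U) : m.inNeg x * m.inPos u = ⟨x, u⟩ := by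
  rw [mul_def]
  simp [inNeg, inPos, m.act_one, m.pow_one]

theorem inPos_mul_inNeg (u : U) (x : V) :
    m.inPos u * m.inNeg x = m.inNeg (m.act u x) * m.inPos (m.pow u x) := by
  rw [inNeg_mul_inPos, mul_def]
  simp [inNeg, inPos]

/-- The unique factorization of the group defined by a matched pair. -/
def factorization : UniqueFactorization m.Carrier where
  pos := m.inPos.range
  neg := m.inNeg.range
  isComplement := by
    refine Subgroup.IsComplement'.symm ⟨?_, ?_⟩
    · rintro ⟨⟨_, x, rfl⟩, ⟨_, u, rfl⟩⟩ ⟨⟨_, y, rfl⟩, ⟨_, v, rfl⟩⟩ h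
      have h₁ : m.inNeg x * m.inPos u = m.inNeg y * m.inPos v := h
      rw [inNeg_mul_inPos, inNeg_mul_inPos, Carrier.mk.injEq] at h₁
      obtain ⟨rfl, rfl⟩ := h₁
      rfl
    · rintro ⟨x, u⟩
      exact ⟨⟨⟨_, x, rfl⟩, ⟨_, u, rfl⟩⟩, m.inNeg_mul_inPos x u⟩

/-- `U` as the factor `G₊`. -/
def posEquiv : U ≃* m.factorization.pos := MonoidHom.ofInjective m.inPos_injective

/-- `V` as the factor `G₋`. -/
def negEquiv : V ≃* m.factorization.neg := MonoidHom.ofInjective m.inNeg_injective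

theorem posPow_eq (u : U) (x : V) :
    m.factorization.posPow (m.posEquiv u) (m.negEquiv x) = m.posEquiv (m.pow u x) :=
  m.factorization.posBar_eq (m.negEquiv (m.act u x)) _ (m.inPos_mul_inNeg u x)

theorem posOnNeg_eq (u : U) (x : V) :
    m.factorization.posOnNeg (m.posEquiv u) (m.negEquiv x) = m.negEquiv (m.act u x) :=
  m.factorization.negBar_eq _ (m.posEquiv (m.pow u x)) (m.inPos_mul_inNeg u x)

end MatchedPair

/-! ### The group attached to the supports of the structure constants -/

namespace HopfSupport

variable {ι : Type u} (P : HopfSupport ι)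

/-- The set of counits, which is a group for the product. -/
def Counits : Type u := {x : ι // P.counit x}

/-- The product of two counits. -/
def counitMul (x y : P.Counits) : P.Counits :=
  ⟨(exists_mul_of_counit_counit x.2 y.2).choose,
    counit_of_mul x.2 (exists_mul_of_counit_counit x.2 y.2).choose_spec⟩

theorem mul_counitMul (x y : P.Counits) : P.mul x.1 y.1 (P.counitMul x y).1 :=
  (exists_mul_of_counit_counit x.2 y.2).choose_spec

theorem exists_counitInv (x : P.Counits) : ∃ y : P.Counits, P.mul y.1 x.1 P.e := by
  obtain ⟨c, hc⟩ := P.exists_mul_tgt x.1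
  rw [counit_iff_tgt.1 x.2] at hc
  exact ⟨⟨c, ((P.counit_mul c x.1).1 ⟨_, hc, P.counit_e⟩).1⟩, hc⟩

instance : Mul P.Counits := ⟨P.counitMul⟩
instance : One P.Counits := ⟨⟨P.e, P.counit_e⟩⟩
instance : Inv P.Counits := ⟨fun x => (P.exists_counitInv x).choose⟩

theorem mul_coe (x y : P.Counits) : P.mul x.1 y.1 (x * y).1 := P.mul_counitMul x y

variable {P} in
theorem eq_mul {x y : P.Counits} {k : ι} (h : P.mul x.1 y.1 k) : k = (x * y).1 :=
  mul_unique h (P.mul_coe x y)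

instance : Group P.Counits :=
  Group.ofLeftAxioms
    (fun x y z => Subtype.ext <| by
      obtain ⟨k, hk, hk'⟩ := (P.assoc x.1 y.1 z.1 _).1 ⟨_, P.mul_coe x y, P.mul_coe (x * y) z⟩
      rw [eq_mul hk] at hk'
      exact eq_mul hk')
    (fun x => Subtype.ext (eq_of_unit_mul P.unit_e (P.mul_coe 1 x)).symm)
    (fun x => Subtype.ext (eq_mul (P.exists_counitInv x).choose_spec).symm)

theorem coe_one : (1 : P.Counits).1 = P.e := rfl

/-- The set of units, which is a group for the product of the dual Hopf algebra. -/
abbrev Units : Type u := P.dual.Counits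

theorem coe_one' : (1 : P.Units).1 = P.e := P.dual_e

/-- The basis element with given left unit and right counit. -/
def pair (u : P.Units) (x : P.Counits) : ι :=
  (exists_src_cotgt (P := P) (u := u.1) (x := x.1) u.2 x.2).choose

theorem src_pair (u : P.Units) (x : P.Counits) : P.src (P.pair u x) = u.1 :=
  (exists_src_cotgt (P := P) (u := u.1) (x := x.1) u.2 x.2).choose_spec.1

theorem cotgt_pair (u : P.Units) (x : P.Counits) : P.cotgt (P.pair u x) = x.1 :=
  (exists_src_cotgt (P := P) (u := u.1) (x := x.1) u.2 x.2).choose_spec.2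

variable {P} in
theorem eq_pair {i : ι} {u : P.Units} {x : P.Counits} (h : P.src i = u.1) (h' : P.cotgt i = x.1) :
    i = P.pair u x :=
  ext_src_cotgt (by rw [h, src_pair]) (by rw [h', cotgt_pair])

/-- The right unit of `P.pair u x`. -/
def pow (u : P.Units) (x : P.Counits) : P.Units := ⟨P.tgt (P.pair u x), P.unit_tgt _⟩

/-- The left counit of `P.pair u x`. -/
def act (u : P.Units) (x : P.Counits) : P.Counits := ⟨P.cosrc (P.pair u x), P.counit_cosrc _⟩

theorem pair_one (u : P.Units) : P.pair u 1 = u.1 :=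
  (eq_pair (src_unit u.2) (unit_iff_cotgt.1 u.2)).symm

theorem one_pair (x : P.Counits) : P.pair 1 x = x.1 :=
  (eq_pair ((counit_iff_src.1 x.2).trans P.coe_one'.symm) (cotgt_counit x.2)).symm

/-- The product exists because the units match, and it is identified by its left unit, kept by
products, and its right counit, multiplicative by `mul_cotgt`. Applying `tgt` and `cosrc` to it
yields half of the matched pair axioms; `comul_pair` yields the others. -/
theorem mul_pair (u : P.Units) (x y : P.Counits) :
    P.mul (P.pair u x) (P.pair (P.pow u x) y) (P.pair u (x * y)) := by
  obtain ⟨k, hk⟩ := exists_mul (P := P) (i := P.pair u x) (j := P.pair (P.pow u x) y)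
    (by rw [src_pair]; rfl)
  have h₁ := mul_cotgt hk
  rw [cotgt_pair, cotgt_pair] at h₁
  rwa [← eq_pair ((src_mul hk).trans (P.src_pair u x)) (eq_mul h₁)]

theorem comul_pair (u v : P.Units) (x : P.Counits) :
    P.comul (P.pair u (P.act v x)) (P.pair v x) (P.pair (u * v) x) := by
  obtain ⟨k, hk⟩ := exists_mul (P := P.dual) (i := P.pair u (P.act v x)) (j := P.pair v x)
    (P.cotgt_pair _ _)
  have h₁ := comul_src hk
  rw [src_pair, src_pair] at h₁
  rwa [← eq_pair (eq_mul (P := P.dual) h₁) ((cotgt_comul hk).trans (P.cotgt_pair v x))]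

/-- The matched pair formed by the units and the counits. -/
def matchedPair : MatchedPair P.Units P.Counits where
  pow := P.pow
  act := P.act
  pow_one u := Subtype.ext <| (congrArg P.tgt (P.pair_one u)).trans (tgt_unit u.2)
  one_pow x := Subtype.ext <| (congrArg P.tgt (P.one_pair x)).trans
    ((counit_iff_tgt.1 x.2).trans P.coe_one'.symm)
  act_one u := Subtype.ext <| (congrArg P.cosrc (P.pair_one u)).trans (unit_iff_cosrc.1 u.2)
  one_act x := Subtype.ext <| (congrArg P.cosrc (P.one_pair x)).trans (cosrc_counit x.2)
  pow_mul u x y := Subtype.ext <| tgt_mul (P.mul_pair u x y)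
  act_mul u x y := Subtype.ext <| eq_mul (x := P.act u x) (y := P.act (P.pow u x) y) <|
    mul_cosrc (P.mul_pair u x y)
  mul_act u v x := Subtype.ext <| cosrc_comul (P.comul_pair u v x)
  mul_pow u v x := Subtype.ext <|
    eq_mul (P := P.dual) (x := P.pow u (P.act v x)) (y := P.pow v x) <|
      comul_tgt (P.comul_pair u v x)

/-- The supports of the structure constants are those of `H(G; G₊, G₋)`. -/
structure IsBicross {G : Type u} [Group G] (F : UniqueFactorization G)
    (idx : F.pos × F.neg ≃ ι) : Prop where
  mul_iff : ∀ p x q y k,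
    P.mul (idx (p, x)) (idx (q, y)) k ↔ F.posPow p x = q ∧ k = idx (p, x * y)
  comul_iff : ∀ p x q y k,
    P.comul (idx (p, x)) (idx (q, y)) k ↔ F.posOnNeg q y = x ∧ k = idx (p * q, y)
  unit_iff : ∀ p x, P.unit (idx (p, x)) ↔ x = 1
  counit_iff : ∀ p x, P.counit (idx (p, x)) ↔ p = 1

/-- Basis elements are indexed by pairs of a unit and a counit. -/
def pairEquiv : P.Units × P.Counits ≃ ι :=
  Equiv.ofBijective (fun w => P.pair w.1 w.2) (by
    constructor
    · rintro ⟨u, x⟩ ⟨v, y⟩ h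
      have h' : P.pair u x = P.pair v y := h
      exact Prod.ext (Subtype.ext (by rw [← P.src_pair u x, h', P.src_pair]))
        (Subtype.ext (by rw [← P.cotgt_pair u x, h', P.cotgt_pair]))
    · intro i
      exact ⟨(⟨P.src i, P.unit_src i⟩, ⟨P.cotgt i, P.counit_cotgt i⟩), (eq_pair rfl rfl).symm⟩)

theorem exists_isBicross [Finite ι] : ∃ (G : Type u) (_ : Group G) (_ : Finite G)
    (F : UniqueFactorization G) (idx : F.pos × F.neg ≃ ι), P.IsBicross F idx := by
  have : Finite P.Units := Subtype.finite
  have : Finite P.Counits := Subtype.finite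
  set m := P.matchedPair
  -- The index `u x` stands for the basis element with left unit `u` and right counit `x`.
  let idx := (m.posEquiv.toEquiv.prodCongr m.negEquiv.toEquiv).symm.trans P.pairEquiv
  have hidx : ∀ u x, idx (m.posEquiv u, m.negEquiv x) = P.pair u x := fun u x =>
    congrArg P.pairEquiv
      ((m.posEquiv.toEquiv.prodCongr m.negEquiv.toEquiv).symm_apply_apply (u, x))
  refine ⟨m.Carrier, inferInstance, inferInstance, m.factorization, idx, ?_, ?_, ?_, ?_⟩
  · intro p x q y k
    obtain ⟨u, rfl⟩ := m.posEquiv.surjective p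
    obtain ⟨x, rfl⟩ := m.negEquiv.surjective x
    obtain ⟨v, rfl⟩ := m.posEquiv.surjective q
    obtain ⟨y, rfl⟩ := m.negEquiv.surjective y
    rw [m.posPow_eq, ← map_mul, hidx, hidx, hidx, m.posEquiv.injective.eq_iff]
    have h := P.mul_pair u x y
    constructor
    · intro hk
      have h₁ := tgt_eq_src hk
      rw [src_pair] at h₁
      have h₂ : P.pow u x = v := Subtype.ext h₁
      rw [h₂] at h
      exact ⟨h₂, mul_unique hk h⟩
    · rintro ⟨h₁, rfl⟩
      have h₂ : P.pow u x = v := h₁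
      rwa [h₂] at h
  · intro p x q y k
    obtain ⟨u, rfl⟩ := m.posEquiv.surjective p
    obtain ⟨x, rfl⟩ := m.negEquiv.surjective x
    obtain ⟨v, rfl⟩ := m.posEquiv.surjective q
    obtain ⟨y, rfl⟩ := m.negEquiv.surjective y
    rw [m.posOnNeg_eq, ← map_mul, hidx, hidx, hidx, m.negEquiv.injective.eq_iff]
    have h := P.comul_pair u v y
    constructor
    · intro hk
      have h₁ : P.cotgt _ = P.cosrc _ := tgt_eq_src (P := P.dual) hk
      rw [cotgt_pair] at h₁
      have h₂ : P.act v y = x := Subtype.ext h₁.symm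
      rw [h₂] at h
      exact ⟨h₂, mul_unique (P := P.dual) hk h⟩
    · rintro ⟨h₁, rfl⟩
      have h₂ : P.act v y = x := h₁
      rwa [h₂] at h
  · intro p x
    obtain ⟨u, rfl⟩ := m.posEquiv.surjective p
    obtain ⟨x, rfl⟩ := m.negEquiv.surjective x
    rw [hidx, map_eq_one_iff _ m.negEquiv.injective, unit_iff_cotgt, cotgt_pair, ← P.coe_one]
    exact Subtype.ext_iff.symm
  · intro p x
    obtain ⟨u, rfl⟩ := m.posEquiv.surjective p
    obtain ⟨x, rfl⟩ := m.negEquiv.surjective x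
    rw [hidx, map_eq_one_iff _ m.posEquiv.injective, counit_iff_src, src_pair, ← P.coe_one']
    exact Subtype.ext_iff.symm

end HopfSupport

/-! ### Triviality of real cocycles -/

/-- A pair of compatible real-valued cocycles on the two groupoids attached to a unique
factorization is a coboundary. -/
theorem UniqueFactorization.exists_coboundary {G : Type u} [Group G] [Finite G]
    (F : UniqueFactorization G) (L : F.pos → F.neg → F.neg → ℝ) (N : F.pos → F.pos → F.neg → ℝ)
    (hL : ∀ p x y z, L p x y + L p (x * y) z = L (F.posPow p x) y z + L p x (y * z))
    (hN : ∀ p q r x, N p q (F.posOnNeg r x) + N (p * q) r x = N q r x + N p (q * r) x)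
    (hLN : ∀ p q x y, L (p * q) x y + N p q (x * y) =
      L p (F.posOnNeg q x) (F.posOnNeg (F.posPow q x) y) + L q x y + N p q x +
        N (F.posPow p (F.posOnNeg q x)) (F.posPow q x) y) :
    ∃ c : F.pos → F.neg → ℝ,
      (∀ p x y, L p x y = c p x + c (F.posPow p x) y - c p (x * y)) ∧
      ∀ p q x, N p q x = c (p * q) x - c p (F.posOnNeg q x) - c q x := by
  have := Fintype.ofFinite F.neg
  have hn : (Fintype.card F.neg : ℝ) ≠ 0 := by exact_mod_cast Fintype.card_ne_zero
  have hm : (Fintype.card F.pos : ℝ) ≠ 0 := by exact_mod_cast Fintype.card_ne_zero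
  -- Averaging the cocycle identity over its last variable trivializes `L`.
  set c₁ : F.pos → F.neg → ℝ := fun p x => (∑ y, L p x y) / Fintype.card F.neg with hc₁
  have h₁ : ∀ p x y, L p x y = c₁ p x + c₁ (F.posPow p x) y - c₁ p (x * y) := by
    intro p x y
    have h : ∑ z, (L p x y + L p (x * y) z) = ∑ z, (L (F.posPow p x) y z + L p x (y * z)) :=
      Finset.sum_congr rfl fun z _ => hL p x y z
    rw [Finset.sum_add_distrib, Finset.sum_add_distrib, Finset.sum_const, Finset.card_univ,
      nsmul_eq_mul, Fintype.sum_equiv (Equiv.mulLeft y) (fun z => L p x (y * z)) (L p x)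
        fun _ => rfl] at h
    simp only [hc₁]
    field_simp
    linarith
  -- After rescaling by `c₁` the product cocycle is gone, so compatibility makes the remaining
  -- coproduct cocycle additive in `x` along the groupoid (`h₃`).
  set N' : F.pos → F.pos → F.neg → ℝ := fun p q x =>
    N p q x + c₁ p (F.posOnNeg q x) + c₁ q x - c₁ (p * q) x with hN'
  have h₂ : ∀ p q r x, N' p q (F.posOnNeg r x) + N' (p * q) r x = N' q r x + N' p (q * r) x := by
    intro p q r x
    have h := hN p q r x
    simp only [hN', F.mul_posOnNeg, mul_assoc]
    linarith
  have h₃ : ∀ p q x y, N' p q (x * y) =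
      N' p q x + N' (F.posPow p (F.posOnNeg q x)) (F.posPow q x) y := by
    intro p q x y
    have h := hLN p q x y
    rw [h₁ (p * q), h₁ p, h₁ q, F.mul_posPow, ← F.posOnNeg_mul] at h
    simp only [hN']
    linarith
  set c₂ : F.pos → F.neg → ℝ := fun q x => (∑ p, N' p q x) / Fintype.card F.pos with hc₂
  have h₄ : ∀ p q x, N' p q x = c₂ p (F.posOnNeg q x) + c₂ q x - c₂ (p * q) x := by
    intro q r x
    have h : ∑ p, (N' p q (F.posOnNeg r x) + N' (p * q) r x) =
        ∑ p, (N' q r x + N' p (q * r) x) :=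
      Finset.sum_congr rfl fun p _ => h₂ p q r x
    rw [Finset.sum_add_distrib, Finset.sum_add_distrib, Finset.sum_const, Finset.card_univ,
      nsmul_eq_mul, Fintype.sum_equiv (Equiv.mulRight q) (fun p => N' (p * q) r x)
        (fun p => N' p r x) fun _ => rfl] at h
    simp only [hc₂]
    field_simp
    linarith
  -- The average `c₂` inherits this additivity, since `p ↦ p^y` for `y = ᵠx` permutes `G₊`.
  -- Subtracting `c₂` therefore does not disturb what `c₁` achieved.
  have h₅ : ∀ q x y, c₂ q (x * y) = c₂ q x + c₂ (F.posPow q x) y := by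
    intro q x y
    simp only [hc₂, h₃]
    rw [Finset.sum_add_distrib, ← add_div]
    congr 2
    exact Fintype.sum_equiv (F.posPowEquiv (F.posOnNeg q x)) _ _ fun _ => rfl
  refine ⟨fun p x => c₁ p x - c₂ p x, fun p x y => ?_, fun p q x => ?_⟩
  · simp only [h₁, h₅]
    ring
  · have h := h₄ p q x
    simp only [hN'] at h
    linarith

/-! ### Canonical maps of a Hopf algebra -/

namespace HopfAlgebra

variable (H : Type u) [Ring H] [HopfAlgebra ℂ H]

/-- The map `a ⊗ b ↦ a₁ ⊗ f(a₂) b`. -/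
def leftCanon (f : H →ₗ[ℂ] H) : H ⊗[ℂ] H →ₗ[ℂ] H ⊗[ℂ] H :=
  LinearMap.lTensor H (LinearMap.mul' ℂ H ∘ₗ LinearMap.rTensor H f) ∘ₗ
    (TensorProduct.assoc ℂ H H H).toLinearMap ∘ₗ
      LinearMap.rTensor H (Coalgebra.comul (R := ℂ))

/-- The map `a ⊗ b ↦ a f(b₁) ⊗ b₂`. -/
def rightCanon (f : H →ₗ[ℂ] H) : H ⊗[ℂ] H →ₗ[ℂ] H ⊗[ℂ] H :=
  LinearMap.rTensor H (LinearMap.mul' ℂ H ∘ₗ LinearMap.lTensor H f) ∘ₗ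
    (TensorProduct.assoc ℂ H H H).symm.toLinearMap ∘ₗ
      LinearMap.lTensor H (Coalgebra.comul (R := ℂ))

variable {H}

theorem leftCanon_tmul (f : H →ₗ[ℂ] H) (a b : H) : leftCanon H f (a ⊗ₜ[ℂ] b) =
    LinearMap.lTensor H (LinearMap.mulRight ℂ b ∘ₗ f) (Coalgebra.comul (R := ℂ) a) := by
  simp only [leftCanon, LinearMap.comp_apply, LinearMap.rTensor_tmul, LinearEquiv.coe_coe]
  induction Coalgebra.comul (R := ℂ) a with
  | zero => simp
  | tmul x y => simp
  | add x y hx hy => rw [TensorProduct.add_tmul, map_add, map_add, map_add, hx, hy]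

theorem rightCanon_tmul (f : H →ₗ[ℂ] H) (a b : H) : rightCanon H f (a ⊗ₜ[ℂ] b) =
    LinearMap.rTensor H (LinearMap.mulLeft ℂ a ∘ₗ f) (Coalgebra.comul (R := ℂ) b) := by
  simp only [rightCanon, LinearMap.comp_apply, LinearMap.lTensor_tmul, LinearEquiv.coe_coe]
  induction Coalgebra.comul (R := ℂ) b with
  | zero => simp
  | tmul x y => simp
  | add x y hx hy => rw [TensorProduct.tmul_add, map_add, map_add, map_add, hx, hy]

/-- In Sweedler notation, `a₁ ⊗ S(a₂) a₃ b = a ⊗ b`. Thus the inverse of the canonical map is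
non-negative as soon as the antipode is. -/
theorem leftCanon_antipode_comp :
    leftCanon H (antipode ℂ) ∘ₗ leftCanon H LinearMap.id = LinearMap.id := by
  refine TensorProduct.ext' fun a b => ?_
  rw [LinearMap.comp_apply, leftCanon_tmul, LinearMap.id_apply]
  have h₁ : ∀ t : H ⊗[ℂ] H,
      leftCanon H (antipode ℂ) (LinearMap.lTensor H (LinearMap.mulRight ℂ b ∘ₗ .id) t) =
      LinearMap.lTensor H (LinearMap.mulRight ℂ b ∘ₗ LinearMap.mul' ℂ H ∘ₗ
        LinearMap.rTensor H (antipode ℂ)) (TensorProduct.assoc ℂ H H H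
          (LinearMap.rTensor H (Coalgebra.comul (R := ℂ)) t)) := by
    intro t
    induction t with
    | zero => simp
    | tmul x y =>
      rw [LinearMap.lTensor_tmul, leftCanon_tmul, LinearMap.rTensor_tmul]
      induction Coalgebra.comul (R := ℂ) x with
      | zero => simp
      | tmul x y => simp [mul_assoc]
      | add x y hx hy => rw [TensorProduct.add_tmul, map_add, map_add, map_add, hx, hy]
    | add x y hx hy => simp only [map_add, hx, hy]
  have h₂ : (LinearMap.mulRight ℂ b ∘ₗ LinearMap.mul' ℂ H ∘ₗ
      LinearMap.rTensor H (antipode ℂ)) ∘ₗ Coalgebra.comul (R := ℂ) =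
      LinearMap.toSpanSingleton ℂ H b ∘ₗ Coalgebra.counit (R := ℂ) := by
    refine LinearMap.ext fun x => ?_
    simp only [LinearMap.comp_apply]
    rw [HopfAlgebra.mul_antipode_rTensor_comul_apply]
    simp [Algebra.algebraMap_eq_smul_one]
  rw [h₁, Coalgebra.coassoc_apply, ← LinearMap.comp_apply, ← LinearMap.lTensor_comp, h₂,
    LinearMap.lTensor_comp, LinearMap.comp_apply, Coalgebra.lTensor_counit_comul]
  simp

theorem rightCanon_antipode_comp :
    rightCanon H (antipode ℂ) ∘ₗ rightCanon H LinearMap.id = LinearMap.id := by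
  refine TensorProduct.ext' fun a b => ?_
  rw [LinearMap.comp_apply, rightCanon_tmul, LinearMap.id_apply]
  have h₁ : ∀ t : H ⊗[ℂ] H,
      rightCanon H (antipode ℂ) (LinearMap.rTensor H (LinearMap.mulLeft ℂ a ∘ₗ .id) t) =
      LinearMap.rTensor H (LinearMap.mulLeft ℂ a ∘ₗ LinearMap.mul' ℂ H ∘ₗ
        LinearMap.lTensor H (antipode ℂ)) ((TensorProduct.assoc ℂ H H H).symm
          (LinearMap.lTensor H (Coalgebra.comul (R := ℂ)) t)) := by
    intro t
    induction t with
    | zero => simp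
    | tmul x y =>
      rw [LinearMap.rTensor_tmul, rightCanon_tmul, LinearMap.lTensor_tmul]
      induction Coalgebra.comul (R := ℂ) y with
      | zero => simp
      | tmul x y => simp
      | add x y hx hy => rw [TensorProduct.tmul_add, map_add, map_add, map_add, hx, hy]
    | add x y hx hy => simp only [map_add, hx, hy]
  have h₂ : (LinearMap.mulLeft ℂ a ∘ₗ LinearMap.mul' ℂ H ∘ₗ
      LinearMap.lTensor H (antipode ℂ)) ∘ₗ Coalgebra.comul (R := ℂ) =
      LinearMap.toSpanSingleton ℂ H a ∘ₗ Coalgebra.counit (R := ℂ) := by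
    refine LinearMap.ext fun x => ?_
    simp only [LinearMap.comp_apply]
    rw [HopfAlgebra.mul_antipode_lTensor_comul_apply]
    simp [Algebra.algebraMap_eq_smul_one]
  rw [h₁, Coalgebra.coassoc_symm_apply, ← LinearMap.comp_apply, ← LinearMap.rTensor_comp, h₂,
    LinearMap.rTensor_comp, LinearMap.comp_apply, Coalgebra.rTensor_counit_comul]
  simp

end HopfAlgebra

/-! ### Structure constants -/

namespace StructureConstants

variable {H : Type u} [Ring H] [HopfAlgebra ℂ H] {ι : Type v} [Fintype ι]
  (b : Module.Basis ι ℂ H)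

/-- The coefficient of `b k` in `b i * b j`. -/
def mulCoeff (i j k : ι) : ℂ := b.repr (b i * b j) k

/-- The coefficient of `b i ⊗ b j` in the coproduct of `b k`. -/
def comulCoeff (i j k : ι) : ℂ := (b.tensorProduct b).repr (Coalgebra.comul (R := ℂ) (b k)) (i, j)

theorem mul_eq (i j : ι) : b i * b j = ∑ k, mulCoeff b i j k • b k := (b.sum_repr _).symm

theorem one_eq : (1 : H) = ∑ k, b.repr 1 k • b k := (b.sum_repr _).symm

theorem comul_eq (k : ι) : Coalgebra.comul (R := ℂ) (b k) =
    ∑ i, ∑ j, comulCoeff b i j k • (b i ⊗ₜ[ℂ] b j) := by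
  conv_lhs => rw [← (b.tensorProduct b).sum_repr (Coalgebra.comul (R := ℂ) (b k))]
  simp only [Fintype.sum_prod_type, Module.Basis.tensorProduct_apply, comulCoeff]

theorem mulCoeff_assoc (i j k l : ι) : ∑ m, mulCoeff b i j m * mulCoeff b m k l =
    ∑ m, mulCoeff b j k m * mulCoeff b i m l := by
  have h := congrArg (fun v => b.repr v l) (mul_assoc (b i) (b j) (b k))
  rw [mul_eq b i j, mul_eq b j k, Finset.sum_mul, Finset.mul_sum] at h
  simpa [mulCoeff] using h

theorem one_mulCoeff [DecidableEq ι] (j k : ι) :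
    ∑ i, b.repr 1 i * mulCoeff b i j k = if j = k then 1 else 0 := by
  have h := congrArg (fun v => b.repr v k) (one_mul (b j))
  nth_rw 1 [one_eq b] at h
  simpa [Finset.sum_mul, mulCoeff, Finsupp.single_apply, -Module.Basis.sum_repr] using h

theorem mulCoeff_one [DecidableEq ι] (j k : ι) :
    ∑ i, b.repr 1 i * mulCoeff b j i k = if j = k then 1 else 0 := by
  have h := congrArg (fun v => b.repr v k) (mul_one (b j))
  nth_rw 1 [one_eq b] at h
  simpa [Finset.mul_sum, mulCoeff, Finsupp.single_apply, -Module.Basis.sum_repr] using h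

theorem comulCoeff_coassoc (i j k l : ι) : ∑ m, comulCoeff b i j m * comulCoeff b m k l =
    ∑ m, comulCoeff b j k m * comulCoeff b i m l := by
  have h := Coalgebra.coassoc_apply (R := ℂ) (b l)
  simp only [comul_eq, map_sum, map_smul, LinearMap.rTensor_tmul, LinearMap.lTensor_tmul,
    TensorProduct.sum_tmul, TensorProduct.tmul_sum, TensorProduct.tmul_smul,
    ← TensorProduct.smul_tmul', TensorProduct.assoc_tmul, Finset.smul_sum, smul_smul] at h
  have h' := congrArg (fun v => (b.tensorProduct (b.tensorProduct b)).repr v (i, j, k)) h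
  classical
  simpa [Module.Basis.tensorProduct_repr_tmul_apply, Finsupp.single_apply, mul_comm,
    Finset.sum_ite_eq, Finset.sum_ite_eq', ite_and] using h'

theorem counit_comulCoeff [DecidableEq ι] (j k : ι) :
    ∑ i, Coalgebra.counit (R := ℂ) (b i) * comulCoeff b i j k = if j = k then 1 else 0 := by
  have h := congrArg (TensorProduct.lid ℂ H) (Coalgebra.rTensor_counit_comul (R := ℂ) (b k))
  rw [comul_eq b] at h
  have h' := congrArg (fun v => b.repr v j) h
  simpa [Finsupp.single_apply, mul_comm, eq_comm] using h'

theorem comulCoeff_counit [DecidableEq ι] (j k : ι) :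
    ∑ i, Coalgebra.counit (R := ℂ) (b i) * comulCoeff b j i k = if j = k then 1 else 0 := by
  have h := congrArg (TensorProduct.rid ℂ H) (Coalgebra.lTensor_counit_comul (R := ℂ) (b k))
  rw [comul_eq b] at h
  have h' := congrArg (fun v => b.repr v j) h
  simpa [Finsupp.single_apply, mul_comm, eq_comm] using h'

theorem counit_mulCoeff (i j : ι) :
    ∑ m, mulCoeff b i j m * Coalgebra.counit (R := ℂ) (b m) =
      Coalgebra.counit (R := ℂ) (b i) * Coalgebra.counit (R := ℂ) (b j) := by
  have h := Bialgebra.counit_mul (R := ℂ) (b i) (b j)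
  rw [mul_eq b] at h
  simpa using h

theorem comulCoeff_one (i j : ι) :
    ∑ m, comulCoeff b i j m * b.repr 1 m = b.repr 1 i * b.repr 1 j := by
  have h := congrArg (fun v => (b.tensorProduct b).repr v (i, j))
    (Bialgebra.comul_one (R := ℂ) (A := H))
  nth_rw 1 [one_eq b] at h
  rw [Algebra.TensorProduct.one_def] at h
  simpa [comulCoeff, mul_comm, Module.Basis.tensorProduct_repr_tmul_apply,
    -Module.Basis.sum_repr] using h

theorem counit_one : ∑ i, b.repr 1 i * Coalgebra.counit (R := ℂ) (b i) = 1 := by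
  have h := Bialgebra.counit_one (R := ℂ) (A := H)
  rw [one_eq b] at h
  simpa [-Module.Basis.sum_repr] using h

theorem mulCoeff_comulCoeff (i j k l : ι) :
    ∑ m, mulCoeff b i j m * comulCoeff b k l m =
      ∑ a, ∑ a', ∑ c, ∑ c', comulCoeff b a a' i * comulCoeff b c c' j *
        (mulCoeff b a c k * mulCoeff b a' c' l) := by
  have h := congrArg (fun v => (b.tensorProduct b).repr v (k, l))
    (Bialgebra.comul_mul (R := ℂ) (b i) (b j))
  have h₁ : (b.tensorProduct b).repr (Coalgebra.comul (R := ℂ) (b i * b j)) (k, l) =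
      ∑ m, mulCoeff b i j m * comulCoeff b k l m := by
    rw [mul_eq b i j]
    simp [comulCoeff]
  rw [← h₁]
  refine h.trans ?_
  rw [comul_eq b i, comul_eq b j]
  simp only [Finset.sum_mul]
  simp only [Finset.mul_sum, smul_mul_smul_comm, Algebra.TensorProduct.tmul_mul_tmul, map_sum,
    map_smul, Finsupp.coe_finsetSum, Finset.sum_apply, Finsupp.smul_apply, smul_eq_mul,
    Module.Basis.tensorProduct_repr_tmul_apply, mulCoeff]
  refine Finset.sum_congr rfl fun a _ => Finset.sum_congr rfl fun a' _ =>
    Finset.sum_congr rfl fun c _ => Finset.sum_congr rfl fun c' _ => ?_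
  rw [mul_comm (b.repr _ l)]

end StructureConstants

theorem sum_ne_zero_iff_exists {α : Type*} [Fintype α] {f : α → ℂ} (hf : ∀ a, 0 ≤ f a) :
    ∑ a, f a ≠ 0 ↔ ∃ a, f a ≠ 0 := by
  rw [Ne, Finset.sum_eq_zero_iff_of_nonneg fun a _ => hf a]
  simp

/-- Non-negative terms cannot cancel, so each identity between structure constants passes to an
identity between their supports. -/
theorem exists_ne_zero_and_iff {α : Type*} [Fintype α] {f g : α → ℂ} (hf : ∀ a, 0 ≤ f a)
    (hg : ∀ a, 0 ≤ g a) : (∃ a, f a ≠ 0 ∧ g a ≠ 0) ↔ ∑ a, f a * g a ≠ 0 := by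
  simp only [sum_ne_zero_iff_exists fun a => mul_nonneg (hf a) (hg a), mul_ne_zero_iff]

theorem exists_ofReal_of_nonneg {z : ℂ} (h : 0 ≤ z) (h₀ : z ≠ 0) :
    0 < z.re ∧ (z.re : ℂ) = z := by
  obtain ⟨h₁, h₂⟩ := Complex.nonneg_iff.1 h
  have h₃ : (z.re : ℂ) = z := Complex.ext rfl (by simp [← h₂])
  refine ⟨lt_of_le_of_ne h₁ fun h => h₀ ?_, h₃⟩
  rw [← h₃, ← h, Complex.ofReal_zero]

/-! ### Hopf algebras with a positive basis -/

namespace IsPositiveBasis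

open StructureConstants

variable {H : Type u} [Ring H] [HopfAlgebra ℂ H] {ι : Type u} [Fintype ι]
  {b : Module.Basis ι ℂ H}

theorem isNonneg_leftCanon (hb : IsPositiveBasis b) {f : H →ₗ[ℂ] H}
    (hf : ∀ i, IsNonneg b (f (b i))) (w : ι × ι) :
    IsNonneg (b.tensorProduct b) (HopfAlgebra.leftCanon H f (b.tensorProduct b w)) := by
  rw [Module.Basis.tensorProduct_apply', HopfAlgebra.leftCanon_tmul]
  refine IsNonneg.map (b := b.tensorProduct b) (fun i => ?_)
    (fun ij => hb.comul_nonneg w.1 ij.1 ij.2)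
  rw [Module.Basis.tensorProduct_apply', LinearMap.lTensor_tmul]
  exact (IsNonneg.self _).tmul (IsNonneg.mul (fun i j => hb.mul_nonneg i j) (hf _)
    (IsNonneg.self _))

theorem isNonneg_rightCanon (hb : IsPositiveBasis b) {f : H →ₗ[ℂ] H}
    (hf : ∀ i, IsNonneg b (f (b i))) (w : ι × ι) :
    IsNonneg (b.tensorProduct b) (HopfAlgebra.rightCanon H f (b.tensorProduct b w)) := by
  rw [Module.Basis.tensorProduct_apply', HopfAlgebra.rightCanon_tmul]
  refine IsNonneg.map (b := b.tensorProduct b) (fun i => ?_)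
    (fun ij => hb.comul_nonneg w.2 ij.1 ij.2)
  rw [Module.Basis.tensorProduct_apply', LinearMap.rTensor_tmul]
  exact (IsNonneg.mul (fun i j => hb.mul_nonneg i j) (IsNonneg.self _) (hf _)).tmul
    (IsNonneg.self _)

theorem repr_leftCanon (i j k l : ι) :
    (b.tensorProduct b).repr (HopfAlgebra.leftCanon H LinearMap.id
      (b.tensorProduct b (i, j))) (k, l) = ∑ m, comulCoeff b k m i * mulCoeff b m j l := by
  classical
  rw [Module.Basis.tensorProduct_apply', HopfAlgebra.leftCanon_tmul, comul_eq b, Finset.sum_comm]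
  simp only [map_sum, map_smul, LinearMap.lTensor_tmul, Finsupp.coe_finsetSum, Finset.sum_apply,
    Finsupp.smul_apply, Module.Basis.tensorProduct_repr_tmul_apply, smul_eq_mul,
    Module.Basis.repr_self, Finsupp.single_apply, LinearMap.comp_apply, LinearMap.id_apply,
    LinearMap.mulRight_apply, mul_ite, mul_one, mul_zero, Finset.sum_ite_eq', Finset.mem_univ,
    if_true, mulCoeff]

theorem repr_rightCanon (i j k l : ι) :
    (b.tensorProduct b).repr (HopfAlgebra.rightCanon H LinearMap.id
      (b.tensorProduct b (i, j))) (k, l) = ∑ m, comulCoeff b m l j * mulCoeff b i m k := by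
  classical
  rw [Module.Basis.tensorProduct_apply', HopfAlgebra.rightCanon_tmul, comul_eq b]
  simp only [map_sum, map_smul, LinearMap.rTensor_tmul, Finsupp.coe_finsetSum, Finset.sum_apply,
    Finsupp.smul_apply, Module.Basis.tensorProduct_repr_tmul_apply, smul_eq_mul,
    Module.Basis.repr_self, Finsupp.single_apply, LinearMap.comp_apply, LinearMap.id_apply,
    LinearMap.mulLeft_apply, ite_mul, one_mul, zero_mul, mul_ite, mul_zero, Finset.sum_ite_eq',
    Finset.mem_univ, if_true, mulCoeff]

theorem mulCoeff_nonneg (hb : IsPositiveBasis b) (i j k : ι) : 0 ≤ mulCoeff b i j k :=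
  hb.mul_nonneg i j k

theorem comulCoeff_nonneg (hb : IsPositiveBasis b) (i j k : ι) : 0 ≤ comulCoeff b i j k :=
  hb.comul_nonneg k i j

/-- The supports of the structure constants of a Hopf algebra with a positive basis. -/
def support (hb : IsPositiveBasis b) : HopfSupport ι where
  mul i j k := mulCoeff b i j k ≠ 0
  comul i j k := comulCoeff b i j k ≠ 0
  unit i := b.repr 1 i ≠ 0
  counit i := Coalgebra.counit (R := ℂ) (b i) ≠ 0
  assoc i j k l := by
    rw [exists_ne_zero_and_iff, exists_ne_zero_and_iff, mulCoeff_assoc]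
    all_goals exact fun _ => hb.mulCoeff_nonneg _ _ _
  coassoc i j k l := by
    rw [exists_ne_zero_and_iff, exists_ne_zero_and_iff, comulCoeff_coassoc]
    all_goals exact fun _ => hb.comulCoeff_nonneg _ _ _
  unit_mul j k := by
    classical
    rw [exists_ne_zero_and_iff hb.one_nonneg fun _ => hb.mulCoeff_nonneg _ _ _, one_mulCoeff]
    simp
  mul_unit j k := by
    classical
    rw [exists_ne_zero_and_iff hb.one_nonneg fun _ => hb.mulCoeff_nonneg _ _ _, mulCoeff_one]
    simp
  counit_comul j k := by
    classical
    rw [exists_ne_zero_and_iff hb.counit_nonneg fun _ => hb.comulCoeff_nonneg _ _ _,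
      counit_comulCoeff]
    simp
  comul_counit j k := by
    classical
    rw [exists_ne_zero_and_iff hb.counit_nonneg fun _ => hb.comulCoeff_nonneg _ _ _,
      comulCoeff_counit]
    simp
  mul_comul i j k l := by
    have h : ∀ a a' c c', 0 ≤ comulCoeff b a a' i * comulCoeff b c c' j *
        (mulCoeff b a c k * mulCoeff b a' c' l) := fun a a' c c' =>
      _root_.mul_nonneg (_root_.mul_nonneg (hb.comulCoeff_nonneg _ _ _)
        (hb.comulCoeff_nonneg _ _ _)) (_root_.mul_nonneg (hb.mulCoeff_nonneg _ _ _)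
        (hb.mulCoeff_nonneg _ _ _))
    rw [exists_ne_zero_and_iff (fun _ => hb.mulCoeff_nonneg _ _ _)
      (fun _ => hb.comulCoeff_nonneg _ _ _), mulCoeff_comulCoeff]
    rw [sum_ne_zero_iff_exists fun a => Finset.sum_nonneg fun a' _ => Finset.sum_nonneg
      fun c _ => Finset.sum_nonneg fun c' _ => h a a' c c']
    refine exists_congr fun a => ?_
    rw [sum_ne_zero_iff_exists fun a' => Finset.sum_nonneg
      fun c _ => Finset.sum_nonneg fun c' _ => h a a' c c']
    refine exists_congr fun a' => ?_
    rw [sum_ne_zero_iff_exists fun c => Finset.sum_nonneg fun c' _ => h a a' c c']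
    refine exists_congr fun c => ?_
    rw [sum_ne_zero_iff_exists fun c' => h a a' c c']
    refine exists_congr fun c' => ?_
    simp only [mul_ne_zero_iff, and_assoc]
  counit_mul i j := by
    rw [exists_ne_zero_and_iff (fun _ => hb.mulCoeff_nonneg _ _ _) hb.counit_nonneg,
      counit_mulCoeff, mul_ne_zero_iff]
  unit_comul i j := by
    rw [exists_ne_zero_and_iff (fun _ => hb.comulCoeff_nonneg _ _ _) hb.one_nonneg,
      comulCoeff_one, mul_ne_zero_iff]
  counit_unit := by
    rw [exists_ne_zero_and_iff hb.one_nonneg hb.counit_nonneg, counit_one]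
    exact one_ne_zero
  left_perm := by
    obtain ⟨σ, hσ⟩ := exists_perm_of_nonneg_linearMap (b.tensorProduct b)
      (HopfAlgebra.leftCanon H LinearMap.id) (HopfAlgebra.leftCanon H (HopfAlgebra.antipode ℂ))
      (hb.isNonneg_leftCanon fun i => IsNonneg.self i)
      (hb.isNonneg_leftCanon fun i => hb.antipode_nonneg i)
      (by
        -- In finite dimension the one-sided inverse supplied by the antipode is two-sided.
        have : Module.Finite ℂ H := Module.Finite.of_basis b
        exact (LinearMap.comp_eq_id_comm ℂ (H ⊗[ℂ] H)).1 HopfAlgebra.leftCanon_antipode_comp)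
    refine ⟨σ, fun i j k l => ?_⟩
    rw [← hσ, repr_leftCanon, exists_ne_zero_and_iff (fun _ => hb.comulCoeff_nonneg _ _ _)
      (fun _ => hb.mulCoeff_nonneg _ _ _)]
  right_perm := by
    obtain ⟨σ, hσ⟩ := exists_perm_of_nonneg_linearMap (b.tensorProduct b)
      (HopfAlgebra.rightCanon H LinearMap.id) (HopfAlgebra.rightCanon H (HopfAlgebra.antipode ℂ))
      (hb.isNonneg_rightCanon fun i => IsNonneg.self i)
      (hb.isNonneg_rightCanon fun i => hb.antipode_nonneg i)
      (by
        have : Module.Finite ℂ H := Module.Finite.of_basis b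
        exact (LinearMap.comp_eq_id_comm ℂ (H ⊗[ℂ] H)).1 HopfAlgebra.rightCanon_antipode_comp)
    refine ⟨σ, fun i j k l => ?_⟩
    rw [← hσ, repr_rightCanon, exists_ne_zero_and_iff (fun _ => hb.comulCoeff_nonneg _ _ _)
      (fun _ => hb.mulCoeff_nonneg _ _ _)]

end IsPositiveBasis

/-! ### Removing the positive factors by rescaling the basis -/

namespace IsPositiveBasis

open StructureConstants

variable {H : Type u} [Ring H] [HopfAlgebra ℂ H] {ι : Type u} [Fintype ι]
  {b : Module.Basis ι ℂ H} {G : Type u} [Group G] {F : UniqueFactorization G}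
  {idx : F.pos × F.neg ≃ ι}

/-- The factor in the product of `b (idx (p, x))` and `b (idx (pˣ, y))`. -/
def mulFactor (_hb : IsPositiveBasis b) (idx : F.pos × F.neg ≃ ι) (p : F.pos) (x y : F.neg) : ℝ :=
  (mulCoeff b (idx (p, x)) (idx (F.posPow p x, y)) (idx (p, x * y))).re

/-- The factor of `b (idx (p, ᵠx)) ⊗ b (idx (q, x))` in the coproduct of `b (idx (p * q, x))`. -/
def comulFactor (_hb : IsPositiveBasis b) (idx : F.pos × F.neg ≃ ι) (p q : F.pos) (x : F.neg) :
    ℝ :=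
  (comulCoeff b (idx (p, F.posOnNeg q x)) (idx (q, x)) (idx (p * q, x))).re

theorem mulFactor_pos (hb : IsPositiveBasis b) (h : hb.support.IsBicross F idx) (p : F.pos)
    (x y : F.neg) : 0 < hb.mulFactor idx p x y :=
  (exists_ofReal_of_nonneg (hb.mulCoeff_nonneg _ _ _) ((h.mul_iff _ _ _ _ _).2 ⟨rfl, rfl⟩)).1

theorem comulFactor_pos (hb : IsPositiveBasis b) (h : hb.support.IsBicross F idx) (p q : F.pos)
    (x : F.neg) : 0 < hb.comulFactor idx p q x :=
  (exists_ofReal_of_nonneg (hb.comulCoeff_nonneg _ _ _)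
    ((h.comul_iff _ _ _ _ _).2 ⟨rfl, rfl⟩)).1

theorem mulCoeff_eq (hb : IsPositiveBasis b) (h : hb.support.IsBicross F idx) (p : F.pos)
    (x y : F.neg) : mulCoeff b (idx (p, x)) (idx (F.posPow p x, y)) (idx (p, x * y)) =
      hb.mulFactor idx p x y :=
  (exists_ofReal_of_nonneg (hb.mulCoeff_nonneg _ _ _)
    ((h.mul_iff _ _ _ _ _).2 ⟨rfl, rfl⟩)).2.symm

theorem comulCoeff_eq (hb : IsPositiveBasis b) (h : hb.support.IsBicross F idx) (p q : F.pos)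
    (x : F.neg) : comulCoeff b (idx (p, F.posOnNeg q x)) (idx (q, x)) (idx (p * q, x)) =
      hb.comulFactor idx p q x :=
  (exists_ofReal_of_nonneg (hb.comulCoeff_nonneg _ _ _)
    ((h.comul_iff _ _ _ _ _).2 ⟨rfl, rfl⟩)).2.symm

theorem mulCoeff_eq_zero (hb : IsPositiveBasis b) (h : hb.support.IsBicross F idx) {p q : F.pos}
    {x y : F.neg} {k : ι} (hk : ¬ (F.posPow p x = q ∧ k = idx (p, x * y))) :
    mulCoeff b (idx (p, x)) (idx (q, y)) k = 0 := by
  by_contra h'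
  exact hk ((h.mul_iff _ _ _ _ _).1 h')

theorem comulCoeff_eq_zero (hb : IsPositiveBasis b) (h : hb.support.IsBicross F idx)
    {p q : F.pos} {x y : F.neg} {k : ι} (hk : ¬ (F.posOnNeg q y = x ∧ k = idx (p * q, y))) :
    comulCoeff b (idx (p, x)) (idx (q, y)) k = 0 := by
  by_contra h'
  exact hk ((h.comul_iff _ _ _ _ _).1 h')

/-- On composable indices each side of associativity has a single non-zero term, so it becomes a
multiplicative cocycle condition. -/
theorem mulFactor_assoc (hb : IsPositiveBasis b) (h : hb.support.IsBicross F idx) (p : F.pos)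
    (x y z : F.neg) : hb.mulFactor idx p x y * hb.mulFactor idx p (x * y) z =
      hb.mulFactor idx (F.posPow p x) y z * hb.mulFactor idx p x (y * z) := by
  have h₁ := mulCoeff_assoc b (idx (p, x)) (idx (F.posPow p x, y))
    (idx (F.posPow p (x * y), z)) (idx (p, x * y * z))
  rw [Finset.sum_eq_single (idx (p, x * y)), Finset.sum_eq_single (idx (F.posPow p x, y * z)),
    hb.mulCoeff_eq h, hb.mulCoeff_eq h, mul_assoc x y z, hb.mulCoeff_eq h, F.posPow_mul,
    hb.mulCoeff_eq h] at h₁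
  · exact_mod_cast h₁
  · intro k _ hk
    rw [hb.mulCoeff_eq_zero h (fun h' => hk h'.2), zero_mul]
  · simp
  · intro k _ hk
    rw [hb.mulCoeff_eq_zero h (fun h' => hk h'.2), zero_mul]
  · simp

theorem comulFactor_coassoc (hb : IsPositiveBasis b) (h : hb.support.IsBicross F idx)
    (p q r : F.pos) (x : F.neg) :
    hb.comulFactor idx p q (F.posOnNeg r x) * hb.comulFactor idx (p * q) r x =
      hb.comulFactor idx q r x * hb.comulFactor idx p (q * r) x := by
  have h₁ := comulCoeff_coassoc b (idx (p, F.posOnNeg (q * r) x)) (idx (q, F.posOnNeg r x))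
    (idx (r, x)) (idx (p * q * r, x))
  rw [Finset.sum_eq_single (idx (p * q, F.posOnNeg r x)), Finset.sum_eq_single (idx (q * r, x)),
    hb.comulCoeff_eq h, hb.comulCoeff_eq h, mul_assoc p q r, hb.comulCoeff_eq h, F.mul_posOnNeg,
    hb.comulCoeff_eq h] at h₁
  · exact_mod_cast h₁
  · intro k _ hk
    rw [hb.comulCoeff_eq_zero h (fun h' => hk h'.2), zero_mul]
  · simp
  · intro k _ hk
    rw [hb.comulCoeff_eq_zero h (fun h' => hk h'.2), zero_mul]
  · simp

theorem mulFactor_comulFactor (hb : IsPositiveBasis b) (h : hb.support.IsBicross F idx)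
    (p q : F.pos) (x y : F.neg) :
    hb.mulFactor idx (p * q) x y * hb.comulFactor idx p q (x * y) =
      hb.mulFactor idx p (F.posOnNeg q x) (F.posOnNeg (F.posPow q x) y) *
        hb.mulFactor idx q x y * hb.comulFactor idx p q x *
        hb.comulFactor idx (F.posPow p (F.posOnNeg q x)) (F.posPow q x) y := by
  have h₁ := mulCoeff_comulCoeff b (idx (p * q, x)) (idx (F.posPow (p * q) x, y))
    (idx (p, F.posOnNeg q (x * y))) (idx (q, x * y))
  have h₂ : ∀ f : ι → ι → ι → ι → ℂ, ∑ a, ∑ a', ∑ c, ∑ c', f a a' c c' =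
      ∑ w : ι × ι × ι × ι, f w.1 w.2.1 w.2.2.1 w.2.2.2 := fun f => by
    simp only [Fintype.sum_prod_type]
  rw [h₂, Finset.sum_eq_single (idx (p * q, x * y)), hb.mulCoeff_eq h, hb.comulCoeff_eq h,
    Finset.sum_eq_single (idx (p, F.posOnNeg q x), idx (q, x),
      idx (F.posPow p (F.posOnNeg q x), F.posOnNeg (F.posPow q x) y), idx (F.posPow q x, y)),
    hb.comulCoeff_eq h, F.mul_posPow, hb.comulCoeff_eq h, F.posOnNeg_mul, hb.mulCoeff_eq h,
    hb.mulCoeff_eq h] at h₁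
  · have h₃ := h₁
    norm_cast at h₃
    rw [h₃]
    ring
  -- The support conditions of the four coefficients determine the quadruple completely: only one
  -- term of the fourfold sum survives.
  · rintro ⟨a, a', c, c'⟩ - hw
    by_contra h₃
    obtain ⟨⟨⟨p₁, x₁⟩, rfl⟩, ⟨q₁, y₁⟩, rfl⟩ := And.intro (idx.surjective a) (idx.surjective a')
    obtain ⟨⟨⟨p₂, x₂⟩, rfl⟩, ⟨q₂, y₂⟩, rfl⟩ := And.intro (idx.surjective c) (idx.surjective c')
    simp only [mul_ne_zero_iff] at h₃
    obtain ⟨⟨h₄, h₅⟩, h₆, h₇⟩ := h₃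
    obtain ⟨rfl, h₈⟩ := (h.comul_iff _ _ _ _ _).1 h₄
    obtain ⟨rfl, -⟩ := (h.comul_iff _ _ _ _ _).1 h₅
    obtain ⟨rfl, -⟩ := (h.mul_iff _ _ _ _ _).1 h₆
    obtain ⟨rfl, h₉⟩ := (h.mul_iff _ _ _ _ _).1 h₇
    simp only [EmbeddingLike.apply_eq_iff_eq, Prod.mk.injEq] at h₈ h₉
    obtain ⟨rfl, h₁₀⟩ := h₉
    obtain ⟨h₁₁, rfl⟩ := h₈
    obtain rfl := mul_left_cancel h₁₀
    obtain rfl := mul_right_cancel h₁₁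
    exact hw rfl
  · simp
  · intro k _ hk
    rw [hb.mulCoeff_eq_zero h (fun h' => hk h'.2), zero_mul]
  · simp

/-- The logarithms of the factors are compatible additive cocycles; `s` is the exponential of a
function of which they are the coboundary. -/
theorem exists_scaling [Finite G] (hb : IsPositiveBasis b) (h : hb.support.IsBicross F idx) :
    ∃ s : F.pos → F.neg → ℝ, (∀ p x, 0 < s p x) ∧
      (∀ p x y, hb.mulFactor idx p x y * s p (x * y) = s p x * s (F.posPow p x) y) ∧
      ∀ p q x, hb.comulFactor idx p q x * (s p (F.posOnNeg q x) * s q x) = s (p * q) x := by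
  have hm := fun p x y => (hb.mulFactor_pos h p x y).ne'
  have hc := fun p q x => (hb.comulFactor_pos h p q x).ne'
  obtain ⟨c, h₁, h₂⟩ := F.exists_coboundary (fun p x y => Real.log (hb.mulFactor idx p x y))
    (fun p q x => Real.log (hb.comulFactor idx p q x))
    (fun p x y z => by
      rw [← Real.log_mul (hm _ _ _) (hm _ _ _), ← Real.log_mul (hm _ _ _) (hm _ _ _),
        hb.mulFactor_assoc h])
    (fun p q r x => by
      rw [← Real.log_mul (hc _ _ _) (hc _ _ _), ← Real.log_mul (hc _ _ _) (hc _ _ _),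
        hb.comulFactor_coassoc h])
    (fun p q x y => by
      rw [← Real.log_mul (hm _ _ _) (hc _ _ _), ← Real.log_mul (hm _ _ _) (hm _ _ _),
        ← Real.log_mul (mul_ne_zero (hm _ _ _) (hm _ _ _)) (hc _ _ _),
        ← Real.log_mul (mul_ne_zero (mul_ne_zero (hm _ _ _) (hm _ _ _)) (hc _ _ _)) (hc _ _ _),
        hb.mulFactor_comulFactor h])
  refine ⟨fun p x => Real.exp (c p x), fun p x => Real.exp_pos _, fun p x y => ?_,
    fun p q x => ?_⟩
  · rw [← Real.exp_log (hb.mulFactor_pos h p x y), h₁, ← Real.exp_add, ← Real.exp_add]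
    congr 1
    ring
  · rw [← Real.exp_log (hb.comulFactor_pos h p q x), h₂, ← Real.exp_add, ← Real.exp_add]
    congr 1
    ring

theorem basis_mul_basis (hb : IsPositiveBasis b) (h : hb.support.IsBicross F idx) (p q : F.pos)
    (x y : F.neg) : b (idx (p, x)) * b (idx (q, y)) =
      if F.posPow p x = q then (hb.mulFactor idx p x y : ℂ) • b (idx (p, x * y)) else 0 := by
  rw [mul_eq b]
  split_ifs with hq
  · subst hq
    rw [Finset.sum_eq_single (idx (p, x * y)), hb.mulCoeff_eq h]
    · intro k _ hk
      rw [hb.mulCoeff_eq_zero h (fun h' => hk h'.2), zero_smul]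
    · simp
  · refine Finset.sum_eq_zero fun k _ => ?_
    rw [hb.mulCoeff_eq_zero h (fun h' => hq h'.1), zero_smul]

theorem comul_basis [Finite G] (hb : IsPositiveBasis b) (h : hb.support.IsBicross F idx) (p : F.pos)
    (x : F.neg) : Coalgebra.comul (R := ℂ) (b (idx (p, x))) =
      ∑ q : F.pos, (hb.comulFactor idx (p * q⁻¹) q x : ℂ) •
        (b (idx (p * q⁻¹, F.posOnNeg q x)) ⊗ₜ[ℂ] b (idx (q, x))) := by
  have := Fintype.ofFinite F.neg
  rw [comul_eq b, Finset.sum_comm, ← idx.sum_comp, Fintype.sum_prod_type]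
  refine Finset.sum_congr rfl fun q _ => ?_
  rw [Finset.sum_eq_single x, Finset.sum_eq_single (idx (p * q⁻¹, F.posOnNeg q x))]
  · have h₁ := hb.comulCoeff_eq h (p * q⁻¹) q x
    rw [inv_mul_cancel_right] at h₁
    rw [h₁]
  · intro i _ hi
    obtain ⟨⟨p', x'⟩, rfl⟩ := idx.surjective i
    rw [hb.comulCoeff_eq_zero h, zero_smul]
    rintro ⟨rfl, h₂⟩
    simp only [EmbeddingLike.apply_eq_iff_eq, Prod.mk.injEq] at h₂
    refine hi ?_
    rw [h₂.1, mul_inv_cancel_right]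
  · simp
  · intro y _ hy
    refine Finset.sum_eq_zero fun i _ => ?_
    obtain ⟨⟨p', x'⟩, rfl⟩ := idx.surjective i
    rw [hb.comulCoeff_eq_zero h, zero_smul]
    rintro ⟨-, h₂⟩
    simp only [EmbeddingLike.apply_eq_iff_eq, Prod.mk.injEq] at h₂
    exact hy h₂.2.symm
  · simp

/-- For `p = 1`, the counit axiom at `b (idx (1, x))` has only the term in which both legs of the
coproduct are that same element. -/
theorem counit_basis (hb : IsPositiveBasis b) (h : hb.support.IsBicross F idx) (p : F.pos)
    (x : F.neg) : Coalgebra.counit (R := ℂ) (b (idx (p, x))) * hb.comulFactor idx 1 1 x =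
      if p = 1 then 1 else 0 := by
  classical
  split_ifs with hp
  · subst hp
    have h₁ := counit_comulCoeff b (idx (1, x)) (idx (1, x))
    have h₂ := hb.comulCoeff_eq h 1 1 x
    rw [F.one_posOnNeg, one_mul] at h₂
    rw [if_pos rfl, Finset.sum_eq_single (idx (1, x)), h₂] at h₁
    · exact h₁
    · intro i _ hi
      obtain ⟨⟨p', x'⟩, rfl⟩ := idx.surjective i
      rw [hb.comulCoeff_eq_zero h, mul_zero]
      rintro ⟨rfl, h₂⟩
      simp only [EmbeddingLike.apply_eq_iff_eq, Prod.mk.injEq, and_true, mul_one] at h₂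
      exact hi (by rw [F.one_posOnNeg, h₂])
    · simp
  · have h₁ := mt (h.counit_iff p x).1 hp
    rw [not_not.1 h₁, zero_mul]

end IsPositiveBasis

theorem Module.Basis.ext_of_equiv {α β ι H M : Type*} [AddCommGroup H] [Module ℂ H]
    [AddCommGroup M] [Module ℂ M] (b : Module.Basis ι ℂ H) (idx : α × β ≃ ι) {f g : H →ₗ[ℂ] M}
    (h : ∀ p x, f (b (idx (p, x))) = g (b (idx (p, x)))) : f = g := by
  refine b.ext fun i => ?_
  obtain ⟨⟨p, x⟩, rfl⟩ := idx.surjective i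
  exact h p x

/-- The classification of Hopf algebras with a positive basis. -/
theorem IsPositiveBasis.exists_bialgEquiv {H : Type u} [Ring H] [HopfAlgebra ℂ H] {ι : Type u}
    [Finite ι] {b : Module.Basis ι ℂ H} (hb : IsPositiveBasis b) :
    ∃ (G : Type u) (_ : Group G) (_ : Finite G) (F : UniqueFactorization G)
      (e : H ≃ₐc[ℂ] Bicross F) (σ : ι ≃ G) (c : ι → ℝ),
      ∀ i, 0 < c i ∧ e (b i) = (c i : ℂ) • Bicross.basis F (σ i) := by
  have := Fintype.ofFinite ι
  obtain ⟨G, _, _, F, idx, h⟩ := hb.support.exists_isBicross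
  obtain ⟨s, hs, hm, hc⟩ := hb.exists_scaling h
  have hs₀ : ∀ p x, (s p x : ℂ) ≠ 0 := fun p x => by exact_mod_cast (hs p x).ne'
  let B := ((Bicross.elBasis F).unitsSMul fun w => Units.mk0 (s w.1 w.2 : ℂ) (hs₀ _ _))
  let l : H ≃ₗ[ℂ] Bicross F := b.equiv B idx.symm
  have hl : ∀ p x, l (b (idx (p, x))) = (s p x : ℂ) • Bicross.el F p x := by
    intro p x
    simp only [l, Module.Basis.equiv_apply, Equiv.symm_apply_apply, B,
      Module.Basis.unitsSMul_apply, Bicross.elBasis_apply]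
    rfl
  have hmul : ∀ v w, l (v * w) = l v * l w := by
    intro v w
    have h₁ : (LinearMap.mul ℂ H).compr₂ l.toLinearMap =
        (LinearMap.mul ℂ (Bicross F)).compl₁₂ l.toLinearMap l.toLinearMap := by
      refine b.ext_of_equiv idx fun p x => b.ext_of_equiv idx fun q y => ?_
      simp only [LinearMap.compr₂_apply, LinearMap.compl₁₂_apply, LinearMap.mul_apply',
        LinearEquiv.coe_coe, hl, hb.basis_mul_basis h, smul_mul_smul_comm, Bicross.el_mul_el]
      split_ifs with hq
      · subst hq
        rw [map_smul, hl, smul_smul]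
        congr 1
        exact_mod_cast hm p x y
      · simp
    exact LinearMap.congr_fun (LinearMap.congr_fun h₁ v) w
  -- A surjective multiplicative map preserves the identity.
  have hone : l 1 = 1 := by
    obtain ⟨v, hv⟩ := l.surjective 1
    have h₁ := hmul 1 v
    rwa [one_mul, hv, mul_one, eq_comm] at h₁
  let a : H ≃ₐ[ℂ] Bicross F := AlgEquiv.ofLinearEquiv l hone hmul
  have ha : ∀ p x, a (b (idx (p, x))) = (s p x : ℂ) • Bicross.el F p x := hl
  refine ⟨G, inferInstance, inferInstance, F, BialgEquiv.ofAlgEquiv a ?_ ?_,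
    idx.symm.trans (Subgroup.IsComplement.equiv F.isComplement).symm,
    fun i => s (idx.symm i).1 (idx.symm i).2, fun i => ⟨hs _ _, ?_⟩⟩
  · refine AlgHom.toLinearMap_injective (b.ext_of_equiv idx fun p x => ?_)
    change Coalgebra.counit (R := ℂ) (a (b (idx (p, x)))) = Coalgebra.counit (R := ℂ) _
    rw [ha, map_smul, Bicross.counit_el]
    have h₁ := hb.counit_basis h p x
    have h₂ := hc 1 1 x
    rw [F.one_posOnNeg, mul_one] at h₂
    -- At `p = q = 1` the scaling relation reads `κ s² = s` with `κ` the coproduct factor, so `κ =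
    -- s⁻¹`; this makes the counits agree.
    have h₃ : (hb.comulFactor idx 1 1 x : ℂ) * s 1 x = 1 := by
      have h₄ : hb.comulFactor idx 1 1 x * s 1 x = 1 := by
        refine mul_right_cancel₀ (hs 1 x).ne' ?_
        rw [one_mul, mul_assoc, h₂]
      exact_mod_cast h₄
    split_ifs at h₁ ⊢ with hp
    · subst hp
      rw [smul_eq_mul, mul_one]
      have h₄ : (hb.comulFactor idx 1 1 x : ℂ) ≠ 0 := left_ne_zero_of_mul_eq_one h₃
      refine mul_right_cancel₀ h₄ ?_
      rw [h₁, mul_comm, h₃]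
    · rw [smul_zero]
      exact ((mul_eq_zero.1 h₁).resolve_right (left_ne_zero_of_mul_eq_one h₃)).symm
  · refine AlgHom.toLinearMap_injective (b.ext_of_equiv idx fun p x => ?_)
    change Algebra.TensorProduct.map (a : H →ₐ[ℂ] Bicross F) (a : H →ₐ[ℂ] Bicross F)
      (Coalgebra.comul (R := ℂ) (b (idx (p, x)))) =
        Coalgebra.comul (R := ℂ) (a (b (idx (p, x))))
    rw [ha, map_smul, Bicross.comul_el, hb.comul_basis h, map_sum, Finset.smul_sum]
    refine Finset.sum_congr rfl fun q _ => ?_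
    rw [map_smul, Algebra.TensorProduct.map_tmul]
    change _ • (a (b (idx _)) ⊗ₜ[ℂ] a (b (idx _))) = _
    rw [ha, ha, TensorProduct.smul_tmul_smul, smul_smul]
    congr 1
    have h₁ := hc (p * q⁻¹) q x
    rw [inv_mul_cancel_right] at h₁
    exact_mod_cast h₁
  · obtain ⟨⟨p, x⟩, rfl⟩ := idx.surjective i
    refine (ha p x).trans ?_
    change _ = ((s (idx.symm (idx (p, x))).1 (idx.symm (idx (p, x))).2 : ℝ) : ℂ) •
      Bicross.basis F ((Subgroup.IsComplement.equiv F.isComplement).symm (idx.symm (idx (p, x))))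
    rw [Equiv.symm_apply_apply]
    rfl

/-! ### Transport of triangular structures -/

namespace BialgEquiv

variable {H H' : Type u} [Ring H'] [HopfAlgebra ℂ H'] [Ring H] [HopfAlgebra ℂ H]

/-- The map `e ⊗ e`. -/
def tensor (e : H ≃ₐc[ℂ] H') : H ⊗[ℂ] H ≃ₗ[ℂ] H' ⊗[ℂ] H' :=
  TensorProduct.congr e.toCoalgEquiv.toLinearEquiv e.toCoalgEquiv.toLinearEquiv

/-- The map `e ⊗ e ⊗ e`. -/
def tensor₃ (e : H ≃ₐc[ℂ] H') : H ⊗[ℂ] (H ⊗[ℂ] H) ≃ₗ[ℂ] H' ⊗[ℂ] (H' ⊗[ℂ] H') :=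
  TensorProduct.congr e.toCoalgEquiv.toLinearEquiv e.tensor

variable (e : H ≃ₐc[ℂ] H')

theorem tensor_tmul (a b : H) : e.tensor (a ⊗ₜ[ℂ] b) = e a ⊗ₜ[ℂ] e b := rfl

theorem tensor₃_tmul (a : H) (z : H ⊗[ℂ] H) : e.tensor₃ (a ⊗ₜ[ℂ] z) = e a ⊗ₜ[ℂ] e.tensor z := rfl

theorem tensor_mul (z w : H ⊗[ℂ] H) : e.tensor (z * w) = e.tensor z * e.tensor w :=
  map_mul (Algebra.TensorProduct.congr (e : H ≃ₐ[ℂ] H') (e : H ≃ₐ[ℂ] H')) z w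

theorem tensor_one : e.tensor 1 = 1 :=
  map_one (Algebra.TensorProduct.congr (e : H ≃ₐ[ℂ] H') (e : H ≃ₐ[ℂ] H'))

theorem tensor₃_mul (z w : H ⊗[ℂ] (H ⊗[ℂ] H)) : e.tensor₃ (z * w) = e.tensor₃ z * e.tensor₃ w :=
  map_mul (Algebra.TensorProduct.congr (e : H ≃ₐ[ℂ] H')
    (Algebra.TensorProduct.congr (e : H ≃ₐ[ℂ] H') (e : H ≃ₐ[ℂ] H'))) z w

theorem tensor_comul (a : H) :
    e.tensor (Coalgebra.comul (R := ℂ) a) = Coalgebra.comul (R := ℂ) (e a) :=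
  CoalgHomClass.map_comp_comul_apply e a

theorem tensor_comm (z : H ⊗[ℂ] H) :
    e.tensor (TensorProduct.comm ℂ H H z) = TensorProduct.comm ℂ H' H' (e.tensor z) := by
  induction z with
  | zero => simp
  | add z w hz hw => simp only [map_add, hz, hw]
  | tmul a b => rfl

theorem tensor₃_assoc (z : H ⊗[ℂ] H) (b : H) :
    e.tensor₃ (TensorProduct.assoc ℂ H H H (z ⊗ₜ[ℂ] b)) =
      TensorProduct.assoc ℂ H' H' H' (e.tensor z ⊗ₜ[ℂ] e b) := by
  induction z with
  | zero => simp
  | add z w hz hw => simp only [map_add, TensorProduct.add_tmul, hz, hw]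
  | tmul a b => rfl

theorem tensor₃_leg₁₂ (z : H ⊗[ℂ] H) : e.tensor₃ (leg₁₂ z) = leg₁₂ (e.tensor z) := by
  rw [leg₁₂, tensor₃_assoc, map_one, leg₁₂]

theorem tensor₃_leg₁₃ (z : H ⊗[ℂ] H) : e.tensor₃ (leg₁₃ z) = leg₁₃ (e.tensor z) := by
  simp only [leg₁₃]
  induction z with
  | zero => simp
  | add z w hz hw => simp only [map_add, hz, hw]
  | tmul a b => simp [tensor_tmul, tensor₃_tmul]

theorem tensor₃_leg₂₃ (z : H ⊗[ℂ] H) : e.tensor₃ (leg₂₃ z) = leg₂₃ (e.tensor z) := by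
  rw [leg₂₃, tensor₃_tmul, map_one, leg₂₃]

theorem tensor₃_comul_left (z : H ⊗[ℂ] H) :
    e.tensor₃ (TensorProduct.assoc ℂ H H H (LinearMap.rTensor H (Coalgebra.comul (R := ℂ)) z)) =
      TensorProduct.assoc ℂ H' H' H'
        (LinearMap.rTensor H' (Coalgebra.comul (R := ℂ)) (e.tensor z)) := by
  induction z with
  | zero => simp
  | add z w hz hw => simp only [map_add, hz, hw]
  | tmul a b =>
    rw [tensor_tmul, LinearMap.rTensor_tmul, LinearMap.rTensor_tmul, tensor₃_assoc, tensor_comul]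

theorem tensor₃_comul_right (z : H ⊗[ℂ] H) :
    e.tensor₃ (LinearMap.lTensor H (Coalgebra.comul (R := ℂ)) z) =
      LinearMap.lTensor H' (Coalgebra.comul (R := ℂ)) (e.tensor z) := by
  induction z with
  | zero => simp
  | add z w hz hw => simp only [map_add, hz, hw]
  | tmul a b =>
    rw [tensor_tmul, LinearMap.lTensor_tmul, LinearMap.lTensor_tmul, tensor₃_tmul, tensor_comul]

theorem map_counit_left (z : H ⊗[ℂ] H) :
    e (TensorProduct.lid ℂ H (LinearMap.rTensor H (Coalgebra.counit (R := ℂ)) z)) =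
      TensorProduct.lid ℂ H' (LinearMap.rTensor H' (Coalgebra.counit (R := ℂ)) (e.tensor z)) := by
  induction z with
  | zero => simp
  | add z w hz hw => simp only [map_add, hz, hw]
  | tmul a b => simp [tensor_tmul]

theorem map_counit_right (z : H ⊗[ℂ] H) :
    e (TensorProduct.rid ℂ H (LinearMap.lTensor H (Coalgebra.counit (R := ℂ)) z)) =
      TensorProduct.rid ℂ H' (LinearMap.lTensor H' (Coalgebra.counit (R := ℂ)) (e.tensor z)) := by
  induction z with
  | zero => simp
  | add z w hz hw => simp only [map_add, hz, hw]
  | tmul a b => simp [tensor_tmul]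

end BialgEquiv

section Transport

variable {H H' : Type u} [Ring H] [HopfAlgebra ℂ H] [Ring H'] [HopfAlgebra ℂ H']

theorem IsTriangular.map (e : H ≃ₐc[ℂ] H') {R : H ⊗[ℂ] H} (h : IsTriangular R) :
    IsTriangular (e.tensor R) where
  exists_inv := by
    obtain ⟨S, h₁, h₂, h₃⟩ := h.exists_inv
    refine ⟨e.tensor S, ?_, ?_, fun g => ?_⟩
    · rw [← e.tensor_mul, h₁, e.tensor_one]
    · rw [← e.tensor_mul, h₂, e.tensor_one]
    · obtain ⟨g, rfl⟩ := EquivLike.surjective e g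
      rw [← e.tensor_comul, ← e.tensor_comm, h₃, e.tensor_mul, e.tensor_mul]
  comul_left := by
    rw [← e.tensor₃_comul_left, h.comul_left, e.tensor₃_mul, e.tensor₃_leg₁₃, e.tensor₃_leg₂₃]
  comul_right := by
    rw [← e.tensor₃_comul_right, h.comul_right, e.tensor₃_mul, e.tensor₃_leg₁₃, e.tensor₃_leg₁₂]
  counit_left := by rw [← e.map_counit_left, h.counit_left, map_one]
  counit_right := by rw [← e.map_counit_right, h.counit_right, map_one]
  comm_mul_self := by rw [← e.tensor_comm, ← e.tensor_mul, h.comm_mul_self, e.tensor_one]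

theorem IsPositiveTensor.map {ι ι' : Type u} [Finite ι] {b : Module.Basis ι ℂ H}
    {b' : Module.Basis ι' ℂ H'} {e : H ≃ₐc[ℂ] H'} {σ : ι → ι'} {c : ι → ℝ}
    (he : ∀ i, 0 < c i ∧ e (b i) = (c i : ℂ) • b' (σ i)) {R : H ⊗[ℂ] H}
    (hR : IsPositiveTensor b R) : IsPositiveTensor b' (e.tensor R) := fun i j => by
  refine IsNonneg.map (b := b.tensorProduct b) (c := b'.tensorProduct b')
    (f := e.tensor.toLinearMap) (fun w => ?_) (fun w => hR w.1 w.2) (i, j)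
  rw [Module.Basis.tensorProduct_apply', LinearEquiv.coe_coe, e.tensor_tmul, (he _).2, (he _).2]
  have hc : ∀ i, (0 : ℂ) ≤ c i := fun i => by exact_mod_cast (he i).1.le
  exact ((IsNonneg.self _).smul (hc _)).tmul ((IsNonneg.self _).smul (hc _))

end Transport

/-! ### Isomorphisms of factorizations and of Hopf algebras -/

namespace Bicross

variable {G G' : Type u} [Group G] [Group G'] {F : UniqueFactorization G}
  {F' : UniqueFactorization G'}

section OfMulEquiv

variable (f : G ≃* G') (hp : ∀ g, f g ∈ F'.pos ↔ g ∈ F.pos) (hn : ∀ g, f g ∈ F'.neg ↔ g ∈ F.neg)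

theorem posPow_restrict (p : F.pos) (x : F.neg) :
    F'.posPow (f.restrictSubgroups hp p) (f.restrictSubgroups hn x) =
      f.restrictSubgroups hp (F.posPow p x) := by
  refine F'.posBar_eq (f.restrictSubgroups hn (F.posOnNeg p x)) _ ?_
  change f p * f x = f _ * f _
  rw [← map_mul, ← map_mul, F.posOnNeg_mul_posPow]

theorem posOnNeg_restrict (p : F.pos) (x : F.neg) :
    F'.posOnNeg (f.restrictSubgroups hp p) (f.restrictSubgroups hn x) =
      f.restrictSubgroups hn (F.posOnNeg p x) := by
  refine F'.negBar_eq _ (f.restrictSubgroups hp (F.posPow p x)) ?_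
  change f p * f x = f _ * f _
  rw [← map_mul, ← map_mul, F.posOnNeg_mul_posPow]

theorem negPow_restrict (x : F.neg) (p : F.pos) :
    F'.negPow (f.restrictSubgroups hn x) (f.restrictSubgroups hp p) =
      f.restrictSubgroups hn (F.negPow x p) := by
  refine F'.negPart_eq (f.restrictSubgroups hp (F.negOnPos x p)) _ ?_
  change f x * f p = f _ * f _
  rw [← map_mul, ← map_mul, F.negOnPos_mul_negPow]

/-- The linear map `{g} ↦ {f g}`. -/
def linearEquivOfMulEquiv : Bicross F ≃ₗ[ℂ] Bicross F' := (basis F).equiv (basis F') f.toEquiv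

theorem linearEquivOfMulEquiv_basis (g : G) :
    linearEquivOfMulEquiv (F := F) (F' := F') f (basis F g) = basis F' (f g) :=
  (basis F).equiv_apply g (basis F') f.toEquiv

theorem linearEquivOfMulEquiv_el (p : F.pos) (x : F.neg) :
    linearEquivOfMulEquiv f (el F p x) =
      el F' (f.restrictSubgroups hp p) (f.restrictSubgroups hn x) := by
  rw [el, linearEquivOfMulEquiv_basis, map_mul]
  rfl

variable [Finite G'] [Finite G]

/-- The isomorphism `{g} ↦ {f g}` of Hopf algebras. -/
def bialgEquivOfMulEquiv : Bicross F ≃ₐc[ℂ] Bicross F' := by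
  have hl := linearEquivOfMulEquiv_el f hp hn
  refine BialgEquiv.ofAlgEquiv (AlgEquiv.ofLinearEquiv (linearEquivOfMulEquiv f) ?_ fun v w => ?_)
    ?_ ?_
  · rw [one_eq, one_eq, map_sum]
    refine Fintype.sum_equiv (f.restrictSubgroups hp).toEquiv _ _ fun p => ?_
    rw [hl, map_one]
    rfl
  · have h₁ : (LinearMap.mul ℂ (Bicross F)).compr₂ (linearEquivOfMulEquiv f).toLinearMap =
        (LinearMap.mul ℂ (Bicross F')).compl₁₂ (linearEquivOfMulEquiv f).toLinearMap
          (linearEquivOfMulEquiv f).toLinearMap := by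
      refine ext_el F fun p x => ext_el F fun q y => ?_
      simp only [LinearMap.compr₂_apply, LinearMap.compl₁₂_apply, LinearMap.mul_apply',
        LinearEquiv.coe_coe, hl, el_mul_el, posPow_restrict, EmbeddingLike.apply_eq_iff_eq]
      split_ifs
      · rw [hl, map_mul]
      · rw [map_zero]
    exact LinearMap.congr_fun (LinearMap.congr_fun h₁ v) w
  · refine AlgHom.toLinearMap_injective (ext_el F fun p x => ?_)
    change Coalgebra.counit (R := ℂ) (linearEquivOfMulEquiv f (el F p x)) =
      Coalgebra.counit (R := ℂ) (el F p x)
    rw [hl, counit_el, counit_el]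
    simp only [EmbeddingLike.map_eq_one_iff]
  · refine AlgHom.toLinearMap_injective (ext_el F fun p x => ?_)
    change TensorProduct.map (linearEquivOfMulEquiv (F := F) (F' := F') f).toLinearMap
      (linearEquivOfMulEquiv f).toLinearMap (Coalgebra.comul (R := ℂ) (el F p x)) =
        Coalgebra.comul (R := ℂ) (linearEquivOfMulEquiv f (el F p x))
    rw [hl, comul_el, comul_el, map_sum]
    refine Fintype.sum_equiv (f.restrictSubgroups hp).toEquiv _ _ fun q => ?_
    rw [TensorProduct.map_tmul, LinearEquiv.coe_coe, hl, hl, map_mul, map_inv,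
      ← posOnNeg_restrict f hp hn]
    rfl

theorem bialgEquivOfMulEquiv_basis (g : G) :
    bialgEquivOfMulEquiv f hp hn (basis F g) = basis F' (f g) :=
  linearEquivOfMulEquiv_basis f g

theorem bialgEquivOfMulEquiv_rMatrix {ξ : F.pos →* F.neg} {ξ' : F'.pos →* F'.neg}
    (hξ : ∀ p, f.restrictSubgroups hn (ξ p) = ξ' (f.restrictSubgroups hp p)) :
    (bialgEquivOfMulEquiv f hp hn).tensor (F.rMatrix ξ ξ) = F'.rMatrix ξ' ξ' := by
  have hl : ∀ p x, bialgEquivOfMulEquiv f hp hn (el F p x) = _ :=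
    linearEquivOfMulEquiv_el f hp hn
  simp only [rMatrix_eq_tens, tens, one_smul, map_sum]
  refine Fintype.sum_equiv (f.restrictSubgroups hp).toEquiv _ _ fun p =>
    Fintype.sum_equiv (f.restrictSubgroups hp).toEquiv _ _ fun q => ?_
  rw [BialgEquiv.tensor_tmul, hl, hl, map_inv, ← negPow_restrict f hp hn, hξ, hξ]
  rfl

end OfMulEquiv

end Bicross

/-- Every basis vector that occurs in a positive linear combination occurs in any other expression
of the same vector. -/
theorem Module.Basis.exists_index_eq {α β ι V : Type*} [Fintype α] [Fintype β] [AddCommGroup V]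
    [Module ℂ V] (b : Module.Basis ι ℂ V) {c : α → ℝ} (hc : ∀ a, 0 < c a) {d : β → ℂ}
    {f : α → ι} {g : β → ι} (h : ∑ a, (c a : ℂ) • b (f a) = ∑ a, d a • b (g a)) (a : α) :
    ∃ a', g a' = f a := by
  classical
  by_contra! h'
  have h₁ := congrArg (fun v => b.repr v (f a)) h
  simp only [map_sum, map_smul, Module.Basis.repr_self, Finsupp.coe_finsetSum, Finset.sum_apply,
    Finsupp.smul_apply, Finsupp.single_apply, smul_eq_mul, h', if_false, mul_zero,
    Finset.sum_const_zero] at h₁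
  have h₂ : ∀ i, (0 : ℂ) ≤ (c i : ℂ) * if f i = f a then 1 else 0 := fun i =>
    mul_nonneg (by exact_mod_cast (hc i).le) (by split_ifs <;> simp)
  rw [Finset.sum_eq_zero_iff_of_nonneg fun i _ => h₂ i] at h₁
  have h₃ := h₁ a (Finset.mem_univ a)
  rw [if_pos rfl, mul_one, Complex.ofReal_eq_zero] at h₃
  exact (hc a).ne' h₃

/-! ### The group isomorphism underlying an isomorphism of Hopf algebras -/

namespace Bicross

variable {G G' : Type u} [Group G] [Group G'] [Finite G] [Finite G'] {F : UniqueFactorization G}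
  {F' : UniqueFactorization G'} {e : Bicross F ≃ₐc[ℂ] Bicross F'} {σ : G ≃ G'} {c : G → ℝ}

/-- The elements of `G₊` index the basis vectors occurring in `1`, and `e` fixes `1`. -/
theorem index_mem_pos (he : ∀ g, 0 < c g ∧ e (basis F g) = (c g : ℂ) • basis F' (σ g))
    (p : F.pos) : σ p ∈ F'.pos := by
  have h₁ := map_one e
  rw [one_eq, one_eq, map_sum] at h₁
  simp only [el, (he _).2] at h₁
  obtain ⟨q, hq⟩ := (basis F').exists_index_eq (c := fun p : F.pos => c (p * (1 : F.neg)))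
    (fun p => (he _).1) (f := fun p : F.pos => σ (p * (1 : F.neg))) (d := fun _ => 1)
    (g := fun p : F'.pos => (p * (1 : F'.neg) : G')) (by simpa using h₁) p
  simp only [Subgroup.coe_one, mul_one] at hq
  exact hq ▸ q.2

theorem index_mem_pos_iff (he : ∀ g, 0 < c g ∧ e (basis F g) = (c g : ℂ) • basis F' (σ g))
    (g : G) : σ g ∈ F'.pos ↔ g ∈ F.pos := by
  refine ⟨fun hg => ?_, fun hg => index_mem_pos he ⟨g, hg⟩⟩
  have he' : ∀ g, 0 < (c (σ.symm g))⁻¹ ∧ e.symm (basis F' g) =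
      (((c (σ.symm g))⁻¹ : ℝ) : ℂ) • basis F (σ.symm g) := by
    intro g
    obtain ⟨g, rfl⟩ := σ.surjective g
    have h₁ : (c g : ℂ) ≠ 0 := by exact_mod_cast (he g).1.ne'
    rw [σ.symm_apply_apply]
    refine ⟨inv_pos.2 (he g).1, EquivLike.injective e ?_⟩
    rw [map_smul, (he g).2, smul_smul, Complex.ofReal_inv, inv_mul_cancel₀ h₁, one_smul,
      BialgEquiv.apply_symm_apply]
  have h₁ := index_mem_pos he' ⟨σ g, hg⟩
  rwa [σ.symm_apply_apply] at h₁

/-- The elements of `G₋` index the basis vectors with non-zero counit, and `e` preserves the counit.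
-/
theorem index_mem_neg_iff (he : ∀ g, 0 < c g ∧ e (basis F g) = (c g : ℂ) • basis F' (σ g))
    (g : G) : σ g ∈ F'.neg ↔ g ∈ F.neg := by
  have hF : ∀ {G : Type u} [Group G] (F : UniqueFactorization G) (g : G),
      F.posPart g = 1 ↔ g ∈ F.neg := by
    intro G _ F g
    constructor
    · intro h
      rw [← F.posPart_mul_negPart g, h, Subgroup.coe_one, one_mul]
      exact (F.negPart g).2
    · intro h
      exact F.posPart_eq 1 ⟨g, h⟩ (by simp)
  have h₁ : Coalgebra.counit (R := ℂ) (e (basis F g)) = Coalgebra.counit (R := ℂ) (basis F g) :=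
    CoalgHomClass.counit_comp_apply e _
  have h₂ : (c g : ℂ) ≠ 0 := by exact_mod_cast (he g).1.ne'
  rw [(he g).2, map_smul, basis_eq_el, basis_eq_el, counit_el, counit_el] at h₁
  rw [← hF, ← hF]
  by_cases h₃ : F.posPart g = 1 <;> by_cases h₄ : F'.posPart (σ g) = 1 <;> simp_all

theorem index_mul_negPart (he : ∀ g, 0 < c g ∧ e (basis F g) = (c g : ℂ) • basis F' (σ g))
    {g h : G} (hgh : F.posPow (F.posPart g) (F.negPart g) = F.posPart h) :
    F'.posPow (F'.posPart (σ g)) (F'.negPart (σ g)) = F'.posPart (σ h) ∧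
      σ (g * F.negPart h) = σ g * F'.negPart (σ h) := by
  have hm : ∀ {G : Type u} [Group G] [Finite G] (F : UniqueFactorization G) (g h : G),
      basis F g * basis F h = if F.posPow (F.posPart g) (F.negPart g) = F.posPart h then
        basis F (g * F.negPart h) else 0 := by
    intro G _ _ F g h
    rw [basis_eq_el, basis_eq_el F h, el_mul_el, el, Subgroup.coe_mul, ← mul_assoc,
      F.posPart_mul_negPart]
  have h₁ := map_mul e (basis F g) (basis F h)
  rw [hm, if_pos hgh, (he _).2, (he _).2, (he _).2, smul_mul_smul_comm, hm] at h₁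
  have h₂ : (c (g * F.negPart h) : ℂ) ≠ 0 := by exact_mod_cast (he _).1.ne'
  split_ifs at h₁ with h₃
  · refine ⟨h₃, ?_⟩
    obtain ⟨-, h₄⟩ := (basis F').exists_index_eq (α := Unit) (β := Unit)
      (c := fun _ => c (g * F.negPart h)) (fun _ => (he _).1)
      (d := fun _ => (c g * c h : ℂ)) (f := fun _ => σ (g * F.negPart h))
      (g := fun _ => σ g * F'.negPart (σ h)) (by simpa using h₁) ()
    exact h₄.symm
  · rw [smul_zero, smul_eq_zero] at h₁
    exact absurd h₁ (not_or.2 ⟨h₂, (basis F').ne_zero _⟩)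

theorem index_comul (he : ∀ g, 0 < c g ∧ e (basis F g) = (c g : ℂ) • basis F' (σ g))
    (p q : F.pos) (x : F.neg) :
    F'.negPart (σ (p * F.posOnNeg q x)) =
        F'.posOnNeg (F'.posPart (σ (q * x))) (F'.negPart (σ (q * x))) ∧
      σ (p * q * x) = F'.posPart (σ (p * F.posOnNeg q x)) * σ (q * x) := by
  have h₁ : e.tensor (Coalgebra.comul (R := ℂ) (el F (p * q) x)) =
      Coalgebra.comul (R := ℂ) (e (basis F ((p * q : F.pos) * x))) := e.tensor_comul _
  rw [comul_el, map_sum, (he _).2, map_smul, basis_eq_el, comul_el, Finset.smul_sum] at h₁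
  simp only [BialgEquiv.tensor_tmul, el, (he _).2, TensorProduct.smul_tmul_smul] at h₁
  obtain ⟨r, hr⟩ := ((basis F').tensorProduct (basis F')).exists_index_eq
    (c := fun h : F.pos => c ((p * q * h⁻¹ : F.pos) * F.posOnNeg h x) * c (h * x))
    (fun _ => mul_pos (he _).1 (he _).1)
    (f := fun h : F.pos => (σ ((p * q * h⁻¹ : F.pos) * F.posOnNeg h x), σ (h * x)))
    (d := fun _ => (c ((p * q : F.pos) * x) : ℂ))
    (g := fun h : F'.pos => (((F'.posPart (σ ((p * q : F.pos) * x)) * h⁻¹ : F'.pos) *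
      F'.posOnNeg h (F'.negPart (σ ((p * q : F.pos) * x))) : G'),
      (h * F'.negPart (σ ((p * q : F.pos) * x)) : G')))
    (by simpa only [Module.Basis.tensorProduct_apply, Complex.ofReal_mul] using h₁) q
  rw [mul_inv_cancel_right] at hr
  obtain ⟨h₂, h₃⟩ := Prod.mk.inj hr
  rw [← h₂, ← h₃, F'.negPart_mul, F'.posPart_mul, F'.negPart_mul, F'.posPart_mul]
  refine ⟨rfl, ?_⟩
  rw [Subgroup.coe_mul, Subgroup.coe_inv, ← mul_assoc, inv_mul_cancel_right,
    F'.posPart_mul_negPart, Subgroup.coe_mul]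

/-- The product of the Hopf algebra gives multiplicativity on `G₋`, the coproduct gives it on `G₊`,
and both together on products `p x`. For products `x p`, one checks that `σ` respects the two
actions and uses `u x = (ᵘx)(uˣ)`. -/
theorem index_mul (he : ∀ g, 0 < c g ∧ e (basis F g) = (c g : ℂ) • basis F' (σ g))
    (g h : G) : σ (g * h) = σ g * σ h := by
  have hpos := fun p => F'.posPart_eq (g := σ (p : F.pos)) ⟨σ p, index_mem_pos he p⟩ 1 (by simp)
  have hpos' := fun p => F'.negPart_eq (g := σ (p : F.pos)) ⟨σ p, index_mem_pos he p⟩ 1 (by simp)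
  have hneg := fun x : F.neg => F'.posPart_eq (g := σ x) 1 ⟨σ x, (index_mem_neg_iff he x).2 x.2⟩
    (by simp)
  have hneg' := fun x : F.neg => F'.negPart_eq (g := σ x) 1 ⟨σ x, (index_mem_neg_iff he x).2 x.2⟩
    (by simp)
  have h₁ : ∀ (p : F.pos) (x : F.neg), σ (p * x) = σ p * σ x := by
    intro p x
    have h₂ := (index_mul_negPart he (g := p) (h := p * x) (by
      rw [F.posPart_mul, F.posPart_eq p 1 (by simp), F.negPart_eq p 1 (by simp), F.posPow_one])).2
    have h₃ := (index_comul he p 1 x).2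
    rw [F.negPart_mul] at h₂
    rw [F.one_posOnNeg, h₂, Subgroup.coe_one, mul_one, one_mul,
      F'.posPart_eq ⟨σ p, index_mem_pos he p⟩ (F'.negPart (σ (p * x))) rfl, h₂] at h₃
    rw [h₂, h₃]
  have h₂ : ∀ x y : F.neg, σ (x * y) = σ x * σ y := by
    intro x y
    have h₃ := (index_mul_negPart he (g := x) (h := y) (by
      rw [F.posPart_eq 1 x (by simp), F.posPart_eq 1 y (by simp), F.one_posPow])).2
    rwa [F.negPart_eq 1 y (by simp), hneg'] at h₃
  have h₃ : ∀ p q : F.pos, σ (p * q) = σ p * σ q := by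
    intro p q
    have h₄ := (index_comul he p q 1).2
    simpa only [F.posOnNeg_one, Subgroup.coe_one, mul_one, hpos] using h₄
  have h₄ : ∀ (p : F.pos) (x : F.neg), σ p * σ x = σ (F.posOnNeg p x) * σ (F.posPow p x) := by
    intro p x
    -- `h₅` identifies the image of `ᵖx` and `h₆` that of `pˣ` with the actions of `σ p` and `σ x`
    -- on each other.
    have h₅ := (index_comul he 1 p x).1
    have h₆ := (index_mul_negPart he (g := p * x) (h := F.posPow p x) (by
      rw [F.posPart_mul, F.negPart_mul, F.posPart_eq (F.posPow p x) 1 (by simp)])).1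
    have h₇ := h₁ p x
    have h₈ := F'.posPart_eq (g := σ (p * x)) ⟨σ p, index_mem_pos he p⟩
      ⟨σ x, (index_mem_neg_iff he x).2 x.2⟩ h₇
    have h₉ := F'.negPart_eq (g := σ (p * x)) ⟨σ p, index_mem_pos he p⟩
      ⟨σ x, (index_mem_neg_iff he x).2 x.2⟩ h₇
    rw [Subgroup.coe_one, one_mul, hneg', h₈, h₉] at h₅
    rw [hpos, h₈, h₉] at h₆
    have h₁₀ := F'.posOnNeg_mul_posPow ⟨σ p, index_mem_pos he p⟩
      ⟨σ x, (index_mem_neg_iff he x).2 x.2⟩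
    rw [← h₅, h₆] at h₁₀
    exact h₁₀.symm
  have h₅ : ∀ (x : F.neg) (p : F.pos), σ (x * p) = σ x * σ p := by
    intro x p
    have h₆ := h₄ (F.negOnPos x p) (F.negPow x p)
    rwa [F.posOnNeg_negOnPos, F.posPow_negOnPos, ← h₁, F.negOnPos_mul_negPow] at h₆
  rw [← F.posPart_mul_negPart g, ← F.posPart_mul_negPart h]
  generalize F.posPart g = p, F.negPart g = x, F.posPart h = q, F.negPart h = y
  have h₆ : (p * x * (q * y) : G) =
      ((p * F.negOnPos x q : F.pos) : G) * ((F.negPow x q * y : F.neg) : G) := by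
    rw [Subgroup.coe_mul, Subgroup.coe_mul, mul_assoc, mul_assoc, ← mul_assoc (F.negOnPos x q : G),
      F.negOnPos_mul_negPow, mul_assoc]
  rw [h₆, h₁, Subgroup.coe_mul, Subgroup.coe_mul, h₂, h₃, h₁, h₁, mul_assoc, mul_assoc,
    ← mul_assoc (σ (F.negOnPos x q)), ← h₁, F.negOnPos_mul_negPow, h₅, mul_assoc]

/-- The term of `R` for the pair `(p, 1)` is `{p} ⊗ {ξ(p)}`; its image has to be a term of the same
form, which names `ξ'` at `σ p`. -/
theorem index_hom (he : ∀ g, 0 < c g ∧ e (basis F g) = (c g : ℂ) • basis F' (σ g))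
    {ξ : F.pos →* F.neg} {ξ' : F'.pos →* F'.neg}
    (hR : e.tensor (F.rMatrix ξ ξ) = F'.rMatrix ξ' ξ') (p : F.pos) :
    σ (ξ p) = ξ' ⟨σ p, index_mem_pos he p⟩ := by
  simp only [UniqueFactorization.rMatrix, map_sum, BialgEquiv.tensor_tmul, (he _).2,
    TensorProduct.smul_tmul_smul, ← Fintype.sum_prod_type'] at hR
  obtain ⟨⟨q, r⟩, h⟩ := ((basis F').tensorProduct (basis F')).exists_index_eq
    (c := fun w : F.pos × F.pos => c (w.1 * (F.negPow (ξ w.2) w.1 : G)⁻¹) * c (w.2 * ξ w.1))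
    (fun _ => mul_pos (he _).1 (he _).1)
    (f := fun w : F.pos × F.pos => (σ (w.1 * (F.negPow (ξ w.2) w.1 : G)⁻¹), σ (w.2 * ξ w.1)))
    (d := fun _ => 1)
    (g := fun w : F'.pos × F'.pos => (w.1 * (F'.negPow (ξ' w.2) w.1 : G')⁻¹, (w.2 * ξ' w.1 : G')))
    (by simpa only [Module.Basis.tensorProduct_apply, Complex.ofReal_mul, one_smul] using hR)
    (p, 1)
  obtain ⟨h₁, h₂⟩ := Prod.mk.inj h
  simp only [map_one, F.one_negPow, Subgroup.coe_one, inv_one, mul_one, one_mul] at h₁ h₂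
  have h₃ : q = ⟨σ p, index_mem_pos he p⟩ := (F'.factor_inj (x := (F'.negPow (ξ' r) q)⁻¹) (y := 1)
    (by simpa using h₁)).1
  have h₄ := (F'.factor_inj (p := r) (x := ξ' q) (q := 1)
    (y := ⟨σ (ξ p), (index_mem_neg_iff he _).2 (ξ p).2⟩) (by simpa using h₂)).2
  rw [← h₃, h₄]

theorem exists_mulEquiv (he : ∀ g, 0 < c g ∧ e (basis F g) = (c g : ℂ) • basis F' (σ g))
    {ξ : F.pos →* F.neg} {ξ' : F'.pos →* F'.neg}
    (hR : e.tensor (F.rMatrix ξ ξ) = F'.rMatrix ξ' ξ') :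
    ∃ f : G ≃* G', (∀ g, f g ∈ F'.pos ↔ g ∈ F.pos) ∧ (∀ g, f g ∈ F'.neg ↔ g ∈ F.neg) ∧
      ∀ (p : F.pos) (q : F'.pos), f p = q → f (ξ p) = ξ' q := by
  refine ⟨⟨σ, index_mul he⟩, index_mem_pos_iff he, index_mem_neg_iff he, fun p q hpq => ?_⟩
  obtain rfl : ⟨σ p, index_mem_pos he p⟩ = q := Subtype.ext hpq
  exact index_hom he hR p

end Bicross

/-! ### The correspondence with Hopf algebras -/

/-- From the second kind of data: `H(G; G₊, G₋)` with the basis `G` and the triangular structure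
given by `ξ`. -/
def AbelianFact.toPosTriHopf (X : AbelianFact.{u}) : PosTriHopf.{u} where
  H := Bicross X.1.F
  ι := X.1.G
  b := Bicross.basis X.1.F
  R := X.1.F.rMatrix X.1.ξ X.1.ξ
  isPositiveBasis := Bicross.isPositiveBasis
  isTriangular := Bicross.isTriangular_rMatrix X.2.isBraided
  isPositiveTensor := Bicross.isPositiveTensor_rMatrix X.1.ξ X.1.ξ

theorem AbelianFact.toPosTriHopf_iso_iff (X Y : AbelianFact.{u}) :
    PosTriHopf.Iso X.toPosTriHopf Y.toPosTriHopf ↔ FactHom.Iso X.1 Y.1 := by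
  constructor
  · rintro ⟨e, ⟨σ, c, he⟩, hR⟩
    exact Bicross.exists_mulEquiv (G := X.1.G) (G' := Y.1.G) (e := e) (σ := σ) (c := c) he hR
  · rintro ⟨f, hp, hn, hξ⟩
    exact ⟨Bicross.bialgEquivOfMulEquiv f hp hn, ⟨f.toEquiv, fun _ => 1, fun g =>
      ⟨one_pos, by
        refine (Bicross.bialgEquivOfMulEquiv_basis f hp hn g).trans ?_
        rw [Complex.ofReal_one, one_smul]
        rfl⟩⟩,
      Bicross.bialgEquivOfMulEquiv_rMatrix f hp hn fun p => Subtype.ext (hξ p _ rfl)⟩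

/-- Transport `R` along the isomorphism that straightens the basis. It stays triangular and
positive, so the classification on `H(G; G₊, G₋)` applies. -/
theorem PosTriHopf.exists_iso (Y : PosTriHopf.{u}) :
    ∃ X : AbelianFact.{u}, PosTriHopf.Iso X.toPosTriHopf Y := by
  obtain ⟨G, _, _, F, e, σ, c, he⟩ := Y.isPositiveBasis.exists_bialgEquiv
  obtain ⟨ξ, hξ, hR⟩ := Bicross.exists_isBraided_of_isTriangular (Y.isTriangular.map e)
    (Y.isPositiveTensor.map he)
  exact ⟨⟨{ G := G, F := F, ξ := ξ }, hξ.isAbelianNormal⟩,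
    PosTriHopf.setoid.symm ⟨e, ⟨σ, c, he⟩, hR.symm⟩⟩

/-- The correspondence of the second kind of data with Hopf algebras. -/
def abelianHopfEquiv : Quotient AbelianFact.setoid.{u} ≃ Quotient PosTriHopf.setoid.{u} :=
  Equiv.ofBijective
    (Quotient.map AbelianFact.toPosTriHopf fun X Y h => (X.toPosTriHopf_iso_iff Y).2 h) (by
      constructor
      · rintro ⟨X⟩ ⟨Y⟩ h
        exact Quotient.sound ((X.toPosTriHopf_iso_iff Y).1 (Quotient.exact h))
      · rintro ⟨Y⟩
        obtain ⟨X, hX⟩ := Y.exists_iso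
        exact ⟨⟦X⟧, Quotient.sound hX⟩)

end

/-- The four kinds of data correspond bijectively up to isomorphism, through the explicit
constructions; moreover, on a fixed unique factorization, `ξ ↦ R` is a bijection onto the positive
triangular structures, the second and third conditions on `ξ` agree, and the structure given by a
pair `(ξ, η)` is triangular exactly when `ξ = η`. -/
theorem theorem4 :
    (∃ (e₂₁ : Quotient AbelianFact.setoid.{u} ≃ Quotient PosTriHopf.setoid.{u})
        (e₂₃ : Quotient AbelianFact.setoid.{u} ≃ Quotient BraidedFact.setoid.{u})
        (e₂₄ : Quotient AbelianFact.setoid.{u} ≃ Quotient CycleData.setoid.{u}),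
      (∀ X : AbelianFact.{u},
        ∃ (hb : IsPositiveBasis (Bicross.basis X.1.F))
          (hR : IsTriangular (X.1.F.rMatrix X.1.ξ X.1.ξ))
          (hp : IsPositiveTensor (Bicross.basis X.1.F) (X.1.F.rMatrix X.1.ξ X.1.ξ)),
          e₂₁ ⟦X⟧ = ⟦{ H := Bicross X.1.F, ι := X.1.G, b := Bicross.basis X.1.F,
                       R := X.1.F.rMatrix X.1.ξ X.1.ξ, isPositiveBasis := hb,
                       isTriangular := hR, isPositiveTensor := hp }⟧) ∧
      (∀ X : AbelianFact.{u}, ∃ h : X.1.F.IsBraided X.1.ξ, e₂₃ ⟦X⟧ = ⟦⟨X.1, h⟩⟧) ∧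
      (∀ X : AbelianFact.{u}, e₂₄ ⟦X⟧ = ⟦X.toCycleData⟧) ∧
      (∀ Y : CycleData.{u}, ∃ h : Y.toFactHom.F.IsAbelianNormal Y.toFactHom.ξ,
        e₂₄.symm ⟦Y⟧ = ⟦⟨Y.toFactHom, h⟩⟧)) ∧
    (∀ (G : Type u) [Group G] [Finite G] (F : UniqueFactorization G),
      Set.BijOn (fun ξ => F.rMatrix ξ ξ) {ξ | F.IsAbelianNormal ξ}
        {R | IsTriangular R ∧ IsPositiveTensor (Bicross.basis F) R} ∧
      (∀ ξ : F.pos →* F.neg, F.IsAbelianNormal ξ ↔ F.IsBraided ξ) ∧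
      (∀ ξ η : F.pos →* F.neg, F.IsQuasiTriangularPair ξ η →
        (IsTriangular (F.rMatrix ξ η) ↔ ξ = η))) := by
  refine ⟨⟨abelianHopfEquiv, abelianBraidedEquiv, abelianCycleEquiv,
    fun X => ⟨Bicross.isPositiveBasis, Bicross.isTriangular_rMatrix X.2.isBraided,
      Bicross.isPositiveTensor_rMatrix _ _, rfl⟩, fun X => ⟨X.2.isBraided, rfl⟩, fun X => rfl,
    fun Y => ⟨Y.toFactHom_isAbelianNormal, rfl⟩⟩, ?_⟩
  intro G _ _ F
  exact ⟨Bicross.bijOn_rMatrix F, fun ξ => UniqueFactorization.isAbelianNormal_iff_isBraided,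
    fun ξ η h => Bicross.isTriangular_rMatrix_iff h⟩
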